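/- **Setting.** Let $\mathbb R^4_1$ be $\mathbb R^4$ with $\langle v,w\rangle=v_1w_1+v_2w_2+v_3w_3-v_4w_4$. For $\lambda\in\mathbb C\setminus\{0,1\}$ let $T_\lambda$ be the elliptic curve $y^2=x(x-1)(x-\lambda)$ together with its point at infinity $P$, and let $dz=dx/y$; thus $T_\lambda\cong\mathbb C/\Lambda$ for a lattice $\Lambda$, with coordinate $z$ and $P\leftrightarrow 0$. Put $$\rho=\frac{\sqrt6\,\Gamma(3/4)}{\Gamma(1/4)} .$$ For parameters $b,c,l,m,x_0,y_0,\lambda\in\mathbb C$ with $b,l\neq0$, $\lambda\ne 0,1$ and $y_0^2=x_0(x_0-1)(x_0-\lambda)$, consider on $T_\lambda$ the data $$\phi=\frac{x-x_0}{b(y-y_0)+c(x-x_0)},\qquad \psi=\frac{l(y+y_0)+m(x-x_0)}{x-x_0},\qquad dh=\bigl[b(y-y_0)+c(x-x_0)\bigr]dz .$$ The Chen–Gackstatter surface is the surface in $\mathbb R^3=\{X_4=0\}$ given on $T_{-1}\setminus\{P\}$ by $$X=2\,\mathrm{Re}\int\bigl(\phi+\psi,\,-i(\phi-\psi),\,1-\phi\psi,\,1+\phi\psi\bigr)dh\qquad(*)$$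 with $\phi=G=\frac{x}{\rho y}$, $\psi=-1/G$, $dh=dx$. **Theorem.** There are a connected open neighbourhood $B$ of $0$ in $\mathbb R^4$, a smooth map $$t\mapsto v(t)=(b,c,l,m,y_0,\lambda)(t)\in\mathbb C^6$$ on $B$ that is an immersion and a homeomorphism onto its image, a smooth function $x_0(t)$, period lattices $\Lambda_t$ of $T_{\lambda(t)}$ with generators depending smoothly on $t$, and maps $X_t:M_t=T_{\lambda(t)}\setminus\{P\}\to\mathbb R^4_1$, jointly smooth in $t$ and $z$, such that: 1. For $t=0$: $x_0(0)=0$, $v(0)=(\rho,0,-\rho,0,0,-1)$, and $\rho^{-1}X_0$ is the Chen–Gackstatter surface. 2. For every $t\in B$ the parameters satisfy the conditions above, and the corresponding $\phi,\psi,dh$ are regular: $\phi\neq\overline\psi$ in $\mathbb C\cup\{\infty\}$ at every point of the compact torus $T_{\lambda(t)}$ (the end $P$ included), and on $M_t$ the form $dh$ is holomorphic with zeros exactly at the poles of $\phi$ or $\psi$, with the same order. The map $X_t$ is given on $M_t$ by the (single-valued) formula $(*)$. 3. For every $t\in B$, $X_t$ is a complete algebraic stationary surface: a smooth conformal spacelike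 immersion with zero mean curvature vector and complete induced metric, with Weierstrass data meromorphic on the compact torus. It has genus one and the single end $P$; its Gaussian curvature is integrable, with $-\int_{M_t}K\,dM=8\pi$; and both Gauss maps have order $1$ at the end: $\phi$ has a simple zero and $\psi$ a simple pole at $P$. 4. The family is effective: if $s,t\in B$ and $X_t\circ f=rX_s+w$ for some $r>0$, $w\in\mathbb R^4_1$ and some biholomorphic map $f:M_s\to M_t$ (that is, a map induced by $z\mapsto\alpha z$ with $\alpha\Lambda_s=\Lambda_t$, $\alpha\neq0$), then $s=t$. -/

import Mathlib

open scoped ContDiff Topology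
open MeasureTheory Filter Set

noncomputable section

namespace StationarySurface

/-! ### Lorentz-Minkowski space and surfaces in it

A punctured torus is written as `M = (ℂ ∖ Λ) / Λ`, where `Λ = L.lattice` is the lattice of a period
pair `L`; its compactification is the genus one Riemann surface `ℂ / Λ` and its only end is the
class `P` of `0`.  A map from `M` is a `Λ`-periodic map on `ℂ ∖ Λ` (values on `Λ` are ignored), and
the coordinate `u + i v` of `ℂ` is a local conformal coordinate of `M`. -/

/-- The vector space underlying `ℝ⁴₁`. -/
abbrev Mink : Type := Fin 4 → ℝ

/-- The Lorentz inner product of signature `(+,+,+,-)`. -/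
def lorentz (v w : Mink) : ℝ := v 0 * w 0 + v 1 * w 1 + v 2 * w 2 - v 3 * w 3

/-- Coefficient `g (a, b)` of the metric induced by `X` at `z`. -/
def inducedMetric (X : ℂ → Mink) (z a b : ℂ) : ℝ :=
  lorentz (fderiv ℝ X z a) (fderiv ℝ X z b)

/-- `EG - F²` in the coordinates `u + i v`. -/
def metricDet (X : ℂ → Mink) (z : ℂ) : ℝ :=
  inducedMetric X z 1 1 * inducedMetric X z Complex.I Complex.I - inducedMetric X z 1 Complex.I ^ 2

/-- The component of `w` normal (for the Lorentz product) to the tangent plane of `X` at `z`. -/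
def normalPart (X : ℂ → Mink) (z : ℂ) (w : Mink) : Mink :=
  let Xu := fderiv ℝ X z 1
  let Xv := fderiv ℝ X z Complex.I
  let E := inducedMetric X z 1 1
  let F := inducedMetric X z 1 Complex.I
  let G := inducedMetric X z Complex.I Complex.I
  w - ((G * lorentz w Xu - F * lorentz w Xv) / metricDet X z) • Xu
    - ((E * lorentz w Xv - F * lorentz w Xu) / metricDet X z) • Xv

/-- The second fundamental form: normal part of the second derivative. -/
def secondFundamentalForm (X : ℂ → Mink) (z a b : ℂ) : Mink :=
  normalPart X z (fderiv ℝ (fun w => fderiv ℝ X w a) z b)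

/-- The mean curvature vector: half the trace of the second fundamental form with respect to the
induced metric. -/
def meanCurvature (X : ℂ → Mink) (z : ℂ) : Mink :=
  let E := inducedMetric X z 1 1
  let F := inducedMetric X z 1 Complex.I
  let G := inducedMetric X z Complex.I Complex.I
  (1 / (2 * metricDet X z)) •
    (G • secondFundamentalForm X z 1 1 - (2 * F) • secondFundamentalForm X z 1 Complex.I
      + E • secondFundamentalForm X z Complex.I Complex.I)

/-- Gaussian curvature of the induced metric `E (du² + dv²)` of a conformal immersion,
`K = -Δ (log E) / (2 E)`. -/
def gaussCurvature (X : ℂ → Mink) (z : ℂ) : ℝ :=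
  -(Laplacian.laplacian (fun w => Real.log (inducedMetric X w 1 1)) z)
    / (2 * inducedMetric X z 1 1)

/-- The integrand of `∫ K dM`: curvature times area density. -/
def curvatureDensity (X : ℂ → Mink) (z : ℂ) : ℝ :=
  gaussCurvature X z * Real.sqrt (metricDet X z)

/-- The total curvature `∫_M K dM` exists and equals `κ`; the integral over `M` is an integral over
a fundamental parallelogram of the lattice. -/
def HasTotalCurvature (L : PeriodPair) (X : ℂ → Mink) (κ : ℝ) : Prop :=
  IntegrableOn (curvatureDensity X) (ZSpan.fundamentalDomain L.basis) ∧
    ∫ z in ZSpan.fundamentalDomain L.basis, curvatureDensity X z = κ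

/-- Completeness of the induced metric of `X` on `M`: each `C¹` path `γ : [0,1) → M` that leaves
every compact subset of `M` has infinite length.  (The sets
`{dist (z, Λ) ≥ ε}` modulo `Λ` exhaust `M` by compact sets.) -/
def IsCompleteSurface (L : PeriodPair) (X : ℂ → Mink) : Prop :=
  ∀ γ : ℝ → ℂ, ContDiffOn ℝ 1 γ (Ico 0 1) → (∀ t ∈ Ico (0 : ℝ) 1, γ t ∉ L.lattice) →
    Tendsto (fun t => Metric.infDist (γ t) (L.lattice : Set ℂ)) (𝓝[<] 1) (𝓝 0) →
    ∫⁻ t in Ioo (0 : ℝ) 1,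
      ENNReal.ofReal (Real.sqrt (inducedMetric X (γ t) (deriv γ t) (deriv γ t))) = ⊤

/-- `X : M → ℝ⁴₁` is a complete stationary surface: a smooth conformal spacelike immersion with zero
mean curvature vector and complete induced metric. -/
structure IsCompleteStationary (L : PeriodPair) (X : ℂ → Mink) : Prop where
  periodic : ∀ z, z ∉ L.lattice → ∀ per ∈ L.lattice, X (z + per) = X z
  smooth : ContDiffOn ℝ ∞ X (L.lattice : Set ℂ)ᶜ
  spacelike : ∀ z, z ∉ L.lattice → ∀ a : ℂ, a ≠ 0 → 0 < inducedMetric X z a a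
  conformal : ∀ z, z ∉ L.lattice → inducedMetric X z 1 1 = inducedMetric X z Complex.I Complex.I ∧
    inducedMetric X z 1 Complex.I = 0
  stationary : ∀ z, z ∉ L.lattice → meanCurvature X z = 0
  complete : IsCompleteSurface L X

/-! ### Weierstrass data -/

/-- Value in `ℂ ∪ {∞}` of a meromorphic function (removable singularities are filled in, so the
value that the Lean function takes at the point itself plays no role). -/
def sphereValue (f : ℂ → ℂ) (z : ℂ) : OnePoint ℂ :=
  open Classical in
  if meromorphicOrderAt f z < 0 then OnePoint.infty else ((limUnder (𝓝[≠] z) f : ℂ) : OnePoint ℂ)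

/-- Complex conjugation on `ℂ ∪ {∞}`. -/
def sphereConj : OnePoint ℂ → OnePoint ℂ := OnePoint.map (starRingEnd ℂ)

/-- The vector of one-forms `(φ + ψ, -i (φ - ψ), 1 - φψ, 1 + φψ) dh`, where `dh = h dz`. -/
def weierstrassForm (φ ψ h : ℂ → ℂ) (z : ℂ) : Fin 4 → ℂ :=
  ![(φ z + ψ z) * h z, -Complex.I * (φ z - ψ z) * h z,
    (1 - φ z * ψ z) * h z, (1 + φ z * ψ z) * h z]

/-- `f` is a meromorphic function on the compact torus `ℂ / Λ`. -/
def IsElliptic (L : PeriodPair) (f : ℂ → ℂ) : Prop :=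
  Meromorphic f ∧ ∀ per ∈ L.lattice, ∀ z, f (z + per) = f z

/-- `X = 2 Re ∫ (φ + ψ, -i (φ - ψ), 1 - φψ, 1 + φψ) dh` with `dh = h dz`, as a single valued map on
`M = ℂ / Λ - {P}`, for data that are meromorphic on the compact torus (algebraic type) and regular
everywhere, the end included. -/
structure IsAlgebraicRepresentation (L : PeriodPair) (φ ψ h : ℂ → ℂ) (X : ℂ → Mink) : Prop where
  elliptic_phi : IsElliptic L φ
  elliptic_psi : IsElliptic L ψ
  elliptic_h : IsElliptic L h
  /-- `φ ≠ conj ψ` as points of `ℂ ∪ {∞}`; in particular their poles do not coincide. -/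
  regular : ∀ z, sphereValue φ z ≠ sphereConj (sphereValue ψ z)
  /-- On `M` the form `dh` is holomorphic and its zeros are the poles of `φ` or `ψ`, with the same
  order. -/
  zeros : ∀ z, z ∉ L.lattice →
    meromorphicOrderAt h z + min 0 (min (meromorphicOrderAt φ z) (meromorphicOrderAt ψ z)) = 0
  periodic : ∀ z, z ∉ L.lattice → ∀ per ∈ L.lattice, X (z + per) = X z
  smooth : ContDiffOn ℝ ∞ X (L.lattice : Set ℂ)ᶜ
  /-- `dX = 2 Re (…) dh`, off the (isolated) poles and removable singularities of the data; by
  continuity this determines `dX` on all of `M`. -/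
  deriv_eq : ∀ z, z ∉ L.lattice → AnalyticAt ℂ φ z → AnalyticAt ℂ ψ z → AnalyticAt ℂ h z →
    ∀ (a : ℂ) (i : Fin 4), fderiv ℝ X z a i = 2 * (weierstrassForm φ ψ h z i * a).re

/-! ### The elliptic curve `y² = x (x - 1) (x - λ)` -/

/-- The function `x` on `ℂ / Λ`, with double pole at `0`. -/
def curveX (L : PeriodPair) (lam : ℂ) (z : ℂ) : ℂ := 4 * L.weierstrassP z + (1 + lam) / 3

/-- The function `y = dx/dz` on `ℂ / Λ`. -/
def curveY (L : PeriodPair) (z : ℂ) : ℂ := 4 * L.derivWeierstrassP z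

/-- `z ↦ (x, y)` identifies `ℂ / Λ` with the elliptic curve `y² = x (x - 1) (x - λ)`, `λ ≠ 0, 1`,
where `0` corresponds to the point at infinity and `dz = dx / y`. -/
def Uniformizes (L : PeriodPair) (lam : ℂ) : Prop :=
  lam ≠ 0 ∧ lam ≠ 1 ∧ ∀ z, z ∉ L.lattice →
    curveY L z ^ 2 = curveX L lam z * (curveX L lam z - 1) * (curveX L lam z - lam)

/-- Parameters of the normalized Weierstrass data whose Gauss maps have order one at the end. -/
structure Params where
  b : ℂ
  c : ℂ
  l : ℂ
  m : ℂ
  x₀ : ℂ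
  y₀ : ℂ
  lam : ℂ

namespace Params

/-- The six essential complex parameters; `x₀` is tied to `y₀` and `λ` by the curve. -/
def coord (p : Params) : Fin 6 → ℂ := ![p.b, p.c, p.l, p.m, p.y₀, p.lam]

/-- `(x₀, ± y₀)` lie on the curve, and `b, l ≠ 0`. -/
def Admissible (p : Params) : Prop :=
  p.b ≠ 0 ∧ p.l ≠ 0 ∧ p.y₀ ^ 2 = p.x₀ * (p.x₀ - 1) * (p.x₀ - p.lam)

/-- The Gauss map `φ = (x - x₀) / (b (y - y₀) + c (x - x₀))`. -/
def phi (p : Params) (L : PeriodPair) (z : ℂ) : ℂ :=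
  (curveX L p.lam z - p.x₀) / (p.b * (curveY L z - p.y₀) + p.c * (curveX L p.lam z - p.x₀))

/-- The Gauss map `ψ = (l (y + y₀) + m (x - x₀)) / (x - x₀)`. -/
def psi (p : Params) (L : PeriodPair) (z : ℂ) : ℂ :=
  (p.l * (curveY L z + p.y₀) + p.m * (curveX L p.lam z - p.x₀)) / (curveX L p.lam z - p.x₀)

/-- The height differential `dh = h dz`, with `h = b (y - y₀) + c (x - x₀)`. -/
def height (p : Params) (L : PeriodPair) (z : ℂ) : ℂ :=
  p.b * (curveY L z - p.y₀) + p.c * (curveX L p.lam z - p.x₀)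

end Params

/-! ### The Chen-Gackstatter surface -/

/-- `ρ = √6 Γ(3/4) / Γ(1/4)`. -/
def rho : ℝ := Real.sqrt 6 * Real.Gamma (3 / 4) / Real.Gamma (1 / 4)

/-- The Gauss map `G = x / (ρ y)` on the curve `y² = x (x - 1) (x + 1)`. -/
def gaussCG (L : PeriodPair) (z : ℂ) : ℂ := curveX L (-1) z / (rho * curveY L z)

/-- `Y` is the Chen-Gackstatter minimal surface, in `ℝ³ = {x₄ = 0}`: the surface with
`φ = G`, `ψ = -1/G`, `dh = dx = y dz` on the curve `y² = x (x - 1) (x + 1)`. -/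
def IsChenGackstatter (L : PeriodPair) (Y : ℂ → Mink) : Prop :=
  Uniformizes L (-1) ∧
  IsAlgebraicRepresentation L (gaussCG L) (fun z => -1 / gaussCG L z) (curveY L) Y ∧
  ∀ z, z ∉ L.lattice → Y z 3 = 0

end StationarySurface

end

open StationarySurface

/-! The theorem is an implicit function argument at the Chen–Gackstatter surface, made explicit by
elliptic functions. With h = dh/dz, the forms P = φh = x − x₀, W = ψh, H = h and N = φψh are
polynomials in x and y with PW = HN. Their primitives are combinations of z, x, y and of a primitive
Z of x built from the Weierstrass ζ function. Hence the integral (*) is single valued exactly when,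
for both generators of the lattice, the quasi-periods satisfy P + conj W = 0, Re H = 0 and Re N = 0.

The periods are treated as unknowns. For (b, y₀, ω₁, ω₂, λ, l, c, m, x₀) ∈ ℂ⁹ one has these eight
real equations, the equation of the curve at (x₀, y₀), and the two complex equations saying that x
takes the values 1 and λ at ω₁/2 and ω₂/2. These are 14 real equations in 18 real unknowns.
Adjoining b and y₀ as free values gives `periodMap`, only real differentiable because of the
conjugations. If its derivative at the base point is injective (`periodMap_injective`), the inverse
function theorem yields a smooth family parametrized by (b, y₀).

The derivative involves the variation of ζ and ℘ with the periods. It is known in two directions: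
homogeneity gives the radial one, and the Frobenius–Stickelberger formula (`periodDeriv_eta`) gives
the direction (η₁, η₂). On the square lattice these span all variations of the periods. There η₁/ω₁
= ρ²/6, a computation with Beta integrals (`eta₁_gaussian`), and the linearized equations reduce to
δλ = (4/3)ρ⁴ conj(δλ). Since ρ² ≤ 64/81 (`rho_sq_le`), the factor is less than 1, so δλ = 0 and all
other variations vanish.

Regularity: PW = HN gives |P|²·(|P|² + |W|² − 2 Re(N conj H)) = | |P|² − N conj H |², so away from
the zeros of P the metric degenerates exactly where φ = conj ψ. At the Chen–Gackstatter data N conj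
H = −ρ²|y|², which cannot equal |x|² ≠ 0. Explicit estimates (`IsClose.nVal_mul_conj_ne`,
`IsClose.norm_wVal`) make this uniform over the noncompact curve for all nearby parameters.

Geometry: the holomorphic form is null for the Lorentz product, so the surface is conformal, and its
coordinates are harmonic, so it is stationary. At the end W has a pole of order 4. Hence the
conformal factor is |z|⁻⁸ times a smooth positive function: the metric dominates |dx|² near the end,
which gives completeness, and the divergence theorem on a period parallelogram turns the factor
|z|⁻⁸ into ∫ Δ = 16π, whence ∫ K dM = −8π (`hasTotalCurvature`).

Effectiveness: a congruence matches the holomorphic forms. Comparing P forces α = 1/r, so the curves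
are related by x ↦ r²x + d, which permutes branch points. As Re λ < 0 on both sides, this forces d =
0 and r = 1, and comparison of H recovers b and y₀, which are the parameter of the family. -/

noncomputable section

namespace StationarySurface

open scoped PeriodPair

section

/-! ### Holomorphic functions of several variables -/

section SeveralVariables

variable {E : Type*} [NormedAddCommGroup E] [NormedSpace ℂ E]

theorem hasDerivAt_comp_line {f : E → ℂ} {x v : E} {ζ : ℂ} (hf : DifferentiableAt ℂ f (x + ζ • v)) :
    HasDerivAt (fun ξ : ℂ => f (x + ξ • v)) (fderiv ℂ f (x + ζ • v) v) ζ := by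
  have h1 : HasDerivAt (fun ξ : ℂ => x + ξ • v) v ζ := by
    simpa using ((hasDerivAt_id ζ).smul_const v).const_add x
  exact hf.hasFDerivAt.comp_hasDerivAt ζ h1

/-- Cauchy estimate for the derivative of a holomorphic function of several variables. -/
theorem norm_fderiv_le_of_ball {f : E → ℂ} {x : E} {r C : ℝ} (hr : 0 < r)
    (hf : DifferentiableOn ℂ f (Metric.ball x r)) (hb : ∀ y ∈ Metric.ball x r, ‖f y‖ ≤ C) :
    ‖fderiv ℂ f x‖ ≤ 2 * C / r := by
  have hC : 0 ≤ C := (norm_nonneg _).trans (hb x (Metric.mem_ball_self hr))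
  refine ContinuousLinearMap.opNorm_le_bound _ (by positivity) fun v => ?_
  by_cases hv : v = 0
  · simp [hv]
  have hv' : 0 < ‖v‖ := norm_pos_iff.2 hv
  set R := r / (2 * ‖v‖) with hR
  have hR0 : 0 < R := by positivity
  have hmem : ∀ ζ : ℂ, ‖ζ‖ ≤ R → x + ζ • v ∈ Metric.ball x r := by
    intro ζ hζ
    rw [Metric.mem_ball, dist_eq_norm, add_sub_cancel_left, norm_smul]
    calc ‖ζ‖ * ‖v‖ ≤ R * ‖v‖ := by gcongr
      _ = r / 2 := by rw [hR]; field_simp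
      _ < r := by linarith
  have hd : ∀ ζ : ℂ, ‖ζ‖ ≤ R → HasDerivAt (fun ξ : ℂ => f (x + ξ • v))
      (fderiv ℂ f (x + ζ • v) v) ζ := fun ζ hζ => hasDerivAt_comp_line
    (hf.differentiableAt (Metric.isOpen_ball.mem_nhds (hmem ζ hζ)))
  have hdc : DiffContOnCl ℂ (fun ξ : ℂ => f (x + ξ • v)) (Metric.ball 0 R) := by
    refine DifferentiableOn.diffContOnCl fun ζ hζ => ?_
    have := Metric.closure_ball_subset_closedBall hζ
    exact (hd ζ (by simpa using this)).differentiableAt.differentiableWithinAt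
  have := Complex.norm_deriv_le_of_forall_mem_sphere_norm_le (C := C) hR0 hdc
    fun ζ hζ => hb _ (hmem ζ (by simpa using (mem_sphere_iff_norm.1 hζ).le))
  have h0 := hd 0 (by simpa using hR0.le)
  rw [h0.deriv] at this
  simp only [zero_smul, add_zero] at this
  refine this.trans (le_of_eq ?_)
  rw [hR]; field_simp

/-- Termwise differentiation of a series of holomorphic functions of several variables. -/
theorem hasFDerivAt_tsum_of_ball {ι : Type*} {f : ι → E → ℂ} {x : E} {r : ℝ} {u : ι → ℝ}
    (hr : 0 < r) (hu : Summable u) (hf : ∀ i, DifferentiableOn ℂ (f i) (Metric.ball x r))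
    (hb : ∀ i, ∀ y ∈ Metric.ball x r, ‖f i y‖ ≤ u i) :
    HasFDerivAt (fun y => ∑' i, f i y) (∑' i, fderiv ℂ (f i) x) x := by
  have hsub : ∀ y ∈ Metric.ball x (r / 2), Metric.ball y (r / 2) ⊆ Metric.ball x r := by
    intro y hy
    apply Metric.ball_subset_ball'
    have := Metric.mem_ball.1 hy
    linarith
  -- The real structure serves only to speak of convexity of the ball, hence of its connectedness.
  let _ : NormedSpace ℝ E := NormedSpace.restrictScalars ℝ ℂ E
  refine hasFDerivAt_tsum_of_isPreconnected (u := fun i => 2 * u i / (r / 2))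
    (by simpa [div_eq_mul_inv] using (hu.mul_left 2).mul_right _)
    Metric.isOpen_ball (convex_ball x (r / 2)).isPreconnected
    (f := f) (f' := fun i y => fderiv ℂ (f i) y) (x₀ := x) (fun i y hy => ?_) (fun i y hy => ?_)
    (Metric.mem_ball_self (by positivity)) ?_ (Metric.mem_ball_self (by positivity))
  · exact ((hf i).differentiableAt (Metric.isOpen_ball.mem_nhds
      (hsub y hy (Metric.mem_ball_self (by positivity))))).hasFDerivAt
  · exact norm_fderiv_le_of_ball (by positivity) ((hf i).mono (hsub y hy))
      fun z hz => hb i z (hsub y hy hz)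
  · exact Summable.of_norm_bounded hu fun i => hb i x (Metric.mem_ball_self hr)

variable [FiniteDimensional ℂ E]

/-- On the complex line through y in the direction v, Cauchy's formula writes the directional
derivative as a circle integral of f(y + ζv)/ζ² over a circle of fixed radius. The integrand is
holomorphic in y with uniformly bounded derivative, so one may differentiate under the integral
sign. -/
theorem differentiableOn_fderiv_apply {f : E → ℂ} {U : Set E} (hU : IsOpen U)
    (hf : DifferentiableOn ℂ f U) (v : E) : DifferentiableOn ℂ (fun x => fderiv ℂ f x v) U := by
  intro x hx
  have : ProperSpace E := FiniteDimensional.proper ℂ E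
  let _ : MeasurableSpace E := borel E
  have : BorelSpace E := ⟨rfl⟩
  obtain ⟨r, hr, C, hb⟩ : ∃ r > 0, ∃ C, Metric.ball x r ⊆ U ∧ ∀ y ∈ Metric.ball x r, ‖f y‖ ≤ C := by
    obtain ⟨r, hr, hrU⟩ := Metric.isOpen_iff.1 hU x hx
    have hcb : Metric.closedBall x (r / 2) ⊆ U :=
      (Metric.closedBall_subset_ball (by linarith)).trans hrU
    obtain ⟨C, hC⟩ := (isCompact_closedBall x (r / 2)).exists_bound_of_continuousOn
      (hf.continuousOn.mono hcb)
    exact ⟨r / 2, by positivity, C, Metric.ball_subset_closedBall.trans hcb,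
      fun y hy => hC y (Metric.ball_subset_closedBall hy)⟩
  obtain ⟨hU', hb⟩ := hb
  have hdiff : ∀ y ∈ Metric.ball x r, DifferentiableAt ℂ f y := fun y hy =>
    hf.differentiableAt (hU.mem_nhds (hU' hy))
  by_cases hv : v = 0
  · subst hv
    simpa using (differentiableWithinAt_const (0 : ℂ))
  have hv' : 0 < ‖v‖ := norm_pos_iff.2 hv
  -- For y within r/4 of x the circle y + ζv stays within r/2 of x, which leaves a margin r/2 for
  -- the Cauchy estimate of the derivative on it.
  set R := r / (4 * ‖v‖) with hR
  have hR0 : 0 < R := by positivity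
  have hRv : R * ‖v‖ = r / 4 := by rw [hR]; field_simp
  have hmem : ∀ y ∈ Metric.ball x (r / 4), ∀ ζ : ℂ, ‖ζ‖ ≤ R → y + ζ • v ∈ Metric.ball x (r / 2) := by
    intro y hy ζ hζ
    rw [Metric.mem_ball, dist_eq_norm] at hy ⊢
    calc ‖y + ζ • v - x‖ = ‖(y - x) + ζ • v‖ := by congr 1; abel
      _ ≤ ‖y - x‖ + ‖ζ‖ * ‖v‖ := (norm_add_le _ _).trans (by rw [norm_smul])
      _ ≤ ‖y - x‖ + R * ‖v‖ := by gcongr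
      _ < r / 2 := by rw [hRv]; linarith
  have hhalf : Metric.ball x (r / 2) ⊆ Metric.ball x r := Metric.ball_subset_ball (by linarith)
  have hfd : ∀ y ∈ Metric.ball x (r / 2), ‖fderiv ℂ f y‖ ≤ 2 * C / (r / 2) := by
    intro y hy
    have hs : Metric.ball y (r / 2) ⊆ Metric.ball x r := by
      apply Metric.ball_subset_ball'
      have := Metric.mem_ball.1 hy
      linarith
    exact norm_fderiv_le_of_ball (by positivity) (fun z hz => (hdiff z (hs hz)).differentiableWithinAt)
      fun z hz => hb z (hs hz)
  have hcauchy : ∀ y ∈ Metric.ball x (r / 4), fderiv ℂ f y v =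
      (2 * Real.pi * Complex.I : ℂ)⁻¹ • ∮ ζ in C(0, R), (ζ ^ 2)⁻¹ • f (y + ζ • v) := by
    intro y hy
    have hd : ∀ ζ : ℂ, ‖ζ‖ ≤ R → HasDerivAt (fun ξ : ℂ => f (y + ξ • v))
        (fderiv ℂ f (y + ζ • v) v) ζ := fun ζ hζ => hasDerivAt_comp_line
      (hdiff _ (hhalf (hmem y hy ζ hζ)))
    have hdc : DiffContOnCl ℂ (fun ξ : ℂ => f (y + ξ • v)) (Metric.ball 0 R) := by
      refine DifferentiableOn.diffContOnCl fun ζ hζ => ?_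
      have := Metric.closure_ball_subset_closedBall hζ
      exact (hd ζ (by simpa using this)).differentiableAt.differentiableWithinAt
    have hU2 : IsOpen {ζ : ℂ | y + ζ • v ∈ Metric.ball x (r / 2)} :=
      Metric.isOpen_ball.preimage (by fun_prop)
    have h1 := Complex.two_pi_I_inv_smul_circleIntegral_sub_sq_inv_smul_of_differentiable
      (c := 0) (w₀ := 0) (R := R) (f := fun ζ : ℂ => f (y + ζ • v)) hU2
      (fun ζ hζ => hmem y hy ζ (by simpa using hζ))
      (fun ζ hζ => (hasDerivAt_comp_line
        (hdiff _ (hhalf hζ))).differentiableAt.differentiableWithinAt)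
      (Metric.mem_ball_self hR0)
    rw [(hd 0 (by simpa using hR0.le)).deriv] at h1
    simpa using h1.symm
  have hnorm : ∀ θ : ℝ, ‖circleMap 0 R θ‖ = R := fun θ => by simp [abs_of_pos hR0]
  have hlin : ∀ ζ : ℂ, ∀ y, DifferentiableAt ℂ f (y + ζ • v) →
      HasFDerivAt (fun y => f (y + ζ • v)) (fderiv ℂ f (y + ζ • v)) y := by
    intro ζ y h
    exact (hasFDerivAt_comp_add_right (ζ • v)).2 h.hasFDerivAt
  have hcircle : DifferentiableAt ℂ
      (fun y => ∮ ζ in C(0, R), (ζ ^ 2)⁻¹ • f (y + ζ • v)) x := by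
    have hcont : ∀ y ∈ Metric.ball x (r / 4), Continuous fun θ : ℝ =>
        deriv (circleMap 0 R) θ • ((circleMap 0 R θ) ^ 2)⁻¹ • f (y + circleMap 0 R θ • v) := by
      intro y hy
      have h1 : Continuous fun θ : ℝ => f (y + circleMap 0 R θ • v) := by
        rw [continuous_iff_continuousAt]
        intro θ
        have := (hdiff _ (hhalf (hmem y hy (circleMap 0 R θ) (hnorm θ).le))).continuousAt
        exact ContinuousAt.comp (f := fun θ : ℝ => y + circleMap 0 R θ • v) this
          ((continuous_const.add ((continuous_circleMap 0 R).smul continuous_const)).continuousAt)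
      have h2 : Continuous fun θ : ℝ => ((circleMap 0 R θ) ^ 2)⁻¹ :=
        ((continuous_circleMap 0 R).pow 2).inv₀ fun θ => by
          simp [hR0.ne']
      have h3 : Continuous fun θ : ℝ => deriv (circleMap 0 R) θ := by
        simp only [deriv_circleMap]
        fun_prop
      exact h3.smul (h2.smul h1)
    refine (intervalIntegral.hasFDerivAt_integral_of_dominated_of_fderiv_le
      (s := Metric.ball x (r / 4)) (bound := fun _ => R * ((R ^ 2)⁻¹ * (2 * C / (r / 2))))
      (F' := fun y θ => deriv (circleMap 0 R) θ • ((circleMap 0 R θ) ^ 2)⁻¹ •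
        fderiv ℂ f (y + circleMap 0 R θ • v))
      (Metric.ball_mem_nhds x (by positivity)) ?_ ?_ ?_ ?_ ?_ ?_).differentiableAt
    · filter_upwards [Metric.ball_mem_nhds x (show 0 < r / 4 by positivity)] with y hy
      exact (hcont y hy).aestronglyMeasurable
    · exact (hcont x (Metric.mem_ball_self (by positivity))).intervalIntegrable _ _
    -- Continuity of the derivative is not known at this stage; its measurability suffices.
    · have : FiniteDimensional ℂ (E →L[ℂ] ℂ) := inferInstance
      have : ProperSpace (E →L[ℂ] ℂ) := FiniteDimensional.proper ℂ _
      have h1 : Measurable fun θ : ℝ => fderiv ℂ f (x + circleMap 0 R θ • v) :=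
        (measurable_fderiv ℂ f).comp (Continuous.measurable
          (continuous_const.add ((continuous_circleMap 0 R).smul continuous_const)))
      have h2 : Measurable fun θ : ℝ => ((circleMap 0 R θ) ^ 2)⁻¹ :=
        ((continuous_circleMap 0 R).pow 2).measurable.inv
      have h3 : Measurable fun θ : ℝ => deriv (circleMap 0 R) θ := measurable_deriv _
      exact (h3.smul (h2.smul h1)).aestronglyMeasurable
    · refine Eventually.of_forall fun θ _ y hy => ?_
      rw [norm_smul, norm_smul, norm_inv, norm_pow, hnorm θ]
      have := hfd _ (hmem y hy _ (hnorm θ).le)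
      simp only [deriv_circleMap, norm_mul, Complex.norm_I, mul_one, hnorm]
      gcongr
    · exact intervalIntegrable_const
    · refine Eventually.of_forall fun θ _ y hy => ?_
      exact ((hlin _ y (hdiff _ (hhalf (hmem y hy _ (hnorm θ).le)))).fun_const_smul _).fun_const_smul _
  have hev : (fun y => fderiv ℂ f y v) =ᶠ[𝓝 x] fun y =>
      (2 * Real.pi * Complex.I : ℂ)⁻¹ • ∮ ζ in C(0, R), (ζ ^ 2)⁻¹ • f (y + ζ • v) := by
    filter_upwards [Metric.ball_mem_nhds x (show 0 < r / 4 by positivity)] with y hy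
    exact hcauchy y hy
  exact (hev.differentiableAt_iff.2 (hcircle.fun_const_smul _)).differentiableWithinAt

/-- A holomorphic function of several variables is smooth. -/
theorem contDiffOn_of_differentiableOn {f : E → ℂ} {U : Set E} (hU : IsOpen U)
    (hf : DifferentiableOn ℂ f U) : ContDiffOn ℂ ∞ f U := by
  rw [contDiffOn_infty]
  intro n
  induction n generalizing f with
  | zero => exact contDiffOn_zero.2 hf.continuousOn
  | succ n ih =>
    rw [Nat.cast_succ, contDiffOn_succ_iff_fderiv_of_isOpen hU]
    refine ⟨hf, fun h => absurd h (by simp), contDiffOn_clm_apply.2 fun v => ?_⟩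
    exact ih (differentiableOn_fderiv_apply hU hf v)

end SeveralVariables

end

/-! ### The Weierstrass zeta function as a function of the variable and the periods -/

/-- The signed area of the parallelogram spanned by two complex numbers. -/
def latticeDet (w : ℂ × ℂ) : ℝ := w.1.re * w.2.im - w.1.im * w.2.re

/-- The lattice point with coordinates `n` in the lattice generated by `w`. -/
def latticePt (w : ℂ × ℂ) (n : ℤ × ℤ) : ℂ := n.1 * w.1 + n.2 * w.2

@[fun_prop]
theorem continuous_latticeDet : Continuous latticeDet := by
  unfold latticeDet; fun_prop

theorem linearIndependent_iff_latticeDet_ne_zero (w : ℂ × ℂ) :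
    LinearIndependent ℝ ![w.1, w.2] ↔ latticeDet w ≠ 0 := by
  rw [LinearIndependent.pair_iff]
  constructor
  · intro h hd
    unfold latticeDet at hd
    have h1 := h w.2.im (-w.1.im) (by
      apply Complex.ext <;> simp <;> linarith)
    have h2 := h w.2.re (-w.1.re) (by
      apply Complex.ext <;> simp <;> linarith)
    have h3 := h 1 0 (by
      apply Complex.ext <;> simp <;> linarith)
    simp at h3
  · intro h s t hst
    have h1 := congrArg Complex.re hst
    have h2 := congrArg Complex.im hst
    simp at h1 h2
    unfold latticeDet at h
    constructor
    · have : s * (w.1.re * w.2.im - w.1.im * w.2.re) = 0 := by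
        linear_combination w.2.im * h1 - w.2.re * h2
      simpa [h] using this
    · have : t * (w.1.re * w.2.im - w.1.im * w.2.re) = 0 := by
        linear_combination w.1.re * h2 - w.1.im * h1
      simpa [h] using this

/-- Cramer's rule: Im(conj(w₁)(s w₁ + t w₂)) is t times the determinant, and likewise for w₂ and −s.
-/
theorem norm_le_of_latticeDet (w : ℂ × ℂ) (s t : ℝ) :
    |latticeDet w| * ‖(s, t)‖ ≤ ‖w‖ * ‖(s : ℂ) * w.1 + t * w.2‖ := by
  have key : ∀ (a v : ℂ) (d x : ℝ), (starRingEnd ℂ a * v).im = d * x → |d| * |x| ≤ ‖a‖ * ‖v‖ := by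
    intro a v d x h
    rw [← abs_mul, ← h]
    refine (Complex.abs_im_le_norm _).trans ?_
    simp
  have h1 := key w.1 (s * w.1 + t * w.2) (latticeDet w) t (by simp [latticeDet]; ring)
  have h2 := key w.2 (s * w.1 + t * w.2) (latticeDet w) (-s) (by simp [latticeDet]; ring)
  rw [abs_neg] at h2
  rw [Prod.norm_def (x := (s, t)), Real.norm_eq_abs, Real.norm_eq_abs]
  rcases max_cases |s| |t| with ⟨h, _⟩ | ⟨h, _⟩ <;> simp only [h]
  · exact h2.trans (by gcongr; exact norm_snd_le w)
  · exact h1.trans (by gcongr; exact norm_fst_le w)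

theorem norm_latticePt_ge (w : ℂ × ℂ) (n : ℤ × ℤ) :
    |latticeDet w| * ‖n‖ ≤ ‖w‖ * ‖latticePt w n‖ := by
  have := norm_le_of_latticeDet w n.1 n.2
  simpa [latticePt, Prod.norm_def, Int.norm_eq_abs] using this

theorem norm_latticePt_sub_le (w w' : ℂ × ℂ) (n : ℤ × ℤ) :
    ‖latticePt w n - latticePt w' n‖ ≤ 2 * ‖n‖ * ‖w - w'‖ := by
  have h : latticePt w n - latticePt w' n = n.1 * (w - w').1 + n.2 * (w - w').2 := by
    simp [latticePt]; ring
  rw [h]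
  refine (norm_add_le _ _).trans ?_
  rw [norm_mul, norm_mul, Complex.norm_intCast, Complex.norm_intCast]
  have h1 : |(n.1 : ℝ)| ≤ ‖n‖ := norm_fst_le n
  have h2 : |(n.2 : ℝ)| ≤ ‖n‖ := norm_snd_le n
  have h3 := norm_fst_le (w - w')
  have h4 := norm_snd_le (w - w')
  calc _ ≤ ‖n‖ * ‖w - w'‖ + ‖n‖ * ‖w - w'‖ := by gcongr
    _ = _ := by ring

theorem one_le_norm_of_ne_zero {n : ℤ × ℤ} (hn : n ≠ 0) : 1 ≤ ‖n‖ := by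
  have : n.1 ≠ 0 ∨ n.2 ≠ 0 := by
    by_contra! h
    exact hn (Prod.ext h.1 h.2)
  rcases this with h | h
  · exact le_trans (by rw [Int.norm_eq_abs]; exact_mod_cast Int.one_le_abs h) (norm_fst_le n)
  · exact le_trans (by rw [Int.norm_eq_abs]; exact_mod_cast Int.one_le_abs h) (norm_snd_le n)

/-- Pairs `(z, w)` for which `z` is not a non-zero point of the lattice generated by `w`. -/
def regularDomain : Set (ℂ × ℂ × ℂ) :=
  {q | latticeDet q.2 ≠ 0 ∧ ∀ n : ℤ × ℤ, n ≠ 0 → q.1 ≠ latticePt q.2 n}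

/-- Locally uniform lower bound for the distance to the non-zero lattice points. -/
theorem exists_lower_bound {q : ℂ × ℂ × ℂ} (hq : q ∈ regularDomain) :
    ∃ r > 0, ∃ c > 0, ∀ q' ∈ Metric.ball q r, latticeDet q'.2 ≠ 0 ∧ ∀ n : ℤ × ℤ, n ≠ 0 →
      c * ‖n‖ ≤ ‖latticePt q'.2 n‖ ∧ c * ‖n‖ ≤ ‖q'.1 - latticePt q'.2 n‖ := by
  obtain ⟨z, w⟩ := q
  obtain ⟨hd, hz⟩ := hq
  simp only at hd hz
  have hw : 0 < ‖w‖ := by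
    rw [norm_pos_iff]
    rintro rfl
    simp [latticeDet] at hd
  set c₀ := |latticeDet w| / ‖w‖ with hc₀
  have hc₀pos : 0 < c₀ := by positivity
  have h0 : ∀ n : ℤ × ℤ, c₀ * ‖n‖ ≤ ‖latticePt w n‖ := by
    intro n
    have := norm_latticePt_ge w n
    rw [hc₀, div_mul_eq_mul_div, div_le_iff₀ hw]
    linarith
  -- Only finitely many n satisfy this bound, and each has its own positive distance. For the others
  -- |l| ≥ c₀‖n‖ > 2‖z‖, so the triangle inequality leaves half of c₀‖n‖.
  have hfin : {n : ℤ × ℤ | ‖n‖ ≤ 2 * ‖z‖ / c₀}.Finite := by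
    have := (isCompact_closedBall (0 : ℤ × ℤ) (2 * ‖z‖ / c₀)).finite_of_discrete
    simpa [Metric.closedBall, dist_zero_right] using this
  obtain ⟨c₁, hc₁, h1⟩ : ∃ c₁ > 0, ∀ n ∈ hfin.toFinset, n ≠ 0 →
      c₁ * ‖n‖ ≤ ‖z - latticePt w n‖ := by
    induction hfin.toFinset using Finset.induction_on with
    | empty => exact ⟨1, one_pos, by simp⟩
    | insert a s _ ih =>
      obtain ⟨c, hc, h⟩ := ih
      by_cases ha : a = 0
      · refine ⟨c, hc, fun n hn hn0 => ?_⟩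
        rcases Finset.mem_insert.1 hn with rfl | hn
        · exact absurd ha hn0
        · exact h n hn hn0
      · have hpos : 0 < ‖z - latticePt w a‖ := norm_pos_iff.2 (sub_ne_zero.2 (hz a ha))
        have ha1 := one_le_norm_of_ne_zero ha
        refine ⟨min c (‖z - latticePt w a‖ / ‖a‖), lt_min hc (by positivity), fun n hn hn0 => ?_⟩
        rcases Finset.mem_insert.1 hn with rfl | hn
        · calc _ ≤ ‖z - latticePt w n‖ / ‖n‖ * ‖n‖ := by gcongr; exact min_le_right _ _
            _ = _ := by field_simp
        · exact le_trans (by gcongr; exact min_le_left _ _) (h n hn hn0)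
  set c₂ := min (c₀ / 2) c₁ with hc₂
  have hc₂pos : 0 < c₂ := by positivity
  have h2 : ∀ n : ℤ × ℤ, n ≠ 0 → c₂ * ‖n‖ ≤ ‖z - latticePt w n‖ := by
    intro n hn
    by_cases hb : ‖n‖ ≤ 2 * ‖z‖ / c₀
    · exact le_trans (by gcongr; exact min_le_right _ _) (h1 n (by simpa using hb) hn)
    · rw [not_le, div_lt_iff₀ hc₀pos] at hb
      have h3 := h0 n
      have h4 := norm_sub_norm_le (latticePt w n) z
      rw [norm_sub_rev] at h4
      have h5 : c₂ * ‖n‖ ≤ c₀ / 2 * ‖n‖ := by gcongr; exact min_le_left _ _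
      linarith
  have hopen : ∀ᶠ q' in 𝓝 (z, w), latticeDet q'.2 ≠ 0 :=
    (continuous_latticeDet.comp continuous_snd).continuousAt.eventually_ne hd
  obtain ⟨r₀, hr₀, hr⟩ := Metric.eventually_nhds_iff_ball.1 hopen
  -- Moving the periods by c₂/6 moves the point n by at most 2‖n‖c₂/6, and moving z costs c₂/6 ≤
  -- ‖n‖c₂/6; together at most half of c₂‖n‖ is lost.
  refine ⟨min r₀ (c₂ / 6), by positivity, c₂ / 2, by positivity, fun q' hq' => ⟨hr q'
    (Metric.ball_subset_ball (min_le_left _ _) hq'), fun n hn => ?_⟩⟩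
  have hq2 : dist q' (z, w) < c₂ / 6 := lt_of_lt_of_le hq' (min_le_right _ _)
  rw [dist_eq_norm] at hq2
  have hq3 : ‖q'.1 - z‖ < c₂ / 6 := lt_of_le_of_lt (norm_fst_le (q' - (z, w))) hq2
  have hq4 : ‖q'.2 - w‖ < c₂ / 6 := lt_of_le_of_lt (norm_snd_le (q' - (z, w))) hq2
  have hn1 := one_le_norm_of_ne_zero hn
  have h6 := norm_latticePt_sub_le q'.2 w n
  have h7 : 2 * ‖n‖ * ‖q'.2 - w‖ ≤ 2 * ‖n‖ * (c₂ / 6) := by gcongr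
  constructor
  · have h3 := h0 n
    have h5 : c₂ * ‖n‖ ≤ c₀ / 2 * ‖n‖ := by gcongr; exact min_le_left _ _
    have h4 := norm_sub_norm_le (latticePt w n) (latticePt w n - latticePt q'.2 n)
    rw [sub_sub_cancel, norm_sub_rev (latticePt w n)] at h4
    nlinarith [norm_nonneg n]
  · have h3 := h2 n hn
    have h4 : z - latticePt w n = (q'.1 - latticePt q'.2 n) - (q'.1 - z)
        + (latticePt q'.2 n - latticePt w n) := by ring
    have h5 : ‖z - latticePt w n‖ ≤ ‖q'.1 - latticePt q'.2 n‖ + ‖q'.1 - z‖ +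
        ‖latticePt q'.2 n - latticePt w n‖ := by
      rw [h4]
      exact (norm_add_le _ _).trans (by gcongr; exact norm_sub_le _ _)
    nlinarith [norm_nonneg n]

theorem isOpen_regularDomain : IsOpen regularDomain := by
  rw [Metric.isOpen_iff]
  intro q hq
  obtain ⟨r, hr, c, hc, h⟩ := exists_lower_bound hq
  refine ⟨r, hr, fun q' hq' => ⟨(h q' hq').1, fun n hn h0 => ?_⟩⟩
  have h1 := ((h q' hq').2 n hn).2
  rw [h0, sub_self, norm_zero] at h1
  have := one_le_norm_of_ne_zero hn
  nlinarith

theorem summable_norm_pow_three_inv : Summable fun n : ℤ × ℤ => (‖n‖ ^ 3)⁻¹ := by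
  have h := EisensteinSeries.summable_one_div_norm_rpow (k := 3) (by norm_num)
  rw [← (finTwoArrowEquiv ℤ).symm.summable_iff] at h
  refine h.congr fun n => ?_
  simp only [Function.comp_apply, finTwoArrowEquiv, Real.rpow_neg (norm_nonneg _)]
  congr 1
  rw [EisensteinSeries.norm_eq_max_natAbs]
  rw [Prod.norm_def]
  simp [Int.norm_eq_abs]

/-- Summand of the regular part at the origin of the zeta function; it vanishes for `n = 0`. -/
def zetaTerm (n : ℤ × ℤ) (q : ℂ × ℂ × ℂ) : ℂ :=
  q.1 ^ 2 / (latticePt q.2 n ^ 2 * (q.1 - latticePt q.2 n))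

/-- The regular part `ζ(z) - 1 / z` of the zeta function of the lattice generated by `w`. -/
def zetaReg (q : ℂ × ℂ × ℂ) : ℂ := ∑' n, zetaTerm n q

@[simp] theorem latticePt_zero (w : ℂ × ℂ) : latticePt w 0 = 0 := by simp [latticePt]

@[simp] theorem zetaTerm_zero (q : ℂ × ℂ × ℂ) : zetaTerm 0 q = 0 := by simp [zetaTerm]

theorem latticePt_ne_zero {w : ℂ × ℂ} (hw : latticeDet w ≠ 0) {n : ℤ × ℤ} (hn : n ≠ 0) :
    latticePt w n ≠ 0 := by
  intro h
  have h1 := norm_latticePt_ge w n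
  rw [h, norm_zero, mul_zero] at h1
  have := one_le_norm_of_ne_zero hn
  have : 0 < |latticeDet w| := abs_pos.2 hw
  nlinarith

theorem differentiableAt_zetaTerm (n : ℤ × ℤ) {q : ℂ × ℂ × ℂ} (hq : q ∈ regularDomain) :
    DifferentiableAt ℂ (zetaTerm n) q := by
  by_cases hn : n = 0
  · subst hn
    have : zetaTerm 0 = fun _ => 0 := funext zetaTerm_zero
    rw [this]
    exact differentiableAt_const _
  · unfold zetaTerm latticePt
    have h1 := latticePt_ne_zero hq.1 hn
    have h2 := sub_ne_zero.2 (hq.2 n hn)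
    unfold latticePt at h1 h2
    have h3 := mul_ne_zero (pow_ne_zero 2 h1) h2
    fun_prop (disch := exact h3)

/-- Locally uniform bound for the summands of the zeta function. -/
theorem exists_zetaTerm_bound {q : ℂ × ℂ × ℂ} (hq : q ∈ regularDomain) :
    ∃ r > 0, Metric.ball q r ⊆ regularDomain ∧ ∃ u : ℤ × ℤ → ℝ, Summable u ∧
      ∀ n, ∀ q' ∈ Metric.ball q r, ‖zetaTerm n q'‖ ≤ u n := by
  obtain ⟨r, hr, c, hc, h⟩ := exists_lower_bound hq
  obtain ⟨r', hr', hU⟩ := Metric.isOpen_iff.1 isOpen_regularDomain q hq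
  refine ⟨min r r', lt_min hr hr', (Metric.ball_subset_ball (min_le_right _ _)).trans hU,
    fun n => (‖q‖ + r) ^ 2 / c ^ 3 * (‖n‖ ^ 3)⁻¹, summable_norm_pow_three_inv.mul_left _,
    fun n q' hq' => ?_⟩
  have hq' := Metric.ball_subset_ball (min_le_left r r') hq'
  by_cases hn : n = 0
  · subst hn
    simp
  have h1 := one_le_norm_of_ne_zero hn
  obtain ⟨h2, h3⟩ := (h q' hq').2 n hn
  rw [zetaTerm, norm_div, norm_mul, norm_pow, norm_pow]
  have h4 : ‖q'.1‖ ≤ ‖q‖ + r := by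
    have := norm_fst_le q'
    rw [Metric.mem_ball, dist_eq_norm] at hq'
    have h5 := norm_sub_norm_le q' q
    linarith
  calc _ ≤ (‖q‖ + r) ^ 2 / ((c * ‖n‖) ^ 2 * (c * ‖n‖)) := by gcongr
    _ = _ := by field_simp

/-- The combined summand 1/(z − l) + 1/l + z/l² = z²/(l²(z − l)) is O(‖n‖⁻³) uniformly for nearby z
and periods. The series may therefore be differentiated termwise jointly in all variables, which is
what makes the dependence on the lattice accessible. -/
theorem hasFDerivAt_zetaReg {q : ℂ × ℂ × ℂ} (hq : q ∈ regularDomain) :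
    HasFDerivAt zetaReg (∑' n, fderiv ℂ (zetaTerm n) q) q := by
  obtain ⟨r, hr, hU, u, hu, hb⟩ := exists_zetaTerm_bound hq
  exact hasFDerivAt_tsum_of_ball hr hu
    (fun n q' hq' => (differentiableAt_zetaTerm n (hU hq')).differentiableWithinAt) hb

theorem summable_fderiv_zetaTerm {q : ℂ × ℂ × ℂ} (hq : q ∈ regularDomain) :
    Summable fun n => fderiv ℂ (zetaTerm n) q := by
  obtain ⟨r, hr, hU, u, hu, hb⟩ := exists_zetaTerm_bound hq
  refine Summable.of_norm_bounded (g := fun n => 2 * u n / r)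
    (by simpa [div_eq_mul_inv] using (hu.mul_left 2).mul_right _) fun n => ?_
  exact norm_fderiv_le_of_ball hr
    (fun q' hq' => (differentiableAt_zetaTerm n (hU hq')).differentiableWithinAt) (hb n)

theorem contDiffOn_zetaReg : ContDiffOn ℂ ∞ zetaReg regularDomain :=
  contDiffOn_of_differentiableOn isOpen_regularDomain fun _ hq =>
    (hasFDerivAt_zetaReg hq).differentiableAt.differentiableWithinAt

/-- The pair of periods as an element of `ℂ × ℂ`. -/
def periods (L : PeriodPair) : ℂ × ℂ := (L.ω₁, L.ω₂)

theorem latticeDet_periods_ne_zero (L : PeriodPair) : latticeDet (periods L) ≠ 0 :=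
  (linearIndependent_iff_latticeDet_ne_zero (periods L)).1 L.indep

/-- The period pair with given periods. -/
def pairOf (w : ℂ × ℂ) (hw : latticeDet w ≠ 0) : PeriodPair :=
  ⟨w.1, w.2, (linearIndependent_iff_latticeDet_ne_zero w).2 hw⟩

@[simp] theorem periods_pairOf (w : ℂ × ℂ) (hw : latticeDet w ≠ 0) :
    periods (pairOf w hw) = w := rfl

theorem mem_lattice_iff {L : PeriodPair} {z : ℂ} :
    z ∈ L.lattice ↔ ∃ n : ℤ × ℤ, latticePt (periods L) n = z := by
  rw [PeriodPair.mem_lattice]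
  simp [latticePt, periods]

theorem coe_latticeEquivProd_symm (L : PeriodPair) (n : ℤ × ℤ) :
    ((L.latticeEquivProd.symm n : L.lattice) : ℂ) = latticePt (periods L) n := by
  rw [PeriodPair.latticeEquiv_symm_apply]; rfl

theorem mem_regularDomain_iff {L : PeriodPair} {z : ℂ} :
    (z, periods L) ∈ regularDomain ↔ z ∈ ((L.lattice : Set ℂ) \ {0})ᶜ := by
  constructor
  · rintro ⟨_, h⟩ ⟨hz, h0⟩
    obtain ⟨n, rfl⟩ := mem_lattice_iff.1 hz
    exact h n (by rintro rfl; simp at h0) rfl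
  · refine fun h => ⟨latticeDet_periods_ne_zero L, fun n hn hz => h ⟨mem_lattice_iff.2 ⟨n, hz.symm⟩, ?_⟩⟩
    simp only at hz
    simpa [hz] using latticePt_ne_zero (latticeDet_periods_ne_zero L) hn

theorem mem_regularDomain_of_notMem {L : PeriodPair} {z : ℂ} (hz : z ∉ L.lattice) :
    (z, periods L) ∈ regularDomain := mem_regularDomain_iff.2 fun h => hz h.1

theorem zero_mem_regularDomain (L : PeriodPair) : ((0 : ℂ), periods L) ∈ regularDomain :=
  mem_regularDomain_iff.2 fun h => h.2 rfl

theorem hasDerivAt_zetaTerm (L : PeriodPair) (n : ℤ × ℤ) {z : ℂ}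
    (hz : (z, periods L) ∈ regularDomain) :
    HasDerivAt (fun z => zetaTerm n (z, periods L))
      (-(if latticePt (periods L) n = 0 then 0 else
        (1 / (z - latticePt (periods L) n) ^ 2 - 1 / latticePt (periods L) n ^ 2))) z := by
  by_cases hn : n = 0
  · subst hn
    simpa using hasDerivAt_const z (0 : ℂ)
  have h1 := latticePt_ne_zero hz.1 hn
  have h2 := sub_ne_zero.2 (hz.2 n hn)
  simp only at h1 h2
  rw [if_neg h1]
  simp only [zetaTerm]
  generalize latticePt (periods L) n = l at *
  have h3 : HasDerivAt (fun z : ℂ => z ^ 2) (2 * z) z := by simpa using hasDerivAt_pow 2 z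
  have h4 : HasDerivAt (fun z : ℂ => l ^ 2 * (z - l)) (l ^ 2 * 1) z :=
    ((hasDerivAt_id z).sub_const l).const_mul _
  refine (h3.fun_div h4 (mul_ne_zero (pow_ne_zero 2 h1) h2)).congr_deriv ?_
  field_simp
  ring

/-- `℘[L - 0]` is ℘ without its term 1/z²; termwise differentiation produces the negative of its
series, after reindexing the lattice by pairs of integers. -/
theorem hasDerivAt_zetaReg (L : PeriodPair) {z : ℂ} (hz : (z, periods L) ∈ regularDomain) :
    HasDerivAt (fun z => zetaReg (z, periods L)) (-℘[L - (0 : ℂ)] z) z := by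
  have hline : HasDerivAt (fun z : ℂ => (z, periods L)) ((1 : ℂ), (0 : ℂ × ℂ)) z :=
    (hasDerivAt_id z).prodMk (hasDerivAt_const z _)
  have h1 := (hasFDerivAt_zetaReg hz).comp_hasDerivAt z hline
  convert! h1 using 1
  have h2 := ContinuousLinearMap.map_tsum (ContinuousLinearMap.apply ℂ ℂ ((1 : ℂ), (0 : ℂ × ℂ)))
    (summable_fderiv_zetaTerm hz)
  simp only [ContinuousLinearMap.apply_apply] at h2
  rw [h2, PeriodPair.weierstrassPExcept, ← tsum_neg, ← L.latticeEquivProd.symm.toEquiv.tsum_eq]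
  refine tsum_congr fun n => ?_
  have h3 := (differentiableAt_zetaTerm n hz).hasFDerivAt.comp_hasDerivAt z hline
  rw [← (hasDerivAt_zetaTerm L n hz).unique h3]
  simp only [LinearEquiv.coe_toEquiv, coe_latticeEquivProd_symm]

/-- The Weierstrass zeta function of the lattice generated by `q.2`, at the point `q.1`. -/
def zeta (q : ℂ × ℂ × ℂ) : ℂ := 1 / q.1 + zetaReg q

/-- Pairs `(z, w)` for which `z` is not a point of the lattice generated by `w`. -/
def zetaDomain : Set (ℂ × ℂ × ℂ) :=
  {q | latticeDet q.2 ≠ 0 ∧ ∀ n : ℤ × ℤ, q.1 ≠ latticePt q.2 n}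

theorem zetaDomain_eq : zetaDomain = regularDomain ∩ {q | q.1 ≠ 0} := by
  ext q
  constructor
  · exact fun h => ⟨⟨h.1, fun n _ => h.2 n⟩, by simpa using h.2 0⟩
  · rintro ⟨⟨h1, h2⟩, h3⟩
    refine ⟨h1, fun n => ?_⟩
    by_cases hn : n = 0
    · subst hn; simpa using h3
    · exact h2 n hn

theorem isOpen_zetaDomain : IsOpen zetaDomain := by
  rw [zetaDomain_eq]
  exact isOpen_regularDomain.inter (isOpen_ne_fun continuous_fst continuous_const)

theorem contDiffOn_zeta : ContDiffOn ℂ ∞ zeta zetaDomain := by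
  intro q hq
  rw [zetaDomain_eq] at hq
  have h1 : ContDiffAt ℂ ∞ zetaReg q :=
    contDiffOn_zetaReg.contDiffAt (isOpen_regularDomain.mem_nhds hq.1)
  have h2 : q.1 ≠ 0 := hq.2
  have h3 : ContDiffAt ℂ ∞ (fun q : ℂ × ℂ × ℂ => 1 / q.1) q := by
    fun_prop (disch := exact h2)
  exact (h3.add h1).contDiffWithinAt

theorem mem_zetaDomain_iff {L : PeriodPair} {z : ℂ} :
    (z, periods L) ∈ zetaDomain ↔ z ∉ L.lattice := by
  rw [mem_lattice_iff]
  simp only [zetaDomain, mem_ofPred_eq, latticeDet_periods_ne_zero, not_exists, ne_eq,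
    not_false_eq_true, true_and]
  exact forall_congr' fun n => by rw [eq_comm]

theorem weierstrassP_eq (L : PeriodPair) (z : ℂ) :
    ℘[L] z = 1 / z ^ 2 + ℘[L - (0 : ℂ)] z := by
  have := L.weierstrassPExcept_add 0 z
  simp at this
  rw [← this]; simp; ring

theorem derivWeierstrassP_eq (L : PeriodPair) (z : ℂ) :
    ℘'[L] z = -2 / z ^ 3 + ℘'[L - (0 : ℂ)] z := by
  have := L.derivWeierstrassPExcept_def 0 z
  simp only [ZeroMemClass.coe_zero, sub_zero] at this
  rw [this]; ring

theorem hasDerivAt_zeta (L : PeriodPair) {z : ℂ} (hz : z ∉ L.lattice) :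
    HasDerivAt (fun z => zeta (z, periods L)) (-℘[L] z) z := by
  have h0 : z ≠ 0 := by rintro rfl; exact hz (zero_mem _)
  have h1 := hasDerivAt_zetaReg L (mem_regularDomain_of_notMem hz)
  have h2 : HasDerivAt (fun z : ℂ => 1 / z) (-(1 / z ^ 2)) z := by
    simpa using hasDerivAt_inv h0
  convert! h2.add h1 using 1
  rw [weierstrassP_eq]; ring

theorem latticePt_neg (w : ℂ × ℂ) (n : ℤ × ℤ) : latticePt w (-n) = -latticePt w n := by
  simp [latticePt]; ring

theorem zetaReg_neg (z : ℂ) (w : ℂ × ℂ) : zetaReg (-z, w) = -zetaReg (z, w) := by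
  rw [zetaReg, zetaReg, ← tsum_neg, ← (Equiv.neg (ℤ × ℤ)).tsum_eq]
  refine tsum_congr fun n => ?_
  simp only [Equiv.neg_apply, zetaTerm, latticePt_neg, even_two.neg_pow]
  rw [show -z - -latticePt w n = -(z - latticePt w n) by ring, mul_neg, div_neg]

theorem zeta_neg (z : ℂ) (w : ℂ × ℂ) : zeta (-z, w) = -zeta (z, w) := by
  simp only [zeta, zetaReg_neg, div_neg]; ring

@[simp] theorem zetaReg_zero (w : ℂ × ℂ) : zetaReg (0, w) = 0 := by
  simp [zetaReg, zetaTerm]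

theorem isPreconnected_compl_lattice (L : PeriodPair) : IsPreconnected (L.lattice : Set ℂ)ᶜ := by
  have : (L.lattice : Set ℂ).Countable := by
    have := Set.countable_range (fun n : ℤ × ℤ => latticePt (periods L) n)
    refine this.mono fun z hz => ?_
    exact mem_lattice_iff.1 hz
  exact (this.isConnected_compl_of_one_lt_rank (by simp)).isPreconnected

theorem isOpen_compl_lattice (L : PeriodPair) : IsOpen (L.lattice : Set ℂ)ᶜ :=
  L.isClosed_lattice.isOpen_compl

theorem add_mem_lattice_iff {L : PeriodPair} {z l : ℂ} (hl : l ∈ L.lattice) :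
    z + l ∈ L.lattice ↔ z ∈ L.lattice := Submodule.add_mem_iff_left _ hl

/-- A function on the complement of a lattice whose derivative is periodic is quasi-periodic. -/
theorem exists_quasiPeriod {L : PeriodPair} {f f' : ℂ → ℂ}
    (hf : ∀ z, z ∉ L.lattice → HasDerivAt f (f' z) z) {l : ℂ} (hl : l ∈ L.lattice)
    (hp : ∀ z, z ∉ L.lattice → f' (z + l) = f' z) :
    ∃ c, ∀ z, z ∉ L.lattice → f (z + l) = f z + c := by
  have hd : ∀ z, z ∉ L.lattice → HasDerivAt (fun z => f (z + l) - f z) 0 z := by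
    intro z hz
    have h1 := (hf (z + l) (by rwa [add_mem_lattice_iff hl])).comp_add_const z l
    simpa [hp z hz] using h1.fun_sub (hf z hz)
  obtain ⟨c, hc⟩ := (isOpen_compl_lattice L).exists_is_const_of_deriv_eq_zero
    (isPreconnected_compl_lattice L)
    (fun z hz => (hd z hz).differentiableAt.differentiableWithinAt) (fun z hz => (hd z hz).deriv)
  exact ⟨c, fun z hz => by rw [← hc z hz]; ring⟩

/-- The quasi-period of the zeta function for the first period. -/
def eta₁ (w : ℂ × ℂ) : ℂ := 2 * zeta (w.1 / 2, w)

/-- The quasi-period of the zeta function for the second period. -/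
def eta₂ (w : ℂ × ℂ) : ℂ := 2 * zeta (w.2 / 2, w)

theorem zeta_add_of_half {L : PeriodPair} {l : ℂ} (hl : l ∈ L.lattice) (hl2 : l / 2 ∉ L.lattice)
    {z : ℂ} (hz : z ∉ L.lattice) :
    zeta (z + l, periods L) = zeta (z, periods L) + 2 * zeta (l / 2, periods L) := by
  obtain ⟨c, hc⟩ := exists_quasiPeriod (fun z hz => hasDerivAt_zeta L hz) hl
    (fun z _ => by rw [L.weierstrassP_add_coe z ⟨l, hl⟩])
  -- Since ζ is odd, evaluation at −l/2 identifies the additive constant.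
  have h1 := hc (-(l / 2)) (by rwa [neg_mem_iff])
  rw [show -(l / 2) + l = l / 2 by ring, zeta_neg] at h1
  rw [hc z hz]
  linear_combination -h1

theorem zeta_add_ω₁ (L : PeriodPair) {z : ℂ} (hz : z ∉ L.lattice) :
    zeta (z + L.ω₁, periods L) = zeta (z, periods L) + eta₁ (periods L) :=
  zeta_add_of_half L.ω₁_mem_lattice L.ω₁_div_two_notMem_lattice hz

theorem zeta_add_ω₂ (L : PeriodPair) {z : ℂ} (hz : z ∉ L.lattice) :
    zeta (z + L.ω₂, periods L) = zeta (z, periods L) + eta₂ (periods L) :=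
  zeta_add_of_half L.ω₂_mem_lattice L.ω₂_div_two_notMem_lattice hz

/-! ### Elliptic functions and the variation of the zeta function with the periods -/

theorem periodic_of_generators {α : Type*} {L : PeriodPair} {f : ℂ → α}
    (h1 : ∀ z, z ∉ L.lattice → f (z + L.ω₁) = f z) (h2 : ∀ z, z ∉ L.lattice → f (z + L.ω₂) = f z) :
    ∀ z, z ∉ L.lattice → ∀ l ∈ L.lattice, f (z + l) = f z := by
  intro z hz l hl
  induction hl using Submodule.span_induction generalizing z with
  | mem x hx =>
    rcases hx with rfl | rfl
    · exact h1 z hz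
    · exact h2 z hz
  | zero => simp
  | add x y hx hy ihx ihy =>
    have hx' : x ∈ L.lattice := hx
    rw [← add_assoc, ihy (z + x) (by rwa [add_mem_lattice_iff hx']), ihx z hz]
  | smul a x hx ih =>
    have hx' : x ∈ L.lattice := hx
    induction a using Int.induction_on with
    | zero => simp
    | succ n ihn =>
      rw [add_smul, one_smul, ← add_assoc,
        ih _ (by rwa [add_mem_lattice_iff (Submodule.smul_mem _ _ hx')]), ihn]
    | pred n ihn =>
      rw [← ihn, ← ih (z + (-(n : ℤ) - 1) • x)
        (by rwa [add_mem_lattice_iff (Submodule.smul_mem _ _ hx')]), sub_smul, one_smul]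
      congr 1
      abel

/-- Liouville's theorem for elliptic functions with a removable singularity at the lattice
points. -/
theorem eq_const_of_periodic {L : PeriodPair} {f : ℂ → ℂ} {c : ℂ}
    (hf : ∀ z, z ∉ L.lattice → DifferentiableAt ℂ f z)
    (hp : ∀ z, z ∉ L.lattice → ∀ l ∈ L.lattice, f (z + l) = f z)
    (h0 : Tendsto f (𝓝[≠] 0) (𝓝 c)) : ∀ z, z ∉ L.lattice → f z = c := by
  classical
  set F : ℂ → ℂ := fun z => if z ∈ L.lattice then c else f z with hF
  have hFp : ∀ z, ∀ l ∈ L.lattice, F (z + l) = F z := by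
    intro z l hl
    simp only [hF, add_mem_lattice_iff hl]
    split_ifs with h
    · rfl
    · exact hp z h l hl
  have hd : ∀ z, z ∉ L.lattice → DifferentiableAt ℂ F z := by
    intro z hz
    refine (hf z hz).congr_of_eventuallyEq ?_
    filter_upwards [(isOpen_compl_lattice L).mem_nhds hz] with y hy
    exact if_neg hy
  have hpunct : ∀ᶠ z in 𝓝[≠] (0 : ℂ), z ∉ L.lattice := by
    filter_upwards [self_mem_nhdsWithin,
      mem_nhdsWithin_of_mem_nhds (L.compl_lattice_sdiff_singleton_mem_nhds 0)] with z hz hz'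
    simp_all
  have hd0 : DifferentiableAt ℂ F 0 := by
    have hc : ContinuousAt F 0 := by
      rw [continuousAt_iff_punctured_nhds]
      have : F 0 = c := if_pos (zero_mem _)
      rw [this]
      refine h0.congr' ?_
      filter_upwards [hpunct] with z hz
      exact (if_neg hz).symm
    exact (Complex.analyticAt_of_differentiable_on_punctured_nhds_of_continuousAt
      (hpunct.mono hd) hc).differentiableAt
  have hdiff : Differentiable ℂ F := by
    intro z
    by_cases hz : z ∈ L.lattice
    · have : F = fun y => F (y + -z) := funext fun y => (hFp y (-z) (neg_mem hz)).symm
      rw [this]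
      exact (differentiableAt_comp_add_const ..).2 (by simpa using hd0)
    · exact hd z hz
  intro z hz
  have h1 := hdiff.apply_eq_apply_of_bounded (IsZLattice.isCompact_range_of_periodic L.lattice F
    hdiff.continuous fun z l hl => hFp z l hl).isBounded z 0
  simpa [hF, hz] using h1

theorem eventually_notMem_lattice (L : PeriodPair) : ∀ᶠ z in 𝓝[≠] (0 : ℂ), z ∉ L.lattice := by
  filter_upwards [self_mem_nhdsWithin,
    mem_nhdsWithin_of_mem_nhds (L.compl_lattice_sdiff_singleton_mem_nhds 0)] with z hz hz'
  simp_all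

/-- A quasi-periodic function that extends analytically to the origin and vanishes there to second
order vanishes identically. -/
theorem eq_zero_of_quasiPeriodic {L : PeriodPair} {f g : ℂ → ℂ} {c₁ c₂ : ℂ}
    (hf : ∀ z, z ∉ L.lattice → DifferentiableAt ℂ f z)
    (h1 : ∀ z, z ∉ L.lattice → f (z + L.ω₁) = f z + c₁)
    (h2 : ∀ z, z ∉ L.lattice → f (z + L.ω₂) = f z + c₂)
    (hg : AnalyticAt ℂ g 0) (hfg : f =ᶠ[𝓝[≠] 0] g) (hg0 : g 0 = 0) (hg1 : deriv g 0 = 0) :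
    ∀ z, z ∉ L.lattice → f z = 0 := by
  have hO := isOpen_compl_lattice L
  have hfO : DifferentiableOn ℂ f (L.lattice : Set ℂ)ᶜ := fun z hz =>
    (hf z hz).differentiableWithinAt
  have hper : ∀ (l c : ℂ), l ∈ L.lattice → (∀ z, z ∉ L.lattice → f (z + l) = f z + c) →
      ∀ z, z ∉ L.lattice → deriv f (z + l) = deriv f z := by
    intro l c hl h z hz
    rw [← deriv_comp_add_const]
    have : (fun z => f (z + l)) =ᶠ[𝓝 z] fun z => f z + c := by
      filter_upwards [hO.mem_nhds hz] with y hy using h y hy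
    rw [this.deriv_eq, deriv_add_const]
  -- The derivative is genuinely periodic and tends to g'(0) = 0 at the lattice, so Liouville's
  -- theorem kills it; f is then a constant, which g(0) = 0 determines.
  have hd : ∀ z, z ∉ L.lattice → deriv f z = 0 := by
    refine eq_const_of_periodic (fun z hz => ?_)
      (periodic_of_generators (hper _ _ L.ω₁_mem_lattice h1) (hper _ _ L.ω₂_mem_lattice h2)) ?_
    · exact (hfO.analyticAt (hO.mem_nhds hz)).deriv.differentiableAt
    · have h3 : deriv f =ᶠ[𝓝[≠] 0] deriv g := by
        filter_upwards [eventually_eventually_nhdsWithin.2 hfg, self_mem_nhdsWithin] with z hz hz0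
        have hz0 : z ≠ 0 := hz0
        rw [IsOpen.nhdsWithin_eq isOpen_compl_singleton hz0] at hz
        exact Filter.EventuallyEq.deriv_eq hz
      have h4 := hg.deriv.continuousAt.tendsto
      rw [hg1] at h4
      exact (h4.mono_left nhdsWithin_le_nhds).congr' h3.symm
  obtain ⟨c, hc⟩ := hO.exists_is_const_of_deriv_eq_zero (isPreconnected_compl_lattice L) hfO
    (fun z hz => hd z hz)
  have h5 : Tendsto f (𝓝[≠] 0) (𝓝 0) := by
    have h4 := hg.continuousAt.tendsto
    rw [hg0] at h4
    exact (h4.mono_left nhdsWithin_le_nhds).congr' hfg.symm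
  have h6 : Tendsto f (𝓝[≠] 0) (𝓝 c) := tendsto_const_nhds.congr' (by
    filter_upwards [eventually_notMem_lattice L] with z hz using (hc z hz).symm)
  intro z hz
  rw [hc z hz, tendsto_nhds_unique h6 h5]

/-- Taylor's formula at the origin for a function vanishing to order `n`. -/
theorem exists_eq_pow_mul {f : ℂ → ℂ} (hf : AnalyticAt ℂ f 0) {n : ℕ}
    (h : ∀ i < n, iteratedDeriv i f 0 = 0) :
    ∃ g : ℂ → ℂ, AnalyticAt ℂ g 0 ∧ (∀ᶠ z in 𝓝 0, f z = z ^ n * g z) ∧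
      iteratedDeriv n f 0 = n.factorial * g 0 := by
  obtain ⟨g, hg, hfg⟩ := (natCast_le_analyticOrderAt hf).1
    ((natCast_le_analyticOrderAt_iff_iteratedDeriv_eq_zero hf).2 h)
  simp only [sub_zero, smul_eq_mul] at hfg
  refine ⟨g, hg, hfg, ?_⟩
  have h1 : f =ᶠ[𝓝 0] fun z => z ^ n * g z := hfg
  rw [h1.iteratedDeriv_eq, iteratedDeriv_fun_mul (by fun_prop) hg.contDiffAt,
    Finset.sum_eq_single n]
  · simp [Nat.descFactorial_self]
  · intro i _ hi
    rw [iteratedDeriv_fun_pow_zero, if_neg hi]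
    simp
  · simp

/-- The Taylor coefficients at 0 are Eisenstein sums: the constant one is absent, the linear one
vanishes by oddness, and the quadratic one is 3G₄ = g₂/20. -/
theorem exists_weierstrassPExcept_expansion (L : PeriodPair) :
    ∃ A : ℂ → ℂ, AnalyticAt ℂ A 0 ∧ (∀ᶠ z in 𝓝 0, ℘[L - (0 : ℂ)] z = z ^ 2 * A z) ∧
      A 0 = L.g₂ / 20 := by
  have hs := fun n => L.iteratedDeriv_weierstrassPExcept_self 0 (n := n)
  obtain ⟨A, hA, h1, h2⟩ := exists_eq_pow_mul (L.analyticAt_weierstrassPExcept 0) (n := 2) (by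
    intro i hi
    rw [hs]
    interval_cases i
    · simp
    · simp [L.G_eq_zero_of_odd 3 (by decide)])
  refine ⟨A, hA, h1, ?_⟩
  rw [hs] at h2
  simp [Nat.factorial] at h2
  rw [PeriodPair.g₂]
  linear_combination -h2 / 2

theorem exists_zetaReg_expansion (L : PeriodPair) :
    ∃ B : ℂ → ℂ, AnalyticAt ℂ B 0 ∧ (∀ᶠ z in 𝓝 0, zetaReg (z, periods L) = z ^ 3 * B z) ∧
      B 0 = -L.g₂ / 60 := by
  have hs := fun n => L.iteratedDeriv_weierstrassPExcept_self 0 (n := n)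
  have hev : ∀ᶠ z in 𝓝 (0 : ℂ), (z, periods L) ∈ regularDomain := by
    have : Continuous fun z : ℂ => (z, periods L) := by fun_prop
    exact this.continuousAt.eventually_mem
      (isOpen_regularDomain.mem_nhds (zero_mem_regularDomain L))
  have hz : AnalyticAt ℂ (fun z => zetaReg (z, periods L)) 0 := by
    rw [Complex.analyticAt_iff_eventually_differentiableAt]
    exact hev.mono fun z hz => (hasDerivAt_zetaReg L hz).differentiableAt
  have hder : deriv (fun z => zetaReg (z, periods L)) =ᶠ[𝓝 0] fun z => -℘[L - (0 : ℂ)] z :=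
    hev.mono fun z hz => (hasDerivAt_zetaReg L hz).deriv
  have hs' : ∀ n, iteratedDeriv (n + 1) (fun z => zetaReg (z, periods L)) 0 =
      -iteratedDeriv n ℘[L - (0 : ℂ)] 0 := by
    intro n
    rw [iteratedDeriv_succ', hder.iteratedDeriv_eq, iteratedDeriv_fun_neg]
  obtain ⟨B, hB, h1, h2⟩ := exists_eq_pow_mul hz (n := 3) (by
    intro i hi
    interval_cases i
    · simp
    · rw [hs', hs]; simp
    · rw [hs', hs]; simp [L.G_eq_zero_of_odd 3 (by decide)])
  refine ⟨B, hB, h1, ?_⟩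
  rw [hs', hs] at h2
  simp [Nat.factorial] at h2
  rw [PeriodPair.g₂]
  linear_combination -h2 / 6

theorem hasDerivAt_weierstrassP (L : PeriodPair) {z : ℂ} (hz : z ∉ L.lattice) :
    HasDerivAt ℘[L] (℘'[L] z) z := by
  have := (L.analyticOnNhd_weierstrassP z hz).differentiableAt.hasDerivAt
  rwa [L.deriv_weierstrassP] at this

/-- The derivative of the zeta function in the direction `v` of the space of periods. -/
def periodDeriv (v : ℂ × ℂ) (q : ℂ × ℂ × ℂ) : ℂ := fderiv ℂ zetaReg q (0, v)

theorem contDiffOn_fderiv_zetaReg : ContDiffOn ℂ ∞ (fderiv ℂ zetaReg) regularDomain :=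
  contDiffOn_zetaReg.fderiv_of_isOpen isOpen_regularDomain (by simp)

theorem differentiableAt_fderiv_zetaReg {q : ℂ × ℂ × ℂ} (hq : q ∈ regularDomain) :
    DifferentiableAt ℂ (fderiv ℂ zetaReg) q :=
  (contDiffOn_fderiv_zetaReg.contDiffAt (isOpen_regularDomain.mem_nhds hq)).differentiableAt
    (by simp)

theorem fderiv_zetaReg_apply_one (L : PeriodPair) {z : ℂ} (hz : (z, periods L) ∈ regularDomain) :
    fderiv ℂ zetaReg (z, periods L) (1, 0) = -℘[L - (0 : ℂ)] z := by
  have hline : HasDerivAt (fun z : ℂ => (z, periods L)) ((1 : ℂ), (0 : ℂ × ℂ)) z :=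
    (hasDerivAt_id z).prodMk (hasDerivAt_const z _)
  have h0 : HasFDerivAt zetaReg (fderiv ℂ zetaReg (z, periods L)) (z, periods L) :=
    (hasFDerivAt_zetaReg hz).differentiableAt.hasFDerivAt
  have h := h0.comp_hasDerivAt z hline
  have h' : HasDerivAt (zetaReg ∘ fun z => (z, periods L)) (-℘[L - (0 : ℂ)] z) z :=
    hasDerivAt_zetaReg L hz
  exact h.unique h'

theorem second_fderiv_zetaReg_symm {q : ℂ × ℂ × ℂ} (hq : q ∈ regularDomain) (a b : ℂ × ℂ × ℂ) :
    fderiv ℂ (fderiv ℂ zetaReg) q a b = fderiv ℂ (fderiv ℂ zetaReg) q b a :=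
  ((contDiffOn_zetaReg.contDiffAt (isOpen_regularDomain.mem_nhds hq)).isSymmSndFDerivAt
    (by rw [minSmoothness_of_isRCLikeNormedField]; exact WithTop.coe_le_coe.2 (le_top : (2 : ℕ∞) ≤ ⊤))) a b

/-- Symmetry of second derivatives: differentiating in z the variation with the periods is the same
as varying ∂ζ/∂z. Thus information on the variation of ζ passes to ℘. -/
theorem hasDerivAt_periodDeriv {v : ℂ × ℂ} {z : ℂ} {w : ℂ × ℂ} (hq : (z, w) ∈ regularDomain) :
    HasDerivAt (fun z => periodDeriv v (z, w))
      (fderiv ℂ (fun q => fderiv ℂ zetaReg q (1, 0)) (z, w) (0, v)) z := by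
  have hline : HasDerivAt (fun z : ℂ => (z, w)) ((1 : ℂ), (0 : ℂ × ℂ)) z :=
    (hasDerivAt_id z).prodMk (hasDerivAt_const z _)
  have h1 := (differentiableAt_fderiv_zetaReg hq).hasFDerivAt
  have h2 : HasDerivAt (fun z => fderiv ℂ zetaReg (z, w))
      (fderiv ℂ (fderiv ℂ zetaReg) (z, w) (1, 0)) z := h1.comp_hasDerivAt z hline
  have h3 : HasFDerivAt (fun q => fderiv ℂ zetaReg q (1, 0))
      ((fderiv ℂ (fderiv ℂ zetaReg) (z, w)).flip (1, 0)) (z, w) := by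
    simpa using h1.clm_apply (hasFDerivAt_const ((1 : ℂ), (0 : ℂ × ℂ)) (z, w))
  have h4 : HasDerivAt (fun z => fderiv ℂ zetaReg (z, w) (0, v))
      (fderiv ℂ (fderiv ℂ zetaReg) (z, w) (1, 0) (0, v)) z := by
    simpa using h2.clm_apply (hasDerivAt_const z ((0 : ℂ), v))
  rw [h3.fderiv, ContinuousLinearMap.flip_apply, second_fderiv_zetaReg_symm hq]
  exact h4

theorem eventually_pairOf {w : ℂ × ℂ} (hw : latticeDet w ≠ 0) : ∀ᶠ w' in 𝓝 w, latticeDet w' ≠ 0 :=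
  continuous_latticeDet.continuousAt.eventually_ne hw

/-- The regular part of ζ and its z-derivative vanish at z = 0 for every lattice, so this fact and
the next give the variation with the periods a double zero at the origin. -/
theorem periodDeriv_zero (v : ℂ × ℂ) (L : PeriodPair) : periodDeriv v (0, periods L) = 0 := by
  have hline : HasDerivAt (fun s : ℂ => ((0 : ℂ), periods L + s • v)) ((0 : ℂ), v) 0 := by
    simpa using (hasDerivAt_const (0 : ℂ) (0 : ℂ)).prodMk
      (((hasDerivAt_id (0 : ℂ)).smul_const v).const_add (periods L))
  have h1 : HasFDerivAt zetaReg (fderiv ℂ zetaReg (0, periods L)) (0, periods L + (0 : ℂ) • v) := by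
    simpa using (hasFDerivAt_zetaReg (zero_mem_regularDomain L)).differentiableAt.hasFDerivAt
  have h2 := h1.comp_hasDerivAt (0 : ℂ) hline
  have h3 : zetaReg ∘ (fun s : ℂ => ((0 : ℂ), periods L + s • v)) = fun _ => 0 := by
    ext s; simp
  rw [h3] at h2
  exact h2.unique (hasDerivAt_const _ _)

theorem deriv_periodDeriv_zero (v : ℂ × ℂ) (L : PeriodPair) :
    deriv (fun z => periodDeriv v (z, periods L)) 0 = 0 := by
  have hq := zero_mem_regularDomain L
  rw [(hasDerivAt_periodDeriv hq).deriv]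
  have hd : DifferentiableAt ℂ (fun q => fderiv ℂ zetaReg q (1, 0)) (0, periods L) :=
    (differentiableAt_fderiv_zetaReg hq).clm_apply (differentiableAt_const _)
  have hline : HasDerivAt (fun s : ℂ => ((0 : ℂ), periods L + s • v)) ((0 : ℂ), v) 0 := by
    simpa using (hasDerivAt_const (0 : ℂ) (0 : ℂ)).prodMk
      (((hasDerivAt_id (0 : ℂ)).smul_const v).const_add (periods L))
  have h1 : HasFDerivAt (fun q => fderiv ℂ zetaReg q (1, 0))
      (fderiv ℂ (fun q => fderiv ℂ zetaReg q (1, 0)) (0, periods L))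
      (0, periods L + (0 : ℂ) • v) := by
    simpa using hd.hasFDerivAt
  have h2 := h1.comp_hasDerivAt (0 : ℂ) hline
  have hc : ContinuousAt (fun s : ℂ => periods L + s • v) 0 := by fun_prop
  have h3 : ((fun q => fderiv ℂ zetaReg q (1, 0)) ∘ fun s : ℂ => ((0 : ℂ), periods L + s • v))
      =ᶠ[𝓝 0] fun _ => 0 := by
    have h4 : ∀ᶠ s in 𝓝 (0 : ℂ), latticeDet (periods L + s • v) ≠ 0 :=
      hc.eventually (by simpa using eventually_pairOf (latticeDet_periods_ne_zero L))
    filter_upwards [h4] with s hs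
    have h5 := fderiv_zetaReg_apply_one (pairOf _ hs) (zero_mem_regularDomain _)
    simpa using h5
  exact (h2.congr_of_eventuallyEq h3.symm).unique (hasDerivAt_const _ _)

/-- The chain rule for a point that moves together with the lattice, as translates by a period and
half periods do. -/
theorem hasDerivAt_zeta_curve {L : PeriodPair} {z : ℂ} (hz : z ∉ L.lattice) {Z : ℂ → ℂ}
    {W : ℂ → ℂ × ℂ} {a : ℂ} {v : ℂ × ℂ} {s : ℂ} (hZ : HasDerivAt Z a s) (hW : HasDerivAt W v s)
    (hZs : Z s = z) (hWs : W s = periods L) :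
    HasDerivAt (fun s => zeta (Z s, W s)) (-℘[L] z * a + periodDeriv v (z, periods L)) s := by
  have h0 : z ≠ 0 := by rintro rfl; exact hz (zero_mem _)
  have hq := mem_regularDomain_of_notMem hz
  have h1 : HasFDerivAt zetaReg (fderiv ℂ zetaReg (z, periods L)) (Z s, W s) := by
    rw [hZs, hWs]
    exact (hasFDerivAt_zetaReg hq).differentiableAt.hasFDerivAt
  have h2 : HasDerivAt (fun s => zetaReg (Z s, W s)) (fderiv ℂ zetaReg (z, periods L) (a, v)) s := by
    have h := h1.comp_hasDerivAt s (hZ.prodMk hW)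
    exact h
  have h3 : HasDerivAt (fun s => 1 / Z s) (-a / z ^ 2) s := by
    have := hZ.fun_inv (by rwa [hZs])
    rw [hZs] at this
    simpa using this
  have h4 : fderiv ℂ zetaReg (z, periods L) (a, v) =
      a * -℘[L - (0 : ℂ)] z + periodDeriv v (z, periods L) := by
    rw [← fderiv_zetaReg_apply_one L hq, periodDeriv, ← smul_eq_mul, ← map_smul, ← map_add]
    simp
  refine (h3.fun_add h2).congr_deriv ?_
  rw [h4, weierstrassP_eq]
  ring

theorem differentiableAt_eta {L : PeriodPair} :
    DifferentiableAt ℂ eta₁ (periods L) ∧ DifferentiableAt ℂ eta₂ (periods L) := by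
  have key : ∀ l : ℂ, l ∉ L.lattice → DifferentiableAt ℂ zeta (l, periods L) := by
    intro l hl
    exact (contDiffOn_zeta.contDiffAt (isOpen_zetaDomain.mem_nhds
      (mem_zetaDomain_iff.2 hl))).differentiableAt (by simp)
  constructor
  · have h1 : DifferentiableAt ℂ (fun w : ℂ × ℂ => (w.1 / 2, w)) (periods L) := by fun_prop
    exact (DifferentiableAt.comp (g := zeta) (f := fun w : ℂ × ℂ => (w.1 / 2, w)) (periods L)
      (key _ L.ω₁_div_two_notMem_lattice) h1).const_mul 2
  · have h1 : DifferentiableAt ℂ (fun w : ℂ × ℂ => (w.2 / 2, w)) (periods L) := by fun_prop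
    exact (DifferentiableAt.comp (g := zeta) (f := fun w : ℂ × ℂ => (w.2 / 2, w)) (periods L)
      (key _ L.ω₂_div_two_notMem_lattice) h1).const_mul 2

theorem contDiffOn_eta :
    ContDiffOn ℂ ∞ eta₁ {w | latticeDet w ≠ 0} ∧ ContDiffOn ℂ ∞ eta₂ {w | latticeDet w ≠ 0} := by
  have key : ∀ w : ℂ × ℂ, ∀ l : ℂ, (hw : latticeDet w ≠ 0) → l ∉ (pairOf w hw).lattice →
      ContDiffAt ℂ ∞ zeta (l, w) := by
    intro w l hw hl
    exact contDiffOn_zeta.contDiffAt (isOpen_zetaDomain.mem_nhds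
      ((mem_zetaDomain_iff (L := pairOf w hw)).2 hl))
  constructor
  · intro w hw
    have h1 : ContDiffAt ℂ ∞ (fun w : ℂ × ℂ => (w.1 / 2, w)) w := by fun_prop
    exact (contDiffAt_const.mul (ContDiffAt.comp (g := zeta) (f := fun w : ℂ × ℂ => (w.1 / 2, w)) w
      (key w _ hw (pairOf w hw).ω₁_div_two_notMem_lattice) h1)).contDiffWithinAt
  · intro w hw
    have h1 : ContDiffAt ℂ ∞ (fun w : ℂ × ℂ => (w.2 / 2, w)) w := by fun_prop
    exact (contDiffAt_const.mul (ContDiffAt.comp (g := zeta) (f := fun w : ℂ × ℂ => (w.2 / 2, w)) w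
      (key w _ hw (pairOf w hw).ω₂_div_two_notMem_lattice) h1)).contDiffWithinAt

theorem hasDerivAt_line (w v : ℂ × ℂ) : HasDerivAt (fun s : ℂ => w + s • v) v 0 := by
  simpa using (((hasDerivAt_id (0 : ℂ)).smul_const v).const_add w)

/-- Differentiate ζ(z + ωᵢ, w) = ζ(z, w) + ηᵢ(w) with respect to w in the direction v. The argument
z + ωᵢ moves as well, which produces the term in ℘; the constant is the derivative of ηᵢ. -/
theorem periodDeriv_add {L : PeriodPair} (v : ℂ × ℂ) :
    (∃ c, ∀ z, z ∉ L.lattice → periodDeriv v (z + L.ω₁, periods L) =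
      periodDeriv v (z, periods L) + ℘[L] z * v.1 + c) ∧
    (∃ c, ∀ z, z ∉ L.lattice → periodDeriv v (z + L.ω₂, periods L) =
      periodDeriv v (z, periods L) + ℘[L] z * v.2 + c) := by
  have hev : ∀ z, z ∉ L.lattice → ∀ᶠ s in 𝓝 (0 : ℂ), (z, periods L + s • v) ∈ zetaDomain := by
    intro z hz
    have hc : ContinuousAt (fun s : ℂ => (z, periods L + s • v)) 0 := by fun_prop
    exact hc.eventually_mem (isOpen_zetaDomain.mem_nhds (by simpa using mem_zetaDomain_iff.2 hz))
  have hl := hasDerivAt_line (periods L) v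
  constructor
  · refine ⟨fderiv ℂ eta₁ (periods L) v, fun z hz => ?_⟩
    have hz' : z + L.ω₁ ∉ L.lattice := by rwa [add_mem_lattice_iff L.ω₁_mem_lattice]
    have hZ : HasDerivAt (fun s : ℂ => z + (periods L + s • v).1) v.1 0 := by
      have h := (HasFDerivAt.comp_hasDerivAt (0 : ℂ) hasFDerivAt_fst hl).const_add z
      exact h
    have h1 := hasDerivAt_zeta_curve hz' hZ hl (by simp [periods]) (by simp)
    have h2 := hasDerivAt_zeta_curve hz (hasDerivAt_const (0 : ℂ) z) hl rfl (by simp)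
    have h3 : HasFDerivAt eta₁ (fderiv ℂ eta₁ (periods L)) (periods L + (0 : ℂ) • v) := by
      simpa using differentiableAt_eta.1.hasFDerivAt
    have h4 := h2.fun_add (h3.comp_hasDerivAt (0 : ℂ) hl)
    have h5 : (fun s : ℂ => zeta (z + (periods L + s • v).1, periods L + s • v)) =ᶠ[𝓝 0]
        fun s => zeta (z, periods L + s • v) + (eta₁ ∘ fun s : ℂ => periods L + s • v) s := by
      filter_upwards [hev z hz] with s hs
      exact zeta_add_ω₁ (pairOf _ hs.1) ((mem_zetaDomain_iff (L := pairOf _ hs.1)).1 hs)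
    have h6 := h1.unique (h4.congr_of_eventuallyEq h5)
    have h7 := L.weierstrassP_add_coe z ⟨L.ω₁, L.ω₁_mem_lattice⟩
    simp only at h7
    rw [h7] at h6
    linear_combination h6
  · refine ⟨fderiv ℂ eta₂ (periods L) v, fun z hz => ?_⟩
    have hz' : z + L.ω₂ ∉ L.lattice := by rwa [add_mem_lattice_iff L.ω₂_mem_lattice]
    have hZ : HasDerivAt (fun s : ℂ => z + (periods L + s • v).2) v.2 0 := by
      have h := (HasFDerivAt.comp_hasDerivAt (0 : ℂ) hasFDerivAt_snd hl).const_add z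
      exact h
    have h1 := hasDerivAt_zeta_curve hz' hZ hl (by simp [periods]) (by simp)
    have h2 := hasDerivAt_zeta_curve hz (hasDerivAt_const (0 : ℂ) z) hl rfl (by simp)
    have h3 : HasFDerivAt eta₂ (fderiv ℂ eta₂ (periods L)) (periods L + (0 : ℂ) • v) := by
      simpa using differentiableAt_eta.2.hasFDerivAt
    have h4 := h2.fun_add (h3.comp_hasDerivAt (0 : ℂ) hl)
    have h5 : (fun s : ℂ => zeta (z + (periods L + s • v).2, periods L + s • v)) =ᶠ[𝓝 0]
        fun s => zeta (z, periods L + s • v) + (eta₂ ∘ fun s : ℂ => periods L + s • v) s := by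
      filter_upwards [hev z hz] with s hs
      exact zeta_add_ω₂ (pairOf _ hs.1) ((mem_zetaDomain_iff (L := pairOf _ hs.1)).1 hs)
    have h6 := h1.unique (h4.congr_of_eventuallyEq h5)
    have h7 := L.weierstrassP_add_coe z ⟨L.ω₂, L.ω₂_mem_lattice⟩
    simp only at h7
    rw [h7] at h6
    linear_combination h6

/-- Differentiate the cubic equation ℘'² = 4℘³ − g₂℘ − g₃ and cancel ℘'. By analyticity on a
connected set one of the two factors vanishes identically, and it is not ℘', since ℘ has a pole. -/
theorem hasDerivAt_derivWeierstrassP (L : PeriodPair) {z : ℂ} (hz : z ∉ L.lattice) :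
    HasDerivAt ℘'[L] (6 * ℘[L] z ^ 2 - L.g₂ / 2) z := by
  have hO := isOpen_compl_lattice L
  have hd := (L.analyticOnNhd_derivWeierstrassP z hz).differentiableAt.hasDerivAt
  suffices h : deriv ℘'[L] z = 6 * ℘[L] z ^ 2 - L.g₂ / 2 by rwa [h] at hd
  set f : ℂ → ℂ := fun z => deriv ℘'[L] z - (6 * ℘[L] z ^ 2 - L.g₂ / 2) with hf
  have hfa : AnalyticOnNhd ℂ f (L.lattice : Set ℂ)ᶜ := fun y hy => by
    have h1 := (L.analyticOnNhd_derivWeierstrassP y hy).deriv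
    have h2 := L.analyticOnNhd_weierstrassP y hy
    fun_prop
  have hmul : ∀ y ∈ (L.lattice : Set ℂ)ᶜ, f y • ℘'[L] y = 0 := by
    intro y hy
    have h1 := (L.analyticOnNhd_derivWeierstrassP y hy).differentiableAt.hasDerivAt
    have h2 := hasDerivAt_weierstrassP L hy
    have h3 : HasDerivAt (fun z => ℘'[L] z ^ 2) _ y := h1.fun_pow 2
    have h4 : HasDerivAt (fun z => 4 * ℘[L] z ^ 3 - L.g₂ * ℘[L] z - L.g₃) _ y :=
      (((h2.fun_pow 3).const_mul 4).fun_sub (h2.const_mul L.g₂)).sub_const L.g₃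
    have h5 : (fun z => ℘'[L] z ^ 2) =ᶠ[𝓝 y] fun z => 4 * ℘[L] z ^ 3 - L.g₂ * ℘[L] z - L.g₃ := by
      filter_upwards [hO.mem_nhds hy] with x hx using L.derivWeierstrassP_sq x hx
    have h6 := h3.unique (h4.congr_of_eventuallyEq h5)
    simp only [hf, smul_eq_mul]
    push_cast at h6
    linear_combination h6 / 2
  have h1 := AnalyticOnNhd.eq_zero_or_eq_zero_of_smul_eq_zero hfa L.analyticOnNhd_derivWeierstrassP
    hmul (isPreconnected_compl_lattice L)
  rcases h1 with h1 | h1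
  · have := h1 z hz
    simp only [hf] at this
    linear_combination this
  · exfalso
    have h2 := L.not_continuousAt_weierstrassP 0 (zero_mem _)
    obtain ⟨c, hc⟩ := hO.exists_is_const_of_deriv_eq_zero (isPreconnected_compl_lattice L)
      (fun z hz => (hasDerivAt_weierstrassP L hz).differentiableAt.differentiableWithinAt)
      (fun z hz => by rw [(hasDerivAt_weierstrassP L hz).deriv]; exact h1 z hz)
    have h3 := L.order_weierstrassP 0 (zero_mem _)
    have h4 : ℘[L] =ᶠ[𝓝[≠] 0] fun _ => c := by
      filter_upwards [eventually_notMem_lattice L] with z hz using hc z hz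
    rw [meromorphicOrderAt_congr h4] at h3
    have h5 : (0 : WithTop ℤ) ≤ meromorphicOrderAt (fun _ : ℂ => c) 0 :=
      analyticAt_const.meromorphicOrderAt_nonneg
    rw [h3] at h5
    exact absurd h5 (by decide)

/-- The Frobenius-Stickelberger formula: the derivative of the zeta function along the vector field
`η₁ ∂/∂ω₁ + η₂ ∂/∂ω₂` on the space of periods. -/
theorem periodDeriv_eta (L : PeriodPair) {z : ℂ} (hz : z ∉ L.lattice) :
    periodDeriv (eta₁ (periods L), eta₂ (periods L)) (z, periods L) =
      ℘'[L] z / 2 + zeta (z, periods L) * ℘[L] z - L.g₂ / 12 * z := by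
  set v := (eta₁ (periods L), eta₂ (periods L)) with hv
  obtain ⟨A, hA, hA1, hA0⟩ := exists_weierstrassPExcept_expansion L
  obtain ⟨B, hB, hB1, hB0⟩ := exists_zetaReg_expansion L
  -- Inserting ℘ = 1/z² + z²A and ζ = 1/z + z³B, the poles on the right-hand side cancel and zH
  -- remains. Moreover H(0) = g₂/10 − g₂/60 − g₂/12 = 0.
  set H : ℂ → ℂ := fun z => 2 * A z + z * deriv A z / 2 + B z + z ^ 4 * A z * B z - L.g₂ / 12
    with hH
  have hHa : AnalyticAt ℂ H 0 := by
    have := hA.deriv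
    fun_prop
  have hH0 : H 0 = 0 := by
    simp only [hH, hA0, hB0]; ring
  have hA' : ∀ᶠ z in 𝓝 (0 : ℂ), ℘'[L - (0 : ℂ)] z = 2 * z * A z + z ^ 2 * deriv A z := by
    filter_upwards [hA1.eventually_nhds, hA.eventually_analyticAt,
      L.compl_lattice_sdiff_singleton_mem_nhds 0] with z h1 h2 h3
    rw [← L.eqOn_deriv_weierstrassPExcept_derivWeierstrassPExcept 0 h3]
    have h4 : HasDerivAt (fun z : ℂ => z ^ 2 * A z) _ z :=
      (hasDerivAt_pow 2 z).fun_mul h2.differentiableAt.hasDerivAt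
    have h5 : ℘[L - (0 : ℂ)] =ᶠ[𝓝 z] fun z => z ^ 2 * A z := h1
    rw [h5.deriv_eq, h4.deriv]
    simp
  have hq := zero_mem_regularDomain L
  have hreg : ∀ᶠ z in 𝓝 (0 : ℂ), (z, periods L) ∈ regularDomain := by
    have : Continuous fun z : ℂ => (z, periods L) := by fun_prop
    exact this.continuousAt.eventually_mem (isOpen_regularDomain.mem_nhds hq)
  have hDa : AnalyticAt ℂ (fun z => periodDeriv v (z, periods L)) 0 := by
    rw [Complex.analyticAt_iff_eventually_differentiableAt]
    exact hreg.mono fun z hz => (hasDerivAt_periodDeriv hz).differentiableAt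
  -- The direction (η₁, η₂) is dictated by quasi-periodicity: the increment ℘·vᵢ of the period
  -- derivative must match the increment ηᵢ℘ of ζ℘. The difference of both sides is then
  -- quasi-periodic with a double zero at 0.
  have key := eq_zero_of_quasiPeriodic (L := L)
    (f := fun z => periodDeriv v (z, periods L) -
      (℘'[L] z / 2 + zeta (z, periods L) * ℘[L] z - L.g₂ / 12 * z))
    (g := fun z => periodDeriv v (z, periods L) - z * H z)
    (c₁ := (periodDeriv_add (L := L) v).1.choose + L.g₂ / 12 * L.ω₁)
    (c₂ := (periodDeriv_add (L := L) v).2.choose + L.g₂ / 12 * L.ω₂) ?_ ?_ ?_ ?_ ?_ ?_ ?_ z hz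
  · linear_combination key
  · intro z hz
    have h1 := (hasDerivAt_periodDeriv (v := v) (mem_regularDomain_of_notMem hz)).differentiableAt
    have h2 := (hasDerivAt_weierstrassP L hz).differentiableAt
    have h3 := (hasDerivAt_derivWeierstrassP L hz).differentiableAt
    have h4 := (hasDerivAt_zeta L hz).differentiableAt
    fun_prop
  · intro z hz
    have h1 := (periodDeriv_add (L := L) v).1.choose_spec z hz
    have h2 := L.weierstrassP_add_coe z ⟨L.ω₁, L.ω₁_mem_lattice⟩
    have h3 := L.derivWeierstrassP_add_coe z ⟨L.ω₁, L.ω₁_mem_lattice⟩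
    simp only at h2 h3
    rw [h1, h2, h3, zeta_add_ω₁ L hz]
    simp only [hv]
    ring
  · intro z hz
    have h1 := (periodDeriv_add (L := L) v).2.choose_spec z hz
    have h2 := L.weierstrassP_add_coe z ⟨L.ω₂, L.ω₂_mem_lattice⟩
    have h3 := L.derivWeierstrassP_add_coe z ⟨L.ω₂, L.ω₂_mem_lattice⟩
    simp only at h2 h3
    rw [h1, h2, h3, zeta_add_ω₂ L hz]
    simp only [hv]
    ring
  · exact hDa.fun_sub (analyticAt_id.fun_mul hHa)
  · filter_upwards [self_mem_nhdsWithin, mem_nhdsWithin_of_mem_nhds hA1,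
      mem_nhdsWithin_of_mem_nhds hB1, mem_nhdsWithin_of_mem_nhds hA'] with z hz h1 h2 h3
    have hz : z ≠ 0 := hz
    rw [derivWeierstrassP_eq, weierstrassP_eq, zeta, h1, h2, h3]
    simp only [hH]
    field_simp
    ring
  · simp [periodDeriv_zero]
  · have h1 := deriv_periodDeriv_zero v L
    have h2 := hDa.differentiableAt.hasDerivAt
    rw [h1] at h2
    have h3 := h2.fun_sub ((hasDerivAt_id (0 : ℂ)).fun_mul hHa.differentiableAt.hasDerivAt)
    simpa [hH0] using h3.deriv

theorem derivWeierstrassP_half {L : PeriodPair} {l : ℂ} (hl : l ∈ L.lattice) :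
    ℘'[L] (l / 2) = 0 := by
  have h1 := L.derivWeierstrassP_add_coe (-(l / 2)) ⟨l, hl⟩
  simp only at h1
  rw [show -(l / 2) + l = l / 2 by ring, L.derivWeierstrassP_neg] at h1
  linear_combination h1 / 2

/-- The Weierstrass function as a function of the variable and the periods. -/
def wpFun (q : ℂ × ℂ × ℂ) : ℂ := 1 / q.1 ^ 2 - fderiv ℂ zetaReg q (1, 0)

/-- The derivative of the Weierstrass function as a function of the variable and the periods. -/
def wpDeriv (q : ℂ × ℂ × ℂ) : ℂ := fderiv ℂ wpFun q (1, 0)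

theorem wpFun_eq {L : PeriodPair} {z : ℂ} (hz : z ∉ L.lattice) :
    wpFun (z, periods L) = ℘[L] z := by
  rw [wpFun, fderiv_zetaReg_apply_one L (mem_regularDomain_of_notMem hz), weierstrassP_eq]
  ring

theorem contDiffOn_wpFun : ContDiffOn ℂ ∞ wpFun zetaDomain := by
  intro q hq
  rw [zetaDomain_eq] at hq
  have h1 : ContDiffAt ℂ ∞ (fderiv ℂ zetaReg) q :=
    contDiffOn_fderiv_zetaReg.contDiffAt (isOpen_regularDomain.mem_nhds hq.1)
  have h2 : q.1 ≠ 0 := hq.2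
  have h3 : ContDiffAt ℂ ∞ (fun q : ℂ × ℂ × ℂ => 1 / q.1 ^ 2) q := by
    fun_prop (disch := exact pow_ne_zero 2 h2)
  exact (h3.sub (h1.clm_apply contDiffAt_const)).contDiffWithinAt

theorem contDiffOn_wpDeriv : ContDiffOn ℂ ∞ wpDeriv zetaDomain :=
  (contDiffOn_wpFun.fderiv_of_isOpen isOpen_zetaDomain (by simp)).clm_apply contDiffOn_const

theorem differentiableAt_wpFun {L : PeriodPair} {z : ℂ} (hz : z ∉ L.lattice) :
    DifferentiableAt ℂ wpFun (z, periods L) :=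
  (contDiffOn_wpFun.contDiffAt (isOpen_zetaDomain.mem_nhds (mem_zetaDomain_iff.2 hz))
    ).differentiableAt (by simp)

theorem wpDeriv_eq {L : PeriodPair} {z : ℂ} (hz : z ∉ L.lattice) :
    wpDeriv (z, periods L) = ℘'[L] z := by
  have hline : HasDerivAt (fun z : ℂ => (z, periods L)) ((1 : ℂ), (0 : ℂ × ℂ)) z :=
    (hasDerivAt_id z).prodMk (hasDerivAt_const z _)
  have h1 := (differentiableAt_wpFun hz).hasFDerivAt.comp_hasDerivAt z hline
  have h2 : (wpFun ∘ fun z => (z, periods L)) =ᶠ[𝓝 z] ℘[L] := by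
    filter_upwards [(isOpen_compl_lattice L).mem_nhds hz] with y hy using wpFun_eq hy
  exact h1.unique ((hasDerivAt_weierstrassP L hz).congr_of_eventuallyEq h2)

/-- The z-derivative of the Frobenius–Stickelberger formula, with ζ' = −℘ and ℘'' = 6℘² − g₂/2. -/
theorem fderiv_wpFun_eta {L : PeriodPair} {z : ℂ} (hz : z ∉ L.lattice) :
    fderiv ℂ wpFun (z, periods L) (0, (eta₁ (periods L), eta₂ (periods L))) =
      L.g₂ / 3 - 2 * ℘[L] z ^ 2 - zeta (z, periods L) * ℘'[L] z := by
  set v := (eta₁ (periods L), eta₂ (periods L)) with hv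
  have hq := mem_regularDomain_of_notMem hz
  have h0 : z ≠ 0 := by rintro rfl; exact hz (zero_mem _)
  have h1 := hasDerivAt_periodDeriv (v := v) hq
  have h2 : (fun z => periodDeriv v (z, periods L)) =ᶠ[𝓝 z] fun z =>
      ℘'[L] z / 2 + zeta (z, periods L) * ℘[L] z - L.g₂ / 12 * z := by
    filter_upwards [(isOpen_compl_lattice L).mem_nhds hz] with y hy using periodDeriv_eta L hy
  have h3 := (((hasDerivAt_derivWeierstrassP L hz).div_const 2).fun_add
    ((hasDerivAt_zeta L hz).fun_mul (hasDerivAt_weierstrassP L hz))).fun_sub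
    ((hasDerivAt_id z).const_mul (L.g₂ / 12))
  have h4 := h1.unique (h3.congr_of_eventuallyEq h2)
  have h5 : HasFDerivAt (fun q : ℂ × ℂ × ℂ => 1 / q.1 ^ 2)
      ((-2 / z ^ 3) • ContinuousLinearMap.fst ℂ ℂ (ℂ × ℂ)) (z, periods L) := by
    have h6 : HasDerivAt (fun z : ℂ => 1 / z ^ 2) (-2 / z ^ 3) z := by
      have := (hasDerivAt_pow 2 z).fun_inv (pow_ne_zero 2 h0)
      simp only [one_div]
      refine this.congr_deriv ?_
      field_simp
      push_cast
      ring
    exact HasDerivAt.comp_hasFDerivAt (𝕜 := ℂ) (h₂ := fun z : ℂ => 1 / z ^ 2)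
      (f := fun q : ℂ × ℂ × ℂ => q.1) (z, periods L) h6 hasFDerivAt_fst
  have h6 : HasFDerivAt (fun q => fderiv ℂ zetaReg q (1, 0))
      (fderiv ℂ (fun q => fderiv ℂ zetaReg q (1, 0)) (z, periods L)) (z, periods L) :=
    ((differentiableAt_fderiv_zetaReg hq).clm_apply (differentiableAt_const _)).hasFDerivAt
  have h7 : HasFDerivAt wpFun _ (z, periods L) := h5.fun_sub h6
  rw [h7.fderiv, sub_apply, h4]
  simp
  ring

/-! ### Homogeneity, and the variation of quasi-periods and half-period values -/

theorem latticePt_smul (c : ℂ) (w : ℂ × ℂ) (n : ℤ × ℤ) :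
    latticePt (c • w) n = c * latticePt w n := by
  simp [latticePt]; ring

theorem zeta_smul {c : ℂ} (hc : c ≠ 0) (z : ℂ) (w : ℂ × ℂ) :
    zeta (c * z, c • w) = c⁻¹ * zeta (z, w) := by
  have h : zetaReg (c * z, c • w) = c⁻¹ * zetaReg (z, w) := by
    rw [zetaReg, zetaReg, ← tsum_mul_left]
    refine tsum_congr fun n => ?_
    simp only [zetaTerm, latticePt_smul, ← mul_sub, mul_pow]
    generalize latticePt w n = l
    by_cases hl : l = 0
    · simp [hl]
    by_cases hzl : z - l = 0
    · simp [hzl]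
    field_simp
  rw [zeta, zeta, h, mul_add, one_div, one_div, mul_inv]

theorem weierstrassP_mul {L L' : PeriodPair} {α : ℂ} (hα : α ≠ 0)
    (h : ∀ z, z ∈ L.lattice ↔ α * z ∈ L'.lattice) (z : ℂ) :
    ℘[L'] (α * z) = (α ^ 2)⁻¹ * ℘[L] z := by
  let e : L.lattice ≃ L'.lattice :=
    { toFun := fun l => ⟨α * l, (h l).1 l.2⟩
      invFun := fun l => ⟨α⁻¹ * l, (h _).2 (by rw [mul_inv_cancel_left₀ hα]; exact l.2)⟩
      left_inv := fun l => by simp [hα]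
      right_inv := fun l => by simp [hα] }
  rw [PeriodPair.weierstrassP, PeriodPair.weierstrassP, ← tsum_mul_left, ← e.tsum_eq]
  refine tsum_congr fun l => ?_
  simp only [e, Equiv.coe_fn_mk, ← mul_sub, mul_pow, one_div, mul_inv]

theorem derivWeierstrassP_mul {L L' : PeriodPair} {α : ℂ} (hα : α ≠ 0)
    (h : ∀ z, z ∈ L.lattice ↔ α * z ∈ L'.lattice) (z : ℂ) :
    ℘'[L'] (α * z) = (α ^ 3)⁻¹ * ℘'[L] z := by
  have h1 : (fun z => ℘[L'] (α * z)) = fun z => (α ^ 2)⁻¹ * ℘[L] z :=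
    funext (weierstrassP_mul hα h)
  have h2 := congrFun (congrArg deriv h1) z
  rw [deriv_comp_mul_left, deriv_const_mul_field, L.deriv_weierstrassP, L'.deriv_weierstrassP,
    smul_eq_mul] at h2
  field_simp at h2 ⊢
  linear_combination h2

/-- The value of the Weierstrass function at half of the first period. -/
def halfValue₁ (w : ℂ × ℂ) : ℂ := wpFun (w.1 / 2, w)

/-- The value of the Weierstrass function at half of the second period. -/
def halfValue₂ (w : ℂ × ℂ) : ℂ := wpFun (w.2 / 2, w)

theorem halfValue₁_periods (L : PeriodPair) : halfValue₁ (periods L) = ℘[L] (L.ω₁ / 2) :=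
  wpFun_eq L.ω₁_div_two_notMem_lattice

theorem halfValue₂_periods (L : PeriodPair) : halfValue₂ (periods L) = ℘[L] (L.ω₂ / 2) :=
  wpFun_eq L.ω₂_div_two_notMem_lattice

theorem contDiffAt_halfValue {w : ℂ × ℂ} (hw : latticeDet w ≠ 0) :
    ContDiffAt ℂ ∞ halfValue₁ w ∧ ContDiffAt ℂ ∞ halfValue₂ w := by
  have key : ∀ l : ℂ, l ∉ (pairOf w hw).lattice → ContDiffAt ℂ ∞ wpFun (l, w) := by
    intro l hl
    exact contDiffOn_wpFun.contDiffAt (isOpen_zetaDomain.mem_nhds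
      ((mem_zetaDomain_iff (L := pairOf w hw)).2 hl))
  constructor
  · have h1 : ContDiffAt ℂ ∞ (fun w : ℂ × ℂ => (w.1 / 2, w)) w := by fun_prop
    exact ContDiffAt.comp (g := wpFun) (f := fun w : ℂ × ℂ => (w.1 / 2, w)) w
      (key _ (pairOf w hw).ω₁_div_two_notMem_lattice) h1
  · have h1 : ContDiffAt ℂ ∞ (fun w : ℂ × ℂ => (w.2 / 2, w)) w := by fun_prop
    exact ContDiffAt.comp (g := wpFun) (f := fun w : ℂ × ℂ => (w.2 / 2, w)) w
      (key _ (pairOf w hw).ω₂_div_two_notMem_lattice) h1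

theorem latticeDet_smul_ne_zero {w : ℂ × ℂ} (hw : latticeDet w ≠ 0) {c : ℂ} (hc : c ≠ 0) :
    latticeDet (c • w) ≠ 0 := by
  have h : latticeDet (c • w) = Complex.normSq c * latticeDet w := by
    simp [latticeDet, Complex.normSq_apply]; ring
  rw [h]
  exact mul_ne_zero (by simpa using hc) hw

theorem mem_lattice_smul (L : PeriodPair) {c : ℂ} (hc : c ≠ 0) (z : ℂ) :
    z ∈ L.lattice ↔ c * z ∈ (pairOf (c • periods L)
      (latticeDet_smul_ne_zero (latticeDet_periods_ne_zero L) hc)).lattice := by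
  rw [mem_lattice_iff, mem_lattice_iff]
  simp [latticePt_smul, hc]

theorem halfValue_smul (L : PeriodPair) {c : ℂ} (hc : c ≠ 0) :
    halfValue₁ (c • periods L) = (c ^ 2)⁻¹ * halfValue₁ (periods L) ∧
    halfValue₂ (c • periods L) = (c ^ 2)⁻¹ * halfValue₂ (periods L) := by
  have h := mem_lattice_smul L hc
  have h1 := halfValue₁_periods (pairOf (c • periods L)
      (latticeDet_smul_ne_zero (latticeDet_periods_ne_zero L) hc))
  have h2 := halfValue₂_periods (pairOf (c • periods L)
      (latticeDet_smul_ne_zero (latticeDet_periods_ne_zero L) hc))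
  rw [periods_pairOf] at h1 h2
  rw [h1, h2, halfValue₁_periods, halfValue₂_periods]
  rw [← weierstrassP_mul hc h, ← weierstrassP_mul hc h]
  simp [pairOf, periods, mul_div_assoc]

theorem eta_smul (w : ℂ × ℂ) {c : ℂ} (hc : c ≠ 0) :
    eta₁ (c • w) = c⁻¹ * eta₁ w ∧ eta₂ (c • w) = c⁻¹ * eta₂ w := by
  constructor
  · have := zeta_smul hc (w.1 / 2) w
    simp only [eta₁, Prod.smul_fst, smul_eq_mul, mul_div_assoc, this]
    ring
  · have := zeta_smul hc (w.2 / 2) w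
    simp only [eta₂, Prod.smul_snd, smul_eq_mul, mul_div_assoc, this]
    ring

/-- Euler's identity for a homogeneous function. -/
theorem fderiv_self_of_homogeneous {f : ℂ × ℂ → ℂ} {w : ℂ × ℂ} {k : ℕ}
    (hf : DifferentiableAt ℂ f w) (h : ∀ c : ℂ, c ≠ 0 → f (c • w) = (c ^ k)⁻¹ * f w) :
    fderiv ℂ f w w = -k * f w := by
  have h1 : HasFDerivAt f (fderiv ℂ f w) (w + (0 : ℂ) • w) := by simpa using hf.hasFDerivAt
  have h2 := h1.comp_hasDerivAt (0 : ℂ) (hasDerivAt_line w w)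
  have h3 : (f ∘ fun s : ℂ => w + s • w) =ᶠ[𝓝 0] fun s => ((1 + s) ^ k)⁻¹ * f w := by
    have : ∀ᶠ s in 𝓝 (0 : ℂ), 1 + s ≠ 0 :=
      ContinuousAt.eventually_ne (by fun_prop) (by simp)
    filter_upwards [this] with s hs
    rw [← h _ hs, Function.comp_apply, add_smul, one_smul]
  have h4 : HasDerivAt (fun s : ℂ => ((1 + s) ^ k)⁻¹ * f w) (-k * f w) 0 := by
    have h5 : HasDerivAt (fun s : ℂ => (1 + s) ^ k) (k * (1 + 0) ^ (k - 1) * 1) 0 :=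
      ((hasDerivAt_id (0 : ℂ)).const_add 1).fun_pow k
    have h6 := (h5.fun_inv (by simp)).mul_const (f w)
    simpa using h6
  exact h2.unique (h4.congr_of_eventuallyEq h3)

/-- The derivatives of the quasi-periods and of the half-period values. -/
theorem fderiv_eta_apply (L : PeriodPair) (μ ν : ℂ) :
    fderiv ℂ eta₁ (periods L) (μ • periods L + ν • (eta₁ (periods L), eta₂ (periods L))) =
      -μ * eta₁ (periods L) - ν * (L.g₂ / 12 * L.ω₁) ∧
    fderiv ℂ eta₂ (periods L) (μ • periods L + ν • (eta₁ (periods L), eta₂ (periods L))) =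
      -μ * eta₂ (periods L) - ν * (L.g₂ / 12 * L.ω₂) := by
  have hl := hasDerivAt_line (periods L) (eta₁ (periods L), eta₂ (periods L))
  constructor
  · have h1 := fderiv_self_of_homogeneous (k := 1) (differentiableAt_eta (L := L)).1
      fun c hc => by simpa using (eta_smul (periods L) hc).1
    have h2 : fderiv ℂ eta₁ (periods L) (eta₁ (periods L), eta₂ (periods L)) =
        -(L.g₂ / 12 * L.ω₁) := by
      have hZ : HasDerivAt (fun s : ℂ => (periods L +
          s • (eta₁ (periods L), eta₂ (periods L))).1 / 2) (eta₁ (periods L) / 2) 0 := by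
        have h := (HasFDerivAt.comp_hasDerivAt (0 : ℂ) hasFDerivAt_fst hl).div_const 2
        exact h
      have h3 := (hasDerivAt_zeta_curve L.ω₁_div_two_notMem_lattice hZ hl (by simp [periods])
        (by simp)).const_mul 2
      have h4 : HasFDerivAt eta₁ (fderiv ℂ eta₁ (periods L))
          (periods L + (0 : ℂ) • (eta₁ (periods L), eta₂ (periods L))) := by
        simpa using differentiableAt_eta.1.hasFDerivAt
      have h6 : HasDerivAt (eta₁ ∘ fun s : ℂ => periods L +
        s • (eta₁ (periods L), eta₂ (periods L))) _ 0 := h3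
      -- At ω₁/2 one has ℘' = 0, and the motion of the half period contributes −℘η₁/2, which cancels
      -- ζ℘ because ζ(ω₁/2) = η₁/2. Only the term in g₂ survives.
      rw [(h4.comp_hasDerivAt (0 : ℂ) hl).unique h6, periodDeriv_eta L L.ω₁_div_two_notMem_lattice,
        derivWeierstrassP_half L.ω₁_mem_lattice]
      simp only [eta₁, periods]
      ring
    rw [map_add, map_smul, map_smul, h1, h2]
    simp only [smul_eq_mul]
    push_cast
    ring
  · have h1 := fderiv_self_of_homogeneous (k := 1) (differentiableAt_eta (L := L)).2
      fun c hc => by simpa using (eta_smul (periods L) hc).2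
    have h2 : fderiv ℂ eta₂ (periods L) (eta₁ (periods L), eta₂ (periods L)) =
        -(L.g₂ / 12 * L.ω₂) := by
      have hZ : HasDerivAt (fun s : ℂ => (periods L +
          s • (eta₁ (periods L), eta₂ (periods L))).2 / 2) (eta₂ (periods L) / 2) 0 := by
        have h := (HasFDerivAt.comp_hasDerivAt (0 : ℂ) hasFDerivAt_snd hl).div_const 2
        exact h
      have h3 := (hasDerivAt_zeta_curve L.ω₂_div_two_notMem_lattice hZ hl (by simp [periods])
        (by simp)).const_mul 2
      have h4 : HasFDerivAt eta₂ (fderiv ℂ eta₂ (periods L))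
          (periods L + (0 : ℂ) • (eta₁ (periods L), eta₂ (periods L))) := by
        simpa using differentiableAt_eta.2.hasFDerivAt
      have h6 : HasDerivAt (eta₂ ∘ fun s : ℂ => periods L +
        s • (eta₁ (periods L), eta₂ (periods L))) _ 0 := h3
      rw [(h4.comp_hasDerivAt (0 : ℂ) hl).unique h6, periodDeriv_eta L L.ω₂_div_two_notMem_lattice,
        derivWeierstrassP_half L.ω₂_mem_lattice]
      simp only [eta₂, periods]
      ring
    rw [map_add, map_smul, map_smul, h1, h2]
    simp only [smul_eq_mul]
    push_cast
    ring

/-- The motion of the half period does not count, since ℘' vanishes there. The radial direction is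
Euler's identity in degree −2; the direction (η₁, η₂) is the variation of ℘ at fixed z. -/
theorem fderiv_halfValue_apply (L : PeriodPair) (μ ν : ℂ) :
    fderiv ℂ halfValue₁ (periods L) (μ • periods L + ν • (eta₁ (periods L), eta₂ (periods L))) =
      -2 * μ * halfValue₁ (periods L) + ν * (L.g₂ / 3 - 2 * halfValue₁ (periods L) ^ 2) ∧
    fderiv ℂ halfValue₂ (periods L) (μ • periods L + ν • (eta₁ (periods L), eta₂ (periods L))) =
      -2 * μ * halfValue₂ (periods L) + ν * (L.g₂ / 3 - 2 * halfValue₂ (periods L) ^ 2) := by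
  have hd := contDiffAt_halfValue (latticeDet_periods_ne_zero L)
  have hd1 := hd.1.differentiableAt (by simp)
  have hd2 := hd.2.differentiableAt (by simp)
  have hsplit : ∀ (z a : ℂ) (v : ℂ × ℂ), z ∉ L.lattice → fderiv ℂ wpFun (z, periods L) (a, v) =
      a * ℘'[L] z + fderiv ℂ wpFun (z, periods L) (0, v) := by
    intro z a v hz
    rw [← wpDeriv_eq hz, wpDeriv, ← smul_eq_mul, ← map_smul, ← map_add]
    simp
  constructor
  · have h1 := fderiv_self_of_homogeneous (k := 2) hd1 fun c hc => (halfValue_smul L hc).1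
    have h2 : fderiv ℂ halfValue₁ (periods L) (eta₁ (periods L), eta₂ (periods L)) =
        L.g₂ / 3 - 2 * halfValue₁ (periods L) ^ 2 := by
      have h3 : HasFDerivAt (fun w : ℂ × ℂ => (w.1 / 2, w)) (((2 : ℂ)⁻¹ •
          ContinuousLinearMap.fst ℂ ℂ ℂ).prod (ContinuousLinearMap.id ℂ (ℂ × ℂ))) (periods L) := by
        have := (hasFDerivAt_fst (𝕜 := ℂ) (p := periods L)).const_smul (2 : ℂ)⁻¹
        refine HasFDerivAt.prodMk (this.congr_of_eventuallyEq (Eventually.of_forall fun w => ?_))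
          (hasFDerivAt_id _)
        simp; ring
      have h4 := HasFDerivAt.comp (g := wpFun) (f := fun w : ℂ × ℂ => (w.1 / 2, w)) (periods L)
        (differentiableAt_wpFun L.ω₁_div_two_notMem_lattice).hasFDerivAt h3
      have h5 : HasFDerivAt halfValue₁ _ (periods L) := h4
      rw [h5.fderiv, ContinuousLinearMap.comp_apply]
      change fderiv ℂ wpFun (L.ω₁ / 2, periods L) ((2 : ℂ)⁻¹ * eta₁ (periods L),
        (eta₁ (periods L), eta₂ (periods L))) = _
      rw [hsplit _ _ _ L.ω₁_div_two_notMem_lattice, fderiv_wpFun_eta L.ω₁_div_two_notMem_lattice,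
        derivWeierstrassP_half L.ω₁_mem_lattice, halfValue₁_periods]
      ring
    rw [map_add, map_smul, map_smul, h1, h2]
    simp only [smul_eq_mul]
    push_cast
    ring
  · have h1 := fderiv_self_of_homogeneous (k := 2) hd2 fun c hc => (halfValue_smul L hc).2
    have h2 : fderiv ℂ halfValue₂ (periods L) (eta₁ (periods L), eta₂ (periods L)) =
        L.g₂ / 3 - 2 * halfValue₂ (periods L) ^ 2 := by
      have h3 : HasFDerivAt (fun w : ℂ × ℂ => (w.2 / 2, w)) (((2 : ℂ)⁻¹ •
          ContinuousLinearMap.snd ℂ ℂ ℂ).prod (ContinuousLinearMap.id ℂ (ℂ × ℂ))) (periods L) := by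
        have := (hasFDerivAt_snd (𝕜 := ℂ) (p := periods L)).const_smul (2 : ℂ)⁻¹
        refine HasFDerivAt.prodMk (this.congr_of_eventuallyEq (Eventually.of_forall fun w => ?_))
          (hasFDerivAt_id _)
        simp; ring
      have h4 := HasFDerivAt.comp (g := wpFun) (f := fun w : ℂ × ℂ => (w.2 / 2, w)) (periods L)
        (differentiableAt_wpFun L.ω₂_div_two_notMem_lattice).hasFDerivAt h3
      have h5 : HasFDerivAt halfValue₂ _ (periods L) := h4
      rw [h5.fderiv, ContinuousLinearMap.comp_apply]
      change fderiv ℂ wpFun (L.ω₂ / 2, periods L) ((2 : ℂ)⁻¹ * eta₂ (periods L),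
        (eta₁ (periods L), eta₂ (periods L))) = _
      rw [hsplit _ _ _ L.ω₂_div_two_notMem_lattice, fderiv_wpFun_eta L.ω₂_div_two_notMem_lattice,
        derivWeierstrassP_half L.ω₂_mem_lattice, halfValue₂_periods]
      ring
    rw [map_add, map_smul, map_smul, h1, h2]
    simp only [smul_eq_mul]
    push_cast
    ring

/-! ### The square lattice -/

/-- A solution of a linear second order equation with vanishing initial data vanishes. -/
theorem eventually_eq_zero_of_second_deriv {d q : ℂ → ℂ} (hd : AnalyticAt ℂ d 0)
    (hq : AnalyticAt ℂ q 0) (h0 : d 0 = 0) (h1 : deriv d 0 = 0)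
    (h2 : ∀ᶠ z in 𝓝 0, deriv (deriv d) z = q z * d z) : ∀ᶠ z in 𝓝 0, d z = 0 := by
  have e1 := hd.analyticOrderAt_deriv_add_one
  have e2 := hd.deriv.analyticOrderAt_deriv_add_one
  simp only [h0, h1, sub_zero] at e1 e2
  have e3 : analyticOrderAt (deriv (deriv d)) 0 = analyticOrderAt q 0 + analyticOrderAt d 0 := by
    rw [← analyticOrderAt_mul hq hd]
    exact analyticOrderAt_congr h2
  rw [← analyticOrderAt_eq_top]
  by_contra h
  -- If d ≠ 0, two differentiations lower its order, while the equation makes the order of d'' at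
  -- least that of d.
  have hle : analyticOrderAt d 0 ≤ analyticOrderAt (deriv (deriv d)) 0 := by
    rw [e3]; exact le_add_self
  change analyticOrderAt (deriv d) 0 + 1 = analyticOrderAt d 0 at e1
  change analyticOrderAt (deriv (deriv d)) 0 + 1 = analyticOrderAt (deriv d) 0 at e2
  obtain ⟨n, hn⟩ := ENat.ne_top_iff_exists.1 h
  rw [← hn] at e1 hle
  have h3 : analyticOrderAt (deriv d) 0 ≠ ⊤ := by
    intro h3; rw [h3] at e1; simp at e1
  obtain ⟨m, hm⟩ := ENat.ne_top_iff_exists.1 h3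
  rw [← hm] at e1 e2
  have h4 : analyticOrderAt (deriv (deriv d)) 0 ≠ ⊤ := by
    intro h4; rw [h4] at e2; simp at e2
  obtain ⟨k, hk⟩ := ENat.ne_top_iff_exists.1 h4
  rw [← hk] at e2 hle
  norm_cast at e1 e2 hle
  omega

/-- The derivative of the Weierstrass function vanishes at half periods only. -/
theorem derivWeierstrassP_ne_zero {L : PeriodPair} {p : ℂ} (hp : p ∉ L.lattice)
    (h2p : 2 * p ∉ L.lattice) : ℘'[L] p ≠ 0 := by
  intro h0
  -- Both ℘(p + z) and ℘(p − z) satisfy ℘'' = 6℘² − g₂/2, so their difference d solves a linear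
  -- equation. Its initial data are 0 and 2℘'(p) = 0, so d vanishes identically and ℘(z) = ℘(2p −
  -- z). The left side has a pole at 0; the right side has none, as 2p is not a period.
  set d : ℂ → ℂ := fun z => ℘[L] (p + z) - ℘[L] (p - z) with hd
  have hev : ∀ᶠ z in 𝓝 (0 : ℂ), p + z ∉ L.lattice ∧ p - z ∉ L.lattice := by
    have h1 : ContinuousAt (fun z : ℂ => p + z) 0 := by fun_prop
    have h2 : ContinuousAt (fun z : ℂ => p - z) 0 := by fun_prop
    exact (h1.eventually_mem ((isOpen_compl_lattice L).mem_nhds (by simpa using hp))).and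
      (h2.eventually_mem ((isOpen_compl_lattice L).mem_nhds (by simpa using hp)))
  have hd1 : ∀ z, p + z ∉ L.lattice → p - z ∉ L.lattice →
      HasDerivAt d (℘'[L] (p + z) + ℘'[L] (p - z)) z := by
    intro z h1 h2
    have h3 := (hasDerivAt_weierstrassP L h1).comp_const_add p z
    have h4 := (hasDerivAt_weierstrassP L h2).comp_const_sub p z
    simpa using h3.fun_sub h4
  have hd2 : ∀ z, p + z ∉ L.lattice → p - z ∉ L.lattice →
      HasDerivAt (fun z => ℘'[L] (p + z) + ℘'[L] (p - z))
        (6 * (℘[L] (p + z) + ℘[L] (p - z)) * d z) z := by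
    intro z h1 h2
    have h3 := (hasDerivAt_derivWeierstrassP L h1).comp_const_add p z
    have h4 := (hasDerivAt_derivWeierstrassP L h2).comp_const_sub p z
    refine (h3.fun_add h4).congr_deriv ?_
    simp only [hd]; ring
  have hda : AnalyticAt ℂ d 0 := by
    rw [Complex.analyticAt_iff_eventually_differentiableAt]
    exact hev.mono fun z hz => (hd1 z hz.1 hz.2).differentiableAt
  have hq : AnalyticAt ℂ (fun z => 6 * (℘[L] (p + z) + ℘[L] (p - z))) 0 := by
    rw [Complex.analyticAt_iff_eventually_differentiableAt]
    refine hev.mono fun z hz => ?_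
    have h3 := ((hasDerivAt_weierstrassP L hz.1).comp_const_add p z).differentiableAt
    have h4 := ((hasDerivAt_weierstrassP L hz.2).comp_const_sub p z).differentiableAt
    exact (h3.fun_add h4).const_mul 6
  have hzero : ∀ᶠ z in 𝓝 (0 : ℂ), d z = 0 := by
    refine eventually_eq_zero_of_second_deriv hda hq (by simp [hd]) ?_ ?_
    · rw [(hd1 0 (by simpa using hp) (by simpa using hp)).deriv]
      simp [h0]
    · filter_upwards [hev.eventually_nhds, hev] with z hz hz'
      have : deriv d =ᶠ[𝓝 z] fun z => ℘'[L] (p + z) + ℘'[L] (p - z) :=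
        hz.mono fun y hy => (hd1 y hy.1 hy.2).deriv
      rw [this.deriv_eq, (hd2 z hz'.1 hz'.2).deriv]
  set U : Set ℂ := {z | p + z ∉ L.lattice ∧ p - z ∉ L.lattice} with hU
  have hlc : (L.lattice : Set ℂ).Countable :=
    (Set.countable_range (fun n : ℤ × ℤ => latticePt (periods L) n)).mono
      fun z hz => mem_lattice_iff.1 hz
  have hUc : Uᶜ.Countable := by
    refine ((hlc.image fun l => l - p).union (hlc.image fun l => p - l)).mono fun z hz => ?_
    rw [mem_compl_iff, hU, mem_ofPred_eq, not_and_or, not_not, not_not] at hz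
    rcases hz with h | h
    · exact Or.inl ⟨p + z, h, by ring⟩
    · exact Or.inr ⟨p - z, h, by ring⟩
  have hUconn : IsPreconnected U := by
    have := (hUc.isConnected_compl_of_one_lt_rank (by simp)).isPreconnected
    rwa [compl_compl] at this
  have hUo : IsOpen U :=
    ((isOpen_compl_lattice L).preimage (by fun_prop : Continuous fun z : ℂ => p + z)).inter
      ((isOpen_compl_lattice L).preimage (by fun_prop : Continuous fun z : ℂ => p - z))
  have hdU : AnalyticOnNhd ℂ d U :=
    DifferentiableOn.analyticOnNhd
      (fun z hz => (hd1 z hz.1 hz.2).differentiableAt.differentiableWithinAt) hUo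
  have hall := hdU.eqOn_zero_of_preconnected_of_eventuallyEq_zero hUconn
    (by simpa [hU] using hp) hzero
  have h1 : ∀ᶠ z in 𝓝[≠] (0 : ℂ), ℘[L] z = ℘[L] (2 * p - z) := by
    have hc : ContinuousAt (fun z : ℂ => 2 * p - z) 0 := by fun_prop
    filter_upwards [eventually_notMem_lattice L, mem_nhdsWithin_of_mem_nhds
      (hc.eventually_mem ((isOpen_compl_lattice L).mem_nhds (by simpa using h2p)))] with z hz hz'
    have h2 := hall (x := p - z) ⟨by rwa [show p + (p - z) = 2 * p - z by ring],
      by rwa [sub_sub_cancel]⟩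
    simp only [hd, sub_sub_cancel, Pi.zero_apply] at h2
    rw [show p + (p - z) = 2 * p - z by ring] at h2
    linear_combination -h2
  have h3 := L.order_weierstrassP 0 (zero_mem _)
  rw [meromorphicOrderAt_congr h1] at h3
  have h4 : AnalyticAt ℂ (fun z => ℘[L] (2 * p - z)) 0 := by
    have h5 : AnalyticAt ℂ ℘[L] ((fun z : ℂ => 2 * p - z) 0) :=
      L.analyticOnNhd_weierstrassP _ (by simpa using h2p)
    exact h5.comp (f := fun z : ℂ => 2 * p - z) (by fun_prop)
  have h5 := h4.meromorphicOrderAt_nonneg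
  rw [h3] at h5
  exact absurd h5 (by decide)

/-- The lattice of Gaussian integers. -/
def gaussianPair : PeriodPair := pairOf (1, Complex.I) (by simp [latticeDet])

theorem mem_gaussian_iff {z : ℂ} :
    z ∈ gaussianPair.lattice ↔ ∃ m n : ℤ, (m : ℂ) + n * Complex.I = z := by
  rw [PeriodPair.mem_lattice]
  simp [gaussianPair, pairOf]

theorem gaussian_mul_I (z : ℂ) :
    z ∈ gaussianPair.lattice ↔ Complex.I * z ∈ gaussianPair.lattice := by
  simp only [mem_gaussian_iff]
  constructor
  · rintro ⟨m, n, rfl⟩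
    refine ⟨-n, m, ?_⟩
    push_cast
    linear_combination (-(n : ℂ)) * Complex.I_mul_I
  · rintro ⟨m, n, h⟩
    refine ⟨n, -m, ?_⟩
    push_cast
    linear_combination (-Complex.I) * h + ((n : ℂ) - z) * Complex.I_mul_I

theorem gaussian_conj (z : ℂ) :
    z ∈ gaussianPair.lattice ↔ (starRingEnd ℂ) z ∈ gaussianPair.lattice := by
  have key : ∀ z, z ∈ gaussianPair.lattice → (starRingEnd ℂ) z ∈ gaussianPair.lattice := by
    intro z
    simp only [mem_gaussian_iff]
    rintro ⟨m, n, rfl⟩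
    exact ⟨m, -n, by simp⟩
  exact ⟨key z, fun h => by simpa using key _ h⟩

theorem weierstrassP_conj (z : ℂ) :
    ℘[gaussianPair] ((starRingEnd ℂ) z) = (starRingEnd ℂ) (℘[gaussianPair] z) := by
  let e : gaussianPair.lattice ≃ gaussianPair.lattice :=
    { toFun := fun l => ⟨(starRingEnd ℂ) l, (gaussian_conj l).1 l.2⟩
      invFun := fun l => ⟨(starRingEnd ℂ) l, (gaussian_conj l).1 l.2⟩
      left_inv := fun l => by simp
      right_inv := fun l => by simp }
  rw [PeriodPair.weierstrassP, PeriodPair.weierstrassP, Complex.conj_tsum, ← e.tsum_eq]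
  refine tsum_congr fun l => ?_
  simp [e]

theorem derivWeierstrassP_conj (z : ℂ) :
    ℘'[gaussianPair] ((starRingEnd ℂ) z) = (starRingEnd ℂ) (℘'[gaussianPair] z) := by
  let e : gaussianPair.lattice ≃ gaussianPair.lattice :=
    { toFun := fun l => ⟨(starRingEnd ℂ) l, (gaussian_conj l).1 l.2⟩
      invFun := fun l => ⟨(starRingEnd ℂ) l, (gaussian_conj l).1 l.2⟩
      left_inv := fun l => by simp
      right_inv := fun l => by simp }
  rw [PeriodPair.derivWeierstrassP, PeriodPair.derivWeierstrassP, map_neg, Complex.conj_tsum,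
    ← e.tsum_eq]
  congr 1
  refine tsum_congr fun l => ?_
  simp [e, Complex.conj_ofNat]

theorem weierstrassP_I_mul (z : ℂ) : ℘[gaussianPair] (Complex.I * z) = -℘[gaussianPair] z := by
  rw [weierstrassP_mul Complex.I_ne_zero gaussian_mul_I]; simp

/-- Under z ↦ iz both ℘ and ℘'² change sign. Adding the cubic equations at z and iz leaves −2g₃ = 0.
-/
theorem g₃_gaussianPair : gaussianPair.g₃ = 0 := by
  have h0 := gaussianPair.ω₁_div_two_notMem_lattice
  set z := gaussianPair.ω₁ / 2
  have h1 := gaussianPair.derivWeierstrassP_sq z h0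
  have h2 := gaussianPair.derivWeierstrassP_sq (Complex.I * z) (by rwa [← gaussian_mul_I])
  rw [weierstrassP_I_mul, derivWeierstrassP_mul Complex.I_ne_zero gaussian_mul_I, mul_pow,
    ← inv_pow, ← pow_mul, inv_pow] at h2
  rw [show Complex.I ^ (3 * 2) = -1 by
    rw [show 3 * 2 = 4 + 2 by norm_num, pow_add, Complex.I_pow_four, Complex.I_sq, one_mul]] at h2
  norm_num at h2
  linear_combination (1 / 2 : ℂ) * h1 + (1 / 2 : ℂ) * h2

/-- The Weierstrass function of the Gaussian lattice on the line `Im z = 1 / 2`. -/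
def lineValue (t : ℝ) : ℝ := (℘[gaussianPair] (t + Complex.I / 2)).re

/-- The derivative of `lineValue`. -/
def lineDeriv (t : ℝ) : ℝ := (℘'[gaussianPair] (t + Complex.I / 2)).re

theorem line_notMem (t : ℝ) : (t : ℂ) + Complex.I / 2 ∉ gaussianPair.lattice := by
  rw [mem_gaussian_iff]
  rintro ⟨m, n, h⟩
  have := congrArg Complex.im h
  simp at this
  have h2 : (2 * n : ℝ) = 1 := by linarith
  norm_cast at h2
  omega

/-- The line Im z = 1/2 is mapped by conjugation to its translate by the period −i, so ℘ is real on
it. -/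
theorem coe_lineValue (t : ℝ) : (lineValue t : ℂ) = ℘[gaussianPair] (t + Complex.I / 2) := by
  rw [lineValue, ← Complex.conj_eq_iff_re, ← weierstrassP_conj]
  have h := gaussianPair.weierstrassP_sub_coe (t + Complex.I / 2)
    ⟨Complex.I, mem_gaussian_iff.2 ⟨0, 1, by simp⟩⟩
  rw [← h]
  congr 1
  simp [Complex.conj_ofNat]
  ring

theorem coe_lineDeriv (t : ℝ) : (lineDeriv t : ℂ) = ℘'[gaussianPair] (t + Complex.I / 2) := by
  rw [lineDeriv, ← Complex.conj_eq_iff_re, ← derivWeierstrassP_conj]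
  have h := gaussianPair.derivWeierstrassP_sub_coe (t + Complex.I / 2)
    ⟨Complex.I, mem_gaussian_iff.2 ⟨0, 1, by simp⟩⟩
  rw [← h]
  congr 1
  simp [Complex.conj_ofNat]
  ring

theorem hasDerivAt_lineValue (t : ℝ) : HasDerivAt lineValue (lineDeriv t) t := by
  have h := (hasDerivAt_weierstrassP gaussianPair (line_notMem t)).comp_add_const (t : ℂ)
    (Complex.I / 2)
  exact h.real_of_complex

theorem continuous_lineDeriv : Continuous lineDeriv := by
  refine continuous_iff_continuousAt.2 fun t => ?_
  have h := (hasDerivAt_derivWeierstrassP gaussianPair (line_notMem t)).comp_add_const (t : ℂ)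
    (Complex.I / 2)
  exact h.real_of_complex.continuousAt

theorem continuous_lineValue : Continuous lineValue :=
  continuous_iff_continuousAt.2 fun t => (hasDerivAt_lineValue t).continuousAt

/-- Multiplication by i sends (1 + i)/2 to itself minus the period 1 but changes the sign of ℘. -/
theorem lineValue_half : lineValue (1 / 2) = 0 := by
  have h1 := weierstrassP_I_mul (((1 / 2 : ℝ) : ℂ) + Complex.I / 2)
  have h2 := gaussianPair.weierstrassP_sub_coe (((1 / 2 : ℝ) : ℂ) + Complex.I / 2)
    ⟨1, mem_gaussian_iff.2 ⟨1, 0, by simp⟩⟩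
  have h3 : Complex.I * (((1 / 2 : ℝ) : ℂ) + Complex.I / 2) =
      ((1 / 2 : ℝ) : ℂ) + Complex.I / 2 - 1 := by
    push_cast
    linear_combination (1 / 2 : ℂ) * Complex.I_mul_I
  rw [h3] at h1
  simp only at h2
  rw [h2, ← coe_lineValue] at h1
  have h4 : (lineValue (1 / 2) : ℂ) = 0 := by linear_combination h1 / 2
  exact_mod_cast h4

theorem lineDeriv_ne_zero {t : ℝ} (ht : t ∈ Ioo (0 : ℝ) (1 / 2)) : lineDeriv t ≠ 0 := by
  have h := derivWeierstrassP_ne_zero (line_notMem t) (by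
    rw [mem_gaussian_iff]
    rintro ⟨m, n, h⟩
    have := congrArg Complex.re h
    simp at this
    have h1 : (0 : ℝ) < m := by rw [this]; linarith [ht.1]
    have h2 : (m : ℝ) < 1 := by rw [this]; linarith [ht.2]
    norm_cast at h1 h2
    omega)
  rw [← coe_lineDeriv] at h
  exact_mod_cast h

theorem lineDeriv_zero : lineDeriv 0 = 0 := by
  have h := derivWeierstrassP_half (L := gaussianPair) (l := Complex.I)
    (mem_gaussian_iff.2 ⟨0, 1, by simp⟩)
  have h2 := coe_lineDeriv 0
  rw [Complex.ofReal_zero, zero_add, h] at h2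
  exact_mod_cast h2

/-- The positive number `a` with `℘ (1 / 2) = a = -℘ (i / 2)` on the Gaussian lattice. -/
def gaussianRoot : ℝ := -lineValue 0

/-- On the line ℘' is real and vanishes at i/2, so g₃ = 0 gives g₂ = 4a² with a = −℘(i/2). On (0,
1/2) there is no half period, so ℘' has constant sign; the cubic equation decides which sign, hence
also that of a. -/
theorem lineDeriv_sq (t : ℝ) :
    lineDeriv t ^ 2 = 4 * lineValue t * (lineValue t ^ 2 - gaussianRoot ^ 2) ∧
      0 < gaussianRoot ∧ (t ∈ Ioo (0 : ℝ) (1 / 2) → 0 < lineDeriv t) := by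
  have hode : ∀ t, (lineDeriv t : ℂ) ^ 2 = 4 * lineValue t ^ 3 - gaussianPair.g₂ * lineValue t := by
    intro t
    have := gaussianPair.derivWeierstrassP_sq _ (line_notMem t)
    rw [g₃_gaussianPair, ← coe_lineDeriv, ← coe_lineValue] at this
    simpa using this
  -- Otherwise Rolle's theorem would give a zero of ℘' strictly between i/2 and (1 + i)/2.
  have hinj : lineValue 0 ≠ 0 := by
    intro h0
    obtain ⟨c, hc, hc'⟩ := exists_hasDerivAt_eq_zero (a := 0) (b := 1 / 2) (f := lineValue)
      (f' := lineDeriv) (by norm_num) continuous_lineValue.continuousOn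
      (by rw [h0, lineValue_half]) fun t _ => hasDerivAt_lineValue t
    exact lineDeriv_ne_zero hc hc'
  have hg : gaussianPair.g₂ = ((4 * gaussianRoot ^ 2 : ℝ) : ℂ) := by
    have h := hode 0
    rw [lineDeriv_zero] at h
    have h1 : (lineValue 0 : ℂ) ≠ 0 := by exact_mod_cast hinj
    have h2 : (lineValue 0 : ℂ) * (4 * (lineValue 0 : ℂ) ^ 2 - gaussianPair.g₂) = 0 := by
      rw [Complex.ofReal_zero] at h
      linear_combination -h
    have h3 := (mul_eq_zero.1 h2).resolve_left h1
    rw [gaussianRoot]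
    push_cast
    linear_combination -h3
  have hsq : ∀ t, lineDeriv t ^ 2 = 4 * lineValue t * (lineValue t ^ 2 - gaussianRoot ^ 2) := by
    intro t
    have h := hode t
    rw [hg] at h
    have h2 : ((lineDeriv t ^ 2 : ℝ) : ℂ) =
        ((4 * lineValue t * (lineValue t ^ 2 - gaussianRoot ^ 2) : ℝ) : ℂ) := by
      push_cast
      push_cast at h
      linear_combination h
    exact_mod_cast h2
  have hconv : Convex ℝ (Icc (0 : ℝ) (1 / 2)) := convex_Icc _ _
  have hint : interior (Icc (0 : ℝ) (1 / 2)) = Ioo 0 (1 / 2) := interior_Icc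
  have hsign : (∀ t ∈ Ioo (0 : ℝ) (1 / 2), 0 < lineDeriv t) ∨
      ∀ t ∈ Ioo (0 : ℝ) (1 / 2), lineDeriv t < 0 := by
    by_contra! h
    obtain ⟨⟨s, hs, hs'⟩, t, ht, ht'⟩ := h
    obtain ⟨x, hx, hx'⟩ := (isPreconnected_Ioo (a := (0 : ℝ)) (b := 1 / 2)).intermediate_value hs ht
      continuous_lineDeriv.continuousOn ⟨hs', ht'⟩
    exact lineDeriv_ne_zero hx hx'
  have hmem : (1 / 4 : ℝ) ∈ Ioo (0 : ℝ) (1 / 2) := by norm_num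
  rcases hsign with hpos | hneg
  · have hmono : StrictMonoOn lineValue (Icc 0 (1 / 2)) :=
      strictMonoOn_of_deriv_pos hconv continuous_lineValue.continuousOn fun t ht => by
        rw [hint] at ht
        rw [(hasDerivAt_lineValue t).deriv]
        exact hpos t ht
    have h1 := hmono (left_mem_Icc.2 (by norm_num)) (right_mem_Icc.2 (by norm_num)) (by norm_num)
    rw [lineValue_half] at h1
    exact ⟨hsq t, by rw [gaussianRoot]; linarith, hpos t⟩
  -- If ℘ decreased to 0, then 0 < ℘ < |a| at an interior point, and 4℘(℘² − a²) would be negative,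
  -- although it is a square.
  · exfalso
    have hanti : StrictAntiOn lineValue (Icc 0 (1 / 2)) :=
      strictAntiOn_of_deriv_neg hconv continuous_lineValue.continuousOn fun t ht => by
        rw [hint] at ht
        rw [(hasDerivAt_lineValue t).deriv]
        exact hneg t ht
    have h1 := hanti (left_mem_Icc.2 (by norm_num)) ⟨hmem.1.le, hmem.2.le⟩ hmem.1
    have h2 := hanti ⟨hmem.1.le, hmem.2.le⟩ (right_mem_Icc.2 (by norm_num)) hmem.2
    rw [lineValue_half] at h2
    have h3 := hsq (1 / 4)
    have h4 := hneg _ hmem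
    have h5 : lineValue (1 / 4) ^ 2 < gaussianRoot ^ 2 := by
      rw [gaussianRoot, neg_sq]
      exact pow_lt_pow_left₀ h1 h2.le two_ne_zero
    have h6 : 0 < lineDeriv (1 / 4) ^ 2 := by nlinarith
    rw [h3] at h6
    have h7 : 4 * lineValue (1 / 4) * (lineValue (1 / 4) ^ 2 - gaussianRoot ^ 2) < 0 :=
      mul_neg_of_pos_of_neg (by linarith) (by linarith)
    linarith

theorem gaussianRoot_pos : 0 < gaussianRoot := (lineDeriv_sq 0).2.1

theorem strictMonoOn_lineValue : StrictMonoOn lineValue (Icc 0 (1 / 2)) :=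
  strictMonoOn_of_deriv_pos (convex_Icc _ _) continuous_lineValue.continuousOn fun t ht => by
    rw [interior_Icc] at ht
    rw [(hasDerivAt_lineValue t).deriv]
    exact (lineDeriv_sq t).2.2 ht

theorem lineValue_mem {t : ℝ} (ht : t ∈ Ioo (0 : ℝ) (1 / 2)) :
    -gaussianRoot < lineValue t ∧ lineValue t < 0 := by
  have hm : t ∈ Icc (0 : ℝ) (1 / 2) := ⟨ht.1.le, ht.2.le⟩
  have h1 := strictMonoOn_lineValue (left_mem_Icc.2 (by norm_num)) hm ht.1
  have h2 := strictMonoOn_lineValue hm (right_mem_Icc.2 (by norm_num)) ht.2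
  rw [lineValue_half] at h2
  exact ⟨by rwa [gaussianRoot, neg_neg], h2⟩

/-- The normalized square of `lineValue`. -/
def lineSq (t : ℝ) : ℝ := (lineValue t / gaussianRoot) ^ 2

theorem lineSq_image : lineSq '' Ioo 0 (1 / 2) = Ioo 0 1 := by
  have ha := gaussianRoot_pos
  ext w
  constructor
  · rintro ⟨t, ht, rfl⟩
    obtain ⟨h1, h2⟩ := lineValue_mem ht
    have h3 : lineValue t / gaussianRoot < 0 := div_neg_of_neg_of_pos h2 ha
    have h4 : -1 < lineValue t / gaussianRoot := by rw [lt_div_iff₀ ha]; linarith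
    exact ⟨by rw [lineSq]; nlinarith, by rw [lineSq]; nlinarith⟩
  · rintro ⟨h0, h1⟩
    have hs0 : 0 < √w := Real.sqrt_pos.2 h0
    have hs1 : √w < 1 := by rw [Real.sqrt_lt' one_pos]; simpa using h1
    have hv : -gaussianRoot * √w ∈ Ioo (lineValue 0) (lineValue (1 / 2)) := by
      rw [lineValue_half, show lineValue 0 = -gaussianRoot by rw [gaussianRoot, neg_neg]]
      constructor <;> nlinarith
    obtain ⟨t, ht, ht'⟩ := intermediate_value_Ioo (by norm_num : (0 : ℝ) ≤ 1 / 2)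
      continuous_lineValue.continuousOn hv
    refine ⟨t, ht, ?_⟩
    rw [lineSq, ht', neg_mul, neg_div, neg_sq, mul_div_cancel_left₀ _ ha.ne', Real.sq_sqrt h0.le]

theorem lineSq_injOn : InjOn lineSq (Ioo 0 (1 / 2)) := by
  intro s hs t ht h
  have ha := gaussianRoot_pos
  have h1 := (lineValue_mem hs).2
  have h2 := (lineValue_mem ht).2
  refine strictMonoOn_lineValue.injOn ⟨hs.1.le, hs.2.le⟩ ⟨ht.1.le, ht.2.le⟩ ?_
  simp only [lineSq, div_pow] at h
  rw [div_left_inj' (by positivity)] at h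
  nlinarith [sq_nonneg (lineValue s - lineValue t)]

theorem hasDerivAt_lineSq (t : ℝ) :
    HasDerivAt lineSq (2 * lineValue t * lineDeriv t / gaussianRoot ^ 2) t := by
  have := ((hasDerivAt_lineValue t).div_const gaussianRoot).fun_pow 2
  refine this.congr_deriv ?_
  have := gaussianRoot_pos.ne'
  norm_num
  field_simp

/-- With r = −℘/a the cubic equation reads ℘'² = 4a³ r(1 − r²). In the variable s = r² this makes
ds/dt the reciprocal of a Beta integrand, up to a constant. -/
theorem abs_deriv_lineSq {t : ℝ} (ht : t ∈ Ioo (0 : ℝ) (1 / 2)) :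
    |2 * lineValue t * lineDeriv t / gaussianRoot ^ 2| =
      4 * √gaussianRoot * lineSq t ^ (3 / 4 : ℝ) * (1 - lineSq t) ^ (1 / 2 : ℝ) := by
  have ha := gaussianRoot_pos
  obtain ⟨h1, h2⟩ := lineValue_mem ht
  obtain ⟨h3, -, h4⟩ := lineDeriv_sq t
  have h5 := h4 ht
  set r := -lineValue t / gaussianRoot with hr
  have hr0 : 0 < r := div_pos (by linarith) ha
  have hr1 : r < 1 := by rw [hr, div_lt_one ha]; linarith
  have hu : lineValue t = -(gaussianRoot * r) := by rw [hr]; field_simp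
  have hw : lineSq t = r ^ 2 := by rw [lineSq, hu]; field_simp
  have hpow : (r ^ 2) ^ (3 / 4 : ℝ) = r * √r := by
    rw [← Real.rpow_natCast r 2, ← Real.rpow_mul hr0.le, Real.sqrt_eq_rpow]
    nth_rewrite 2 [← Real.rpow_one r]
    rw [← Real.rpow_add hr0]
    norm_num
  have hd : lineDeriv t = 2 * gaussianRoot * √gaussianRoot * √r * √(1 - r ^ 2) := by
    have h1r : 0 ≤ 1 - r ^ 2 := by nlinarith
    refine (pow_left_inj₀ h5.le (by positivity) two_ne_zero).1 ?_
    rw [h3, hu]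
    simp only [mul_pow, Real.sq_sqrt ha.le, Real.sq_sqrt hr0.le, Real.sq_sqrt h1r]
    ring
  rw [hw, hpow, ← Real.sqrt_eq_rpow, hd, hu, abs_div, abs_mul, abs_mul, abs_neg, abs_of_pos
    (show 0 < gaussianRoot * r by positivity), abs_of_nonneg (by positivity : 0 ≤ 2 * gaussianRoot *
    √gaussianRoot * √r * √(1 - r ^ 2)), abs_of_pos (by positivity : 0 < gaussianRoot ^ 2)]
  field_simp
  norm_num
  ring

/-! ### Beta integrals and the quasi-periods of the square lattice -/

theorem beta_eq_integral {α β : ℝ} (hα : 0 < α) (hβ : 0 < β) :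
    ProbabilityTheory.beta α β = ∫ w in Ioo (0 : ℝ) 1, w ^ (α - 1) * (1 - w) ^ (β - 1) := by
  rw [ProbabilityTheory.beta_eq_betaIntegralReal α β hα hβ, Complex.betaIntegral,
    intervalIntegral.integral_of_le zero_le_one, integral_Ioc_eq_integral_Ioo]
  have : ∫ (x : ℝ) in Ioo 0 1, (x : ℂ) ^ ((α : ℂ) - 1) * (1 - (x : ℂ)) ^ ((β : ℂ) - 1) =
      ∫ (x : ℝ) in Ioo 0 1, ((x ^ (α - 1) * (1 - x) ^ (β - 1) : ℝ) : ℂ) := by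
    refine setIntegral_congr_fun measurableSet_Ioo fun x hx => ?_
    rw [Complex.ofReal_mul, Complex.ofReal_cpow hx.1.le, Complex.ofReal_cpow (by linarith [hx.2])]
    push_cast
    rfl
  rw [this, integral_complex_ofReal, Complex.ofReal_re]

/-- After substituting s = (℘/a)² the integrand is the constant 4√a on an interval of length 1/2. -/
theorem beta_quarter : ProbabilityTheory.beta (1 / 4) (1 / 2) = 2 * √gaussianRoot := by
  rw [beta_eq_integral (by norm_num) (by norm_num), ← lineSq_image,
    integral_image_eq_integral_abs_deriv_smul measurableSet_Ioo
      (fun t _ => (hasDerivAt_lineSq t).hasDerivWithinAt) lineSq_injOn]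
  have : ∫ x in Ioo (0 : ℝ) (1 / 2), |2 * lineValue x * lineDeriv x / gaussianRoot ^ 2| •
      (lineSq x ^ (1 / 4 - 1 : ℝ) * (1 - lineSq x) ^ (1 / 2 - 1 : ℝ)) =
      ∫ x in Ioo (0 : ℝ) (1 / 2), 4 * √gaussianRoot := by
    refine setIntegral_congr_fun measurableSet_Ioo fun t ht => ?_
    have hm : lineSq t ∈ Ioo (0 : ℝ) 1 := lineSq_image ▸ mem_image_of_mem _ ht
    have h1 : 0 < 1 - lineSq t := by linarith [hm.2]
    simp only [smul_eq_mul]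
    rw [abs_deriv_lineSq ht]
    calc _ = 4 * √gaussianRoot * (lineSq t ^ (3 / 4 : ℝ) * lineSq t ^ (1 / 4 - 1 : ℝ)) *
          ((1 - lineSq t) ^ (1 / 2 : ℝ) * (1 - lineSq t) ^ (1 / 2 - 1 : ℝ)) := by ring
      _ = _ := by
        rw [← Real.rpow_add hm.1, ← Real.rpow_add h1]
        norm_num
  rw [this]
  simp
  ring

/-- The same substitution; the additional factor s^(1/2) = −℘/a turns the constant integrand into a
multiple of ℘. -/
theorem beta_three_quarters : ProbabilityTheory.beta (3 / 4) (1 / 2) =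
    -(4 / √gaussianRoot) * ∫ t in (0 : ℝ)..(1 / 2), lineValue t := by
  have ha := gaussianRoot_pos
  rw [beta_eq_integral (by norm_num) (by norm_num), ← lineSq_image,
    integral_image_eq_integral_abs_deriv_smul measurableSet_Ioo
      (fun t _ => (hasDerivAt_lineSq t).hasDerivWithinAt) lineSq_injOn,
    intervalIntegral.integral_of_le (by norm_num), integral_Ioc_eq_integral_Ioo,
    ← integral_const_mul]
  refine setIntegral_congr_fun measurableSet_Ioo fun t ht => ?_
  have hm : lineSq t ∈ Ioo (0 : ℝ) 1 := lineSq_image ▸ mem_image_of_mem _ ht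
  have h1 : 0 < 1 - lineSq t := by linarith [hm.2]
  have h2 := (lineValue_mem ht).2
  simp only [smul_eq_mul]
  rw [abs_deriv_lineSq ht]
  have h3 : lineSq t ^ (1 / 2 : ℝ) = -lineValue t / gaussianRoot := by
    rw [← Real.sqrt_eq_rpow, lineSq, Real.sqrt_sq_eq_abs,
      abs_of_neg (div_neg_of_neg_of_pos h2 ha), neg_div]
  calc _ = 4 * √gaussianRoot * (lineSq t ^ (3 / 4 : ℝ) * lineSq t ^ (3 / 4 - 1 : ℝ)) *
        ((1 - lineSq t) ^ (1 / 2 : ℝ) * (1 - lineSq t) ^ (1 / 2 - 1 : ℝ)) := by ring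
    _ = 4 * √gaussianRoot * lineSq t ^ (1 / 2 : ℝ) := by
      rw [← Real.rpow_add hm.1, ← Real.rpow_add h1]
      norm_num
    _ = _ := by
      rw [h3]
      field_simp
      rw [Real.sq_sqrt ha.le]
      ring

/-- This is where ρ enters: the quotient of Gamma values simplifies by Γ(5/4) = Γ(1/4)/4. -/
theorem beta_ratio : ProbabilityTheory.beta (3 / 4) (1 / 2) =
    2 * rho ^ 2 / 3 * ProbabilityTheory.beta (1 / 4) (1 / 2) := by
  have h1 := Real.Gamma_pos_of_pos (show (0 : ℝ) < 1 / 4 by norm_num)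
  have h2 := Real.Gamma_pos_of_pos (show (0 : ℝ) < 3 / 4 by norm_num)
  have h3 : Real.Gamma (5 / 4) = 1 / 4 * Real.Gamma (1 / 4) := by
    rw [← Real.Gamma_add_one (by norm_num)]; norm_num
  rw [rho, ProbabilityTheory.beta, ProbabilityTheory.beta,
    show (3 / 4 + 1 / 2 : ℝ) = 5 / 4 by norm_num, show (1 / 4 + 1 / 2 : ℝ) = 3 / 4 by norm_num, h3,
    div_pow, mul_pow, Real.sq_sqrt (by norm_num)]
  field_simp
  norm_num

theorem integral_lineValue :
    ∫ t in (0 : ℝ)..(1 / 2), lineValue t = -gaussianRoot * rho ^ 2 / 3 := by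
  have ha := gaussianRoot_pos
  have h1 := beta_ratio
  rw [beta_three_quarters, beta_quarter] at h1
  have hs : 0 < √gaussianRoot := Real.sqrt_pos.2 ha
  field_simp at h1
  rw [Real.sq_sqrt ha.le] at h1
  linear_combination -h1 / 12

theorem eta₁_gaussian_I : eta₁ (Complex.I, -1) = 2 * zeta (Complex.I / 2, (1, Complex.I)) := by
  have h : zetaReg (Complex.I / 2, (Complex.I, -1)) = zetaReg (Complex.I / 2, (1, Complex.I)) := by
    let e : ℤ × ℤ ≃ ℤ × ℤ :=
      { toFun := fun n => (-n.2, n.1)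
        invFun := fun n => (n.2, -n.1)
        left_inv := fun n => by simp
        right_inv := fun n => by simp }
    rw [zetaReg, zetaReg, ← e.tsum_eq fun n => zetaTerm n (Complex.I / 2, (1, Complex.I))]
    refine tsum_congr fun n => ?_
    have : latticePt (Complex.I, -1) n = latticePt (1, Complex.I) (e n) := by
      simp [latticePt, e]; ring
    simp only [zetaTerm, this]
  simp only [eta₁, zeta, h]

/-- The pairs (1, i) and i·(1, i) = (i, −1) generate the same lattice, and quasi-periods are
homogeneous of degree −1. -/
theorem eta₂_gaussian : eta₂ (1, Complex.I) = -Complex.I * eta₁ (1, Complex.I) := by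
  have h := (eta_smul (1, Complex.I) Complex.I_ne_zero).1
  have h2 : Complex.I • ((1 : ℂ), Complex.I) = (Complex.I, -1) := by simp
  rw [h2, eta₁_gaussian_I] at h
  rw [eta₂, h, Complex.inv_I]

/-- Oddness and quasi-periodicity give ζ((1 + i)/2) = ζ(1/2) + ζ(i/2). So integrating −℘ from i/2 to
(1 + i)/2 yields ζ(1/2) = η₁/2. -/
theorem eta₁_gaussian : eta₁ (1, Complex.I) = ((2 * gaussianRoot * rho ^ 2 / 3 : ℝ) : ℂ) := by
  have hd : ∀ t ∈ uIcc (0 : ℝ) (1 / 2), HasDerivAt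
      (fun t : ℝ => zeta ((t : ℂ) + Complex.I / 2, periods gaussianPair)) (-(lineValue t : ℂ)) t := by
    intro t _
    rw [coe_lineValue]
    exact ((hasDerivAt_zeta gaussianPair (line_notMem t)).comp_add_const (t : ℂ)
      (Complex.I / 2)).comp_ofReal
  have h1 := intervalIntegral.integral_eq_sub_of_hasDerivAt hd
    ((Complex.continuous_ofReal.comp continuous_lineValue).neg.intervalIntegrable _ _)
  rw [intervalIntegral.integral_neg, intervalIntegral.integral_ofReal, integral_lineValue] at h1
  have hadd := zeta_add_of_half (L := gaussianPair) (l := 1) (mem_gaussian_iff.2 ⟨1, 0, by simp⟩)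
    gaussianPair.ω₁_div_two_notMem_lattice
    (z := Complex.I / 2 - 1 / 2) (by
      rw [mem_gaussian_iff]
      rintro ⟨m, n, h⟩
      have := congrArg Complex.im h
      simp at this
      have h2 : (2 * n : ℝ) = 1 := by linarith
      norm_cast at h2
      omega)
  have hadd2 := zeta_add_of_half (L := gaussianPair) (l := Complex.I)
    (mem_gaussian_iff.2 ⟨0, 1, by simp⟩)
    gaussianPair.ω₂_div_two_notMem_lattice
    (z := -(Complex.I / 2 + 1 / 2)) (by
      rw [neg_mem_iff, mem_gaussian_iff]
      rintro ⟨m, n, h⟩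
      have := congrArg Complex.im h
      simp at this
      have h2 : (2 * n : ℝ) = 1 := by linarith
      norm_cast at h2
      omega)
  have hp : periods gaussianPair = (1, Complex.I) := rfl
  rw [hp] at hadd hadd2 h1
  rw [show Complex.I / 2 - 1 / 2 + 1 = Complex.I / 2 + 1 / 2 by ring] at hadd
  rw [show -(Complex.I / 2 + 1 / 2) + Complex.I = Complex.I / 2 - 1 / 2 by ring, zeta_neg] at hadd2
  rw [show ((1 / 2 : ℝ) : ℂ) + Complex.I / 2 = Complex.I / 2 + 1 / 2 by push_cast; ring,
    Complex.ofReal_zero, zero_add] at h1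
  rw [eta₁]
  simp only
  push_cast at h1 ⊢
  linear_combination -2 * h1 - hadd - hadd2

theorem halfValue_gaussian : halfValue₁ (1, Complex.I) = gaussianRoot ∧
    halfValue₂ (1, Complex.I) = -gaussianRoot := by
  have h2 : ℘[gaussianPair] (Complex.I / 2) = -gaussianRoot := by
    have := coe_lineValue 0
    rw [Complex.ofReal_zero, zero_add] at this
    rw [← this, gaussianRoot]
    push_cast
    ring
  have h1 : ℘[gaussianPair] (1 / 2) = gaussianRoot := by
    have := weierstrassP_I_mul (1 / 2)
    rw [show Complex.I * (1 / 2) = Complex.I / 2 by ring, h2] at this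
    linear_combination this
  have h3 := halfValue₁_periods gaussianPair
  have h4 := halfValue₂_periods gaussianPair
  exact ⟨h3.trans h1, h4.trans h2⟩

/-- The side of the square period lattice of `y² = x (x - 1) (x + 1)`. -/
def side : ℝ := 2 * √gaussianRoot

theorem side_pos : 0 < side := mul_pos two_pos (Real.sqrt_pos.2 gaussianRoot_pos)

theorem side_sq : side ^ 2 = 4 * gaussianRoot := by
  rw [side, mul_pow, Real.sq_sqrt gaussianRoot_pos.le]; norm_num

/-- The period lattice of `y² = x (x - 1) (x + 1)`. -/
def squarePair : PeriodPair :=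
  pairOf ((side : ℂ) • periods gaussianPair) (latticeDet_smul_ne_zero
    (latticeDet_periods_ne_zero gaussianPair) (Complex.ofReal_ne_zero.2 side_pos.ne'))

theorem periods_squarePair : periods squarePair = ((side : ℂ), side * Complex.I) := by
  rw [squarePair, periods_pairOf]
  simp [gaussianPair]

/-- Scaling by `side` divides ℘ by side² = 4a, so the half-period values ±a become ±1/4; thus x = 4℘
takes the values 1 and −1, as required for λ = −1. -/
theorem halfValue_squarePair : halfValue₁ (periods squarePair) = 1 / 4 ∧
    halfValue₂ (periods squarePair) = -1 / 4 := by
  have hs : (side : ℂ) ≠ 0 := Complex.ofReal_ne_zero.2 side_pos.ne'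
  obtain ⟨h1, h2⟩ := halfValue_smul gaussianPair hs
  have hp : periods gaussianPair = (1, Complex.I) := rfl
  have h3 : (side : ℂ) ^ 2 = 4 * gaussianRoot := by exact_mod_cast side_sq
  have ha : (gaussianRoot : ℂ) ≠ 0 := Complex.ofReal_ne_zero.2 gaussianRoot_pos.ne'
  rw [squarePair, periods_pairOf, h1, h2, hp, halfValue_gaussian.1, halfValue_gaussian.2, h3]
  constructor <;> field_simp

theorem halfValue_cubic (L : PeriodPair) :
    4 * halfValue₁ (periods L) ^ 3 - L.g₂ * halfValue₁ (periods L) - L.g₃ = 0 ∧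
    4 * halfValue₂ (periods L) ^ 3 - L.g₂ * halfValue₂ (periods L) - L.g₃ = 0 := by
  rw [halfValue₁_periods, halfValue₂_periods,
    ← L.derivWeierstrassP_sq _ L.ω₁_div_two_notMem_lattice,
    ← L.derivWeierstrassP_sq _ L.ω₂_div_two_notMem_lattice,
    derivWeierstrassP_half L.ω₁_mem_lattice, derivWeierstrassP_half L.ω₂_mem_lattice]
  simp

theorem g₂_squarePair : squarePair.g₂ = 1 / 4 := by
  obtain ⟨h1, h2⟩ := halfValue_cubic squarePair
  rw [halfValue_squarePair.1] at h1
  rw [halfValue_squarePair.2] at h2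
  linear_combination -2 * h1 + 2 * h2

theorem eta_squarePair : eta₁ (periods squarePair) = rho ^ 2 / 6 * side ∧
    eta₂ (periods squarePair) = -Complex.I * (rho ^ 2 / 6 * side) := by
  have hs : (side : ℂ) ≠ 0 := Complex.ofReal_ne_zero.2 side_pos.ne'
  obtain ⟨h1, h2⟩ := eta_smul (periods gaussianPair) hs
  have hp : periods gaussianPair = (1, Complex.I) := rfl
  have h3 : (side : ℂ) ^ 2 = 4 * gaussianRoot := by exact_mod_cast side_sq
  rw [squarePair, periods_pairOf, h1, h2, hp, eta₂_gaussian, eta₁_gaussian]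
  have : (gaussianRoot : ℂ) = side ^ 2 / 4 := by rw [h3]; ring
  push_cast
  rw [this]
  constructor <;> field_simp <;> ring

/-! ### Bounds for ρ -/

theorem rho_pos : 0 < rho :=
  div_pos (mul_pos (Real.sqrt_pos.2 (by norm_num)) (Real.Gamma_pos_of_pos (by norm_num)))
    (Real.Gamma_pos_of_pos (by norm_num))

/-- The reflection formula Γ(1/4)Γ(3/4) = √2 π gives ρ² = 3Γ(3/4)⁴/π². Log-convexity of Γ at 7/4,
the midpoint of 3/2 and 2, gives (3Γ(3/4)/4)⁴ ≤ Γ(3/2)² = π/4. Together ρ² ≤ 64·3/(81π), and π > 3.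
-/
theorem rho_sq_le : rho ^ 2 ≤ 64 / 81 := by
  have hG := Real.Gamma_pos_of_pos (show (0 : ℝ) < 1 / 4 by norm_num)
  have hg := Real.Gamma_pos_of_pos (show (0 : ℝ) < 3 / 4 by norm_num)
  have h1 := Real.Gamma_mul_Gamma_one_sub (1 / 4)
  rw [show (1 - 1 / 4 : ℝ) = 3 / 4 by norm_num, show Real.pi * (1 / 4) = Real.pi / 4 by ring,
    Real.sin_pi_div_four] at h1
  have h2 := Real.Gamma_mul_add_mul_le_rpow_Gamma_mul_rpow_Gamma (s := 3 / 2) (t := 2) (a := 1 / 2)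
    (b := 1 / 2) (by norm_num) (by norm_num) (by norm_num) (by norm_num) (by norm_num)
  have e1 : Real.Gamma (7 / 4) = 3 / 4 * Real.Gamma (3 / 4) := by
    rw [← Real.Gamma_add_one (by norm_num)]; norm_num
  have e2 : Real.Gamma (3 / 2) = 1 / 2 * √Real.pi := by
    rw [← Real.Gamma_one_half_eq, ← Real.Gamma_add_one (by norm_num)]; norm_num
  rw [show (1 / 2 * (3 / 2) + 1 / 2 * 2 : ℝ) = 7 / 4 by norm_num, e1, e2, Real.Gamma_two,
    Real.one_rpow, mul_one, ← Real.sqrt_eq_rpow] at h2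
  have h3 := pow_le_pow_left₀ (by positivity) h2 4
  have h4 : √(1 / 2 * √Real.pi) ^ 4 = Real.pi / 4 := by
    rw [show (4 : ℕ) = 2 * 2 by norm_num, pow_mul, Real.sq_sqrt (by positivity), mul_pow,
      Real.sq_sqrt Real.pi_pos.le]
    ring
  rw [h4] at h3
  have h5 : Real.Gamma (1 / 4) ^ 2 * Real.Gamma (3 / 4) ^ 2 = 2 * Real.pi ^ 2 := by
    rw [← mul_pow, h1, div_pow, div_pow, Real.sq_sqrt (by norm_num)]
    ring
  rw [rho, div_pow, mul_pow, Real.sq_sqrt (by norm_num), div_le_iff₀ (by positivity)]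
  have hpi := Real.pi_gt_three
  have hg2 : 0 < Real.Gamma (3 / 4) ^ 2 := by positivity
  refine le_of_mul_le_mul_right ?_ hg2
  nlinarith [Real.pi_pos]

theorem rho_lt_one : rho < 1 := by
  nlinarith [rho_sq_le, rho_pos]

/-! ### The period problem and the inverse function theorem -/

/-- The inverse function theorem for a smooth map of a finite-dimensional space. -/
theorem exists_smooth_localInverse {E : Type*} [NormedAddCommGroup E] [NormedSpace ℝ E]
    [FiniteDimensional ℝ E] {f : E → E} {s : Set E} (hs : IsOpen s) {a : E} (ha : a ∈ s)
    (hf : ContDiffOn ℝ ∞ f s) (hinj : ∀ v, fderiv ℝ f a v = 0 → v = 0) {N : Set E}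
    (hN : N ∈ 𝓝 a) :
    ∃ V ∈ 𝓝 (f a), ∃ g : E → E, g (f a) = a ∧ ContDiffOn ℝ ∞ g V ∧
      ∀ y ∈ V, f (g y) = y ∧ g y ∈ N := by
  have : CompleteSpace E := FiniteDimensional.complete ℝ E
  have hfa : ContDiffAt ℝ ∞ f a := hf.contDiffAt (hs.mem_nhds ha)
  let e' : E ≃ₗ[ℝ] E := LinearEquiv.ofInjectiveEndo (fderiv ℝ f a : E →ₗ[ℝ] E)
    ((injective_iff_map_eq_zero _).2 hinj)
  let f' : E ≃L[ℝ] E := e'.toContinuousLinearEquiv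
  have hf'coe : (f' : E →L[ℝ] E) = fderiv ℝ f a := by ext v; rfl
  have hf' : HasFDerivAt f (f' : E →L[ℝ] E) a := by
    rw [hf'coe]
    exact (hfa.differentiableAt (by simp)).hasFDerivAt
  let e := hfa.toOpenPartialHomeomorph f hf' (by simp)
  have he : (e : E → E) = f := hfa.toOpenPartialHomeomorph_coe hf' (by simp)
  have hsrc : a ∈ e.source := hfa.mem_toOpenPartialHomeomorph_source hf' (by simp)
  have htgt : f a ∈ e.target := by rw [← he]; exact e.map_source hsrc
  have hsymm : e.symm (f a) = a := by rw [← he]; exact e.left_inv hsrc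
  -- Invertibility of the derivative persists near a, which makes the inverse smooth on a whole
  -- neighbourhood and not only at the image of a.
  have hinv : ∀ᶠ x in 𝓝 a, fderiv ℝ f x ∈ range ((↑) : (E ≃L[ℝ] E) → E →L[ℝ] E) := by
    refine (hfa.continuousAt_fderiv (by simp)).eventually_mem ?_
    rw [← hf'coe]
    exact f'.nhds
  have hS : ∀ᶠ x in 𝓝 a, x ∈ s ∧ x ∈ N ∧ fderiv ℝ f x ∈ range ((↑) : (E ≃L[ℝ] E) → E →L[ℝ] E) :=
    Filter.Eventually.and (hs.mem_nhds ha) (Filter.Eventually.and hN hinv)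
  have hcont : ContinuousAt e.symm (f a) := e.continuousAt_symm htgt
  have hV : ∀ᶠ y in 𝓝 (f a), y ∈ e.target ∧ e.symm y ∈ s ∧ e.symm y ∈ N ∧
      fderiv ℝ f (e.symm y) ∈ range ((↑) : (E ≃L[ℝ] E) → E →L[ℝ] E) := by
    refine Filter.Eventually.and (e.open_target.mem_nhds htgt) ?_
    have h := hcont.tendsto
    rw [hsymm] at h
    exact h.eventually hS
  refine ⟨_, hV, e.symm, hsymm, ?_, ?_⟩
  · rintro y ⟨hy, hy1, -, f₁, hf₁⟩
    refine (e.contDiffAt_symm (f₀' := f₁) hy ?_ ?_).contDiffWithinAt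
    · rw [he, hf₁]
      exact ((hf.contDiffAt (hs.mem_nhds hy1)).differentiableAt (by simp)).hasFDerivAt
    · rw [he]
      exact hf.contDiffAt (hs.mem_nhds hy1)
  · rintro y ⟨hy, -, hy2, -⟩
    refine ⟨?_, hy2⟩
    have := e.right_inv hy
    rwa [he] at this

/-- Quasi-periods of the primitives of `p = φ h`, where `X` is the quasi-period of a primitive of
`x` for the period `q`. -/
def quasiP (x₀ X q : ℂ) : ℂ := X - x₀ * q

/-- Quasi-periods of the primitive of `ψ h`. -/
def quasiW (b c l m x₀ y₀ lam X q : ℂ) : ℂ :=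
  b * l * ((x₀ - (1 + lam) / 3) * X + (x₀ ^ 2 - (1 + lam) * x₀ + 2 * lam / 3) * q) +
    (l * c - m * b) * y₀ * q + m * c * (X - x₀ * q)

/-- Quasi-periods of the primitive of `h`. -/
def quasiH (b c x₀ y₀ X q : ℂ) : ℂ := -b * y₀ * q + c * (X - x₀ * q)

/-- Quasi-periods of the primitive of `φ ψ h`. -/
def quasiN (l m x₀ y₀ X q : ℂ) : ℂ := l * y₀ * q + m * (X - x₀ * q)

/-- The first quasi-period of a primitive of `x`. -/
def quasiX₁ (lam : ℂ) (w : ℂ × ℂ) : ℂ := -4 * eta₁ w + (1 + lam) / 3 * w.1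

/-- The second quasi-period of a primitive of `x`. -/
def quasiX₂ (lam : ℂ) (w : ℂ × ℂ) : ℂ := -4 * eta₂ w + (1 + lam) / 3 * w.2

/-- The equations that the parameters and periods satisfy; the coordinates are
`(b, y₀, ω₁, ω₂, λ, l, c, m, x₀)`. -/
def periodMap (v : Fin 9 → ℂ) : Fin 9 → ℂ :=
  ![v 0, v 1,
    4 * halfValue₁ (v 2, v 3) + (1 + v 4) / 3 - 1,
    4 * halfValue₂ (v 2, v 3) + (1 + v 4) / 3 - v 4,
    v 1 ^ 2 - v 8 * (v 8 - 1) * (v 8 - v 4),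
    quasiP (v 8) (quasiX₁ (v 4) (v 2, v 3)) (v 2) + (starRingEnd ℂ)
      (quasiW (v 0) (v 6) (v 5) (v 7) (v 8) (v 1) (v 4) (quasiX₁ (v 4) (v 2, v 3)) (v 2)),
    quasiP (v 8) (quasiX₂ (v 4) (v 2, v 3)) (v 3) + (starRingEnd ℂ)
      (quasiW (v 0) (v 6) (v 5) (v 7) (v 8) (v 1) (v 4) (quasiX₂ (v 4) (v 2, v 3)) (v 3)),
    (quasiH (v 0) (v 6) (v 8) (v 1) (quasiX₁ (v 4) (v 2, v 3)) (v 2)).re +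
      (quasiH (v 0) (v 6) (v 8) (v 1) (quasiX₂ (v 4) (v 2, v 3)) (v 3)).re * Complex.I,
    (quasiN (v 5) (v 7) (v 8) (v 1) (quasiX₁ (v 4) (v 2, v 3)) (v 2)).re +
      (quasiN (v 5) (v 7) (v 8) (v 1) (quasiX₂ (v 4) (v 2, v 3)) (v 3)).re * Complex.I]

/-- The parameters and periods of the Chen-Gackstatter surface. -/
def basePoint : Fin 9 → ℂ := ![rho, 0, side, side * Complex.I, -1, -rho, 0, 0, 0]

/-- The equation P + conj W = 0 is what fixes ρ: the quasi-periods of x are −4η₁ and −4η₂, those of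
W come from (2/3)ρ²z, and they balance because η₁ = (ρ²/6)ω₁ and η₂ = −i(ρ²/6)ω₁. -/
theorem periodMap_basePoint : periodMap basePoint = ![(rho : ℂ), 0, 0, 0, 0, 0, 0, 0, 0] := by
  obtain ⟨h1, h2⟩ := halfValue_squarePair
  obtain ⟨h3, h4⟩ := eta_squarePair
  rw [periods_squarePair] at h1 h2 h3 h4
  simp only [periodMap, basePoint, Matrix.cons_val, quasiX₁, quasiX₂, h1, h2, h3, h4]
  ext i
  fin_cases i <;> simp [quasiP, quasiW, quasiH, quasiN, Complex.conj_ofNat] <;> ring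

/-- Conjugations and real parts allow only real smoothness, although all the functions of the
periods are holomorphic. -/
theorem contDiffOn_periodMap :
    ContDiffOn ℝ ∞ periodMap {v | latticeDet (v 2, v 3) ≠ 0} := by
  intro v hv
  refine ContDiffAt.contDiffWithinAt ?_
  have hw : ContDiffAt ℝ ∞ (fun v : Fin 9 → ℂ => (v 2, v 3)) v := by fun_prop
  have ho : IsOpen {w : ℂ × ℂ | latticeDet w ≠ 0} :=
    isOpen_ne_fun continuous_latticeDet continuous_const
  have hc : ∀ f : ℂ × ℂ → ℂ, ContDiffAt ℂ ∞ f (v 2, v 3) →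
      ContDiffAt ℝ ∞ (fun v : Fin 9 → ℂ => f (v 2, v 3)) v := fun f hf =>
    ContDiffAt.comp (g := f) (f := fun v : Fin 9 → ℂ => (v 2, v 3)) v (hf.restrict_scalars ℝ) hw
  have h1 := hc _ (contDiffAt_halfValue hv).1
  have h2 := hc _ (contDiffAt_halfValue hv).2
  have h3 := hc _ (contDiffOn_eta.1.contDiffAt (ho.mem_nhds hv))
  have h4 := hc _ (contDiffOn_eta.2.contDiffAt (ho.mem_nhds hv))
  have hconj : ContDiff ℝ ∞ (starRingEnd ℂ) := Complex.conjCLE.contDiff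
  have hre : ∀ f : (Fin 9 → ℂ) → ℂ, ContDiffAt ℝ ∞ f v →
      ContDiffAt ℝ ∞ (fun v => ((f v).re : ℂ)) v := fun f hf =>
    (Complex.ofRealCLM.contDiff.comp Complex.reCLM.contDiff).contDiffAt.comp v hf
  rw [contDiffAt_pi]
  intro i
  fin_cases i <;> simp only [periodMap, Matrix.cons_val, quasiX₁, quasiX₂, quasiP, quasiW, quasiH,
    quasiN, Fin.reduceFinMk, Fin.zero_eta, Fin.mk_one, div_eq_mul_inv]
  iterate 7 fun_prop
  all_goals exact (hre _ (by fun_prop)).add ((hre _ (by fun_prop)).mul contDiffAt_const)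

/-- Linearizing along v, the components b and y₀ vanish by assumption and the curve equation gives
δx₀ = 0. The half-period equations express the variation of the lattice through δλ. The equations
for H and N give δc = δm = 0, and those for P + conj W couple δλ and δl, with only the zero solution
because (4/3)ρ⁴ < 1. -/
theorem periodMap_injective {v : Fin 9 → ℂ} (hv : fderiv ℝ periodMap basePoint v = 0) : v = 0 := by
  have hdet : latticeDet (basePoint 2, basePoint 3) ≠ 0 := by
    have := latticeDet_periods_ne_zero squarePair
    rw [periods_squarePair] at this
    simpa [basePoint] using this
  have ho : IsOpen {v : Fin 9 → ℂ | latticeDet (v 2, v 3) ≠ 0} :=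
    isOpen_ne_fun (continuous_latticeDet.comp (by fun_prop)) continuous_const
  have hline : HasDerivAt (fun s : ℝ => basePoint + s • v) v 0 := by
    simpa using ((hasDerivAt_id (0 : ℝ)).smul_const v).const_add basePoint
  have hco : ∀ i, HasDerivAt (fun s : ℝ => (basePoint + s • v) i) (v i) 0 :=
    fun i => hasDerivAt_pi.1 hline i
  have hP : ∀ i, HasDerivAt (fun s : ℝ => periodMap (basePoint + s • v) i) 0 0 := by
    have h1 : HasFDerivAt periodMap (fderiv ℝ periodMap basePoint) (basePoint + (0 : ℝ) • v) := by
      rw [zero_smul, add_zero]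
      exact ((contDiffOn_periodMap.contDiffAt (ho.mem_nhds hdet)).differentiableAt
        (by simp)).hasFDerivAt
    have h2 := h1.comp_hasDerivAt (0 : ℝ) hline
    rw [hv] at h2
    exact fun i => hasDerivAt_pi.1 h2 i
  have hw : HasDerivAt (fun s : ℝ => ((basePoint + s • v) 2, (basePoint + s • v) 3)) (v 2, v 3) 0 :=
    (hco 2).prodMk (hco 3)
  have hbase : ((basePoint + (0 : ℝ) • v) 2, (basePoint + (0 : ℝ) • v) 3) = periods squarePair := by
    rw [periods_squarePair]
    simp [basePoint]
  have hcomp : ∀ f : ℂ × ℂ → ℂ, DifferentiableAt ℂ f (periods squarePair) →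
      HasDerivAt (fun s : ℝ => f ((basePoint + s • v) 2, (basePoint + s • v) 3))
        (fderiv ℂ f (periods squarePair) (v 2, v 3)) 0 := by
    intro f hf
    have h1 := hf.hasFDerivAt.restrictScalars ℝ
    rw [← hbase] at h1
    have h2 := h1.comp_hasDerivAt (0 : ℝ) hw
    rw [hbase] at h2
    exact h2
  have hd := contDiffAt_halfValue (latticeDet_periods_ne_zero squarePair)
  have he1 := hcomp _ (hd.1.differentiableAt (by simp))
  have he2 := hcomp _ (hd.2.differentiableAt (by simp))
  have hE1 := hcomp _ (differentiableAt_eta (L := squarePair)).1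
  have hE2 := hcomp _ (differentiableAt_eta (L := squarePair)).2
  have hconj : ∀ {f : ℝ → ℂ} {f' : ℂ}, HasDerivAt f f' 0 →
      HasDerivAt (fun s => (starRingEnd ℂ) (f s)) ((starRingEnd ℂ) f') 0 := fun hf =>
    (Complex.conjCLE.toContinuousLinearMap.hasFDerivAt).comp_hasDerivAt (0 : ℝ) hf
  have hre : ∀ {f : ℝ → ℂ} {f' : ℂ}, HasDerivAt f f' 0 →
      HasDerivAt (fun s => ((f s).re : ℂ)) (f'.re : ℂ) 0 := fun hf =>
    ((Complex.ofRealCLM.comp Complex.reCLM).hasFDerivAt).comp_hasDerivAt (0 : ℝ) hf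
  have hσ := ((hco 4).const_add 1).div_const 3
  have hX1 := (hE1.const_mul (-4)).fun_add (hσ.fun_mul (hco 2))
  have hX2 := (hE2.const_mul (-4)).fun_add (hσ.fun_mul (hco 3))
  have hxx := (((hco 8).fun_pow 2).fun_sub (((hco 4).const_add 1).fun_mul (hco 8))).fun_add
    (((hco 4).const_mul 2).div_const 3)
  have hW : ∀ {X q : ℝ → ℂ} {X' q' : ℂ}, HasDerivAt X X' 0 → HasDerivAt q q' 0 → _ :=
    fun {X q X' q'} (hX : HasDerivAt X X' 0) (hq : HasDerivAt q q' 0) =>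
    ((((hco 0).fun_mul (hco 5)).fun_mul ((((hco 8).fun_sub hσ).fun_mul hX).fun_add
      (hxx.fun_mul hq))).fun_add
    (((((hco 5).fun_mul (hco 6)).fun_sub ((hco 7).fun_mul (hco 0))).fun_mul (hco 1)).fun_mul hq))
    |>.fun_add (((hco 7).fun_mul (hco 6)).fun_mul (hX.fun_sub ((hco 8).fun_mul hq)))
  have hH : ∀ {X q : ℝ → ℂ} {X' q' : ℂ}, HasDerivAt X X' 0 → HasDerivAt q q' 0 → _ :=
    fun {X q X' q'} (hX : HasDerivAt X X' 0) (hq : HasDerivAt q q' 0) =>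
    (((hco 0).fun_neg.fun_mul (hco 1)).fun_mul hq).fun_add
      ((hco 6).fun_mul (hX.fun_sub ((hco 8).fun_mul hq)))
  have hN : ∀ {X q : ℝ → ℂ} {X' q' : ℂ}, HasDerivAt X X' 0 → HasDerivAt q q' 0 → _ :=
    fun {X q X' q'} (hX : HasDerivAt X X' 0) (hq : HasDerivAt q q' 0) =>
    (((hco 5).fun_mul (hco 1)).fun_mul hq).fun_add
      ((hco 7).fun_mul (hX.fun_sub ((hco 8).fun_mul hq)))
  have c0 := (hco 0).unique (hP 0)
  have c1 := (hco 1).unique (hP 1)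
  have c2 := (((he1.const_mul 4).fun_add hσ).sub_const 1).unique (hP 2)
  have c3 := (((he2.const_mul 4).fun_add hσ).fun_sub (hco 4)).unique (hP 3)
  have c4 := (((hco 1).fun_pow 2).fun_sub (((hco 8).fun_mul ((hco 8).sub_const 1)).fun_mul
    ((hco 8).fun_sub (hco 4)))).unique (hP 4)
  have c5 := ((hX1.fun_sub ((hco 8).fun_mul (hco 2))).fun_add (hconj (hW hX1 (hco 2)))).unique (hP 5)
  have c6 := ((hX2.fun_sub ((hco 8).fun_mul (hco 3))).fun_add (hconj (hW hX2 (hco 3)))).unique (hP 6)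
  have c7 := ((hre (hH hX1 (hco 2))).fun_add ((hre (hH hX2 (hco 3))).mul_const Complex.I)).unique
    (hP 7)
  have c8 := ((hre (hN hX1 (hco 2))).fun_add ((hre (hN hX2 (hco 3))).mul_const Complex.I)).unique
    (hP 8)
  clear hP hW hH hN hconj hre hX1 hX2 hE1 hE2 he1 he2 hxx hσ hcomp hw hbase hd hline hco
  have hs : (side : ℂ) ≠ 0 := Complex.ofReal_ne_zero.2 side_pos.ne'
  have hr : (rho : ℂ) ≠ 0 := Complex.ofReal_ne_zero.2 rho_pos.ne'
  have hI : (Complex.I : ℂ) ^ 2 = -1 := Complex.I_sq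
  obtain ⟨k1, k2⟩ := halfValue_squarePair
  obtain ⟨k3, k4⟩ := eta_squarePair
  set κ : ℂ := rho ^ 2 / 6 with hκ
  have hκ0 : κ ≠ 0 := div_ne_zero (pow_ne_zero _ hr) (by norm_num)
  -- On the square lattice (ω₁, ω₂) is proportional to (1, i) and (η₁, η₂) to (1, −i), so they form
  -- a basis; the witnesses solve the 2×2 system.
  obtain ⟨μ, ν, hμν⟩ : ∃ μ ν : ℂ, (v 2, v 3) = μ • periods squarePair +
      ν • (eta₁ (periods squarePair), eta₂ (periods squarePair)) := by
    rw [k3, k4, periods_squarePair]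
    refine ⟨(v 2 + -Complex.I * v 3) / (2 * side), (v 2 + Complex.I * v 3) / (2 * κ * side), ?_⟩
    ext
    · simp; field_simp; ring
    · simp; field_simp; linear_combination (2 * v 3) * hI
  have hper := periods_squarePair
  have f1 := (fderiv_halfValue_apply squarePair μ ν).1
  have f2 := (fderiv_halfValue_apply squarePair μ ν).2
  have f3 := (fderiv_eta_apply squarePair μ ν).1
  have f4 := (fderiv_eta_apply squarePair μ ν).2
  rw [← hμν] at f1 f2 f3 f4
  have hω₁ : squarePair.ω₁ = side := congrArg Prod.fst hper
  have hω₂ : squarePair.ω₂ = side * Complex.I := congrArg Prod.snd hper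
  rw [k1, g₂_squarePair] at f1
  rw [k2, g₂_squarePair] at f2
  rw [k3, hω₁, g₂_squarePair] at f3
  rw [k4, hω₂, g₂_squarePair] at f4
  rw [k3, k4, hper] at hμν
  have hv2 : v 2 = (μ + ν * κ) * side := by
    have := congrArg Prod.fst hμν
    simp at this
    rw [this]; ring
  have hv3 : v 3 = (μ - ν * κ) * (side * Complex.I) := by
    have := congrArg Prod.snd hμν
    simp at this
    rw [this]; ring
  rw [hper] at k3 k4
  rw [f1] at c2
  rw [f2] at c3
  rw [f3] at c5 c7 c8
  rw [f4] at c6 c7 c8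
  clear f1 f2 f3 f4 hμν
  simp only [zero_smul, add_zero, basePoint, Matrix.cons_val, k3, k4, c0, c1] at c2 c3 c4 c5 c6 c7 c8
  norm_num at c2 c3 c4
  -- Sum and difference of the half-period equations: with values ±1/4 and g₂ = 1/4 they read −2μ −
  -- ν/6 + δλ/3 = 0 and 2μ − ν/6 − 2δλ/3 = 0.
  have hν : ν = -v 4 := by linear_combination -3 * c2 - 3 * c3
  have hμ : μ = v 4 / 4 := by linear_combination -c2 / 2 - hν / 12
  rw [hv2] at c5 c7 c8
  rw [hv3] at c6 c7 c8
  rw [c4] at c5 c6 c7 c8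
  norm_num at c5 c6 c7 c8
  have hκc : (starRingEnd ℂ) κ = κ := by rw [hκ]; simp [Complex.conj_ofNat]
  have hκim : κ.im = 0 := Complex.conj_eq_iff_im.1 hκc
  have hκre : κ.re ≠ 0 := fun h => hκ0 (Complex.ext h hκim)
  have h3 : (starRingEnd ℂ) 3 = 3 := Complex.conj_ofNat 3
  have h2 : (starRingEnd ℂ) 2 = 2 := Complex.conj_ofNat 2
  have h4 : (starRingEnd ℂ) 4 = 4 := Complex.conj_ofNat 4
  -- The quasi-periods of x are −4κ·side and 4iκ·side with κ real. The two real equations thus read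
  -- off the real and imaginary parts of the unknown u, which is δc or δm.
  have hzero : ∀ u : ℂ, (u.im : ℂ) * (4 * (κ.im * side)) - u.re * (4 * (κ.re * side)) +
      (-(u.re * (4 * (κ.im * side))) - u.im * (4 * (κ.re * side))) * Complex.I = 0 → u = 0 := by
    intro u hu
    have hκre' : (κ.re : ℂ) ≠ 0 := Complex.ofReal_ne_zero.2 hκre
    have h5 : (κ.re : ℂ) * side * u = 0 := by
      rw [← Complex.re_add_im u]
      rw [hκim] at hu
      push_cast at hu
      linear_combination -hu / 4
    exact (mul_eq_zero.1 h5).resolve_left (mul_ne_zero hκre' hs)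
  have z6 := hzero _ c7
  have z7 := hzero _ c8
  simp only [hμ, hν, map_neg, map_div₀, h2, h3, h4, hκc] at c5 c6
  set L := (starRingEnd ℂ) (v 4) with hL
  set l' := (starRingEnd ℂ) (v 5) with hl'
  have d5 : v 4 * κ + v 4 / 4 - 2 / 3 * rho * l' - rho ^ 2 * L * (2 * κ + 1 / 2) = 0 := by
    refine (mul_eq_zero.1 (?_ : (side : ℂ) * _ = 0)).resolve_left hs
    linear_combination c5
  have d6 : -(v 4 * κ) + v 4 / 4 + 2 / 3 * rho * l' - rho ^ 2 * L * (2 * κ - 1 / 2) = 0 := by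
    refine (mul_eq_zero.1 (?_ : (side * Complex.I : ℂ) * _ = 0)).resolve_left
      (mul_ne_zero hs Complex.I_ne_zero)
    linear_combination c6
  -- The unknown δl enters both equations with opposite signs; adding them eliminates it and leaves
  -- δλ/2 = 4κρ² conj(δλ) with κ = ρ²/6. Taking norms then forces δλ = 0.
  have d7 : v 4 = ((4 / 3 * rho ^ 4 : ℝ) : ℂ) * L := by
    push_cast
    rw [hκ] at d5 d6
    linear_combination 2 * d5 + 2 * d6
  have z4 : v 4 = 0 := by
    by_contra h
    have h5 := congrArg norm d7
    rw [norm_mul, hL, Complex.norm_conj, Complex.norm_real, Real.norm_of_nonneg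
      (by have := rho_pos; positivity)] at h5
    have h6 : 0 < ‖v 4‖ := norm_pos_iff.2 h
    have h7 := rho_sq_le
    have h8 : rho ^ 4 < 3 / 4 := by nlinarith [sq_nonneg rho]
    nlinarith
  have z5 : v 5 = 0 := by
    have hL0 : L = 0 := by rw [hL, z4, map_zero]
    rw [z4, hL0] at d5
    have h5 : (rho : ℂ) * l' = 0 := by linear_combination -3 / 2 * d5
    have h6 := (mul_eq_zero.1 h5).resolve_left hr
    exact (map_eq_zero _).1 (hl' ▸ h6)
  ext i
  fin_cases i
  · exact c0
  · exact c1
  · simp only [Fin.reduceFinMk, hv2, hμ, hν, z4]; simp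
  · simp only [Fin.reduceFinMk, hv3, hμ, hν, z4]; simp
  · exact z4
  · exact z5
  · exact z6
  · exact z7
  · exact c4

/-- The vectors `(b, y₀)` of the family, with the other coordinates of `periodMap basePoint`. -/
def familyPoint (t : EuclideanSpace ℝ (Fin 4)) : Fin 9 → ℂ :=
  ![rho + t 0 + t 1 * Complex.I, t 2 + t 3 * Complex.I, 0, 0, 0, 0, 0, 0, 0]

/-- Near the Chen-Gackstatter surface, the parameters for which the period problem is solved form a
smooth family parametrized by `(b, y₀)`. -/
theorem exists_family {N : Set (Fin 9 → ℂ)} (hN : N ∈ 𝓝 basePoint) :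
    ∃ r > 0, ∃ g : EuclideanSpace ℝ (Fin 4) → Fin 9 → ℂ, g 0 = basePoint ∧
      ContDiffOn ℝ ∞ g (Metric.ball 0 r) ∧
      ∀ t ∈ Metric.ball 0 r, periodMap (g t) = familyPoint t ∧ g t ∈ N := by
  have hdet : latticeDet (basePoint 2, basePoint 3) ≠ 0 := by
    have := latticeDet_periods_ne_zero squarePair
    rw [periods_squarePair] at this
    simpa [basePoint] using this
  have ho : IsOpen {v : Fin 9 → ℂ | latticeDet (v 2, v 3) ≠ 0} :=
    isOpen_ne_fun (continuous_latticeDet.comp (by fun_prop)) continuous_const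
  obtain ⟨V, hV, f, hf0, hf, hfV⟩ := exists_smooth_localInverse ho hdet contDiffOn_periodMap
    (fun v => periodMap_injective) hN
  have hpt0 : familyPoint 0 = periodMap basePoint := by
    rw [periodMap_basePoint]
    simp [familyPoint]
  have hsmooth : ContDiff ℝ ∞ familyPoint := by
    have h : ∀ i : Fin 4, ContDiff ℝ ∞ fun t : EuclideanSpace ℝ (Fin 4) => ((t i : ℝ) : ℂ) :=
      fun i => Complex.ofRealCLM.contDiff.comp (EuclideanSpace.proj i : _ →L[ℝ] ℝ).contDiff
    have h0 := h 0
    have h1 := h 1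
    have h2 := h 2
    have h3 := h 3
    rw [contDiff_pi]
    intro i
    fin_cases i <;> simp only [familyPoint, Matrix.cons_val, Fin.reduceFinMk, Fin.zero_eta,
      Fin.mk_one] <;> fun_prop
  rw [← hpt0] at hV hf0
  obtain ⟨r, hr, hball⟩ := Metric.mem_nhds_iff.1 (hsmooth.continuous.continuousAt.preimage_mem_nhds hV)
  refine ⟨r, hr, f ∘ familyPoint, hf0, hf.comp hsmooth.contDiffOn hball, fun t ht => ?_⟩
  exact hfV _ (hball ht)

/-! ### Regularity and positivity of the metric near the Chen–Gackstatter data -/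

section

namespace Params

/-- `h` as a function on the curve. -/
def hVal (p : Params) (x y : ℂ) : ℂ := p.b * (y - p.y₀) + p.c * (x - p.x₀)

/-- `φ ψ h` as a function on the curve. -/
def nVal (p : Params) (x y : ℂ) : ℂ := p.l * (y + p.y₀) + p.m * (x - p.x₀)

/-- `ψ h` as a function on the curve. -/
def wVal (p : Params) (x y : ℂ) : ℂ :=
  p.b * p.l * (x ^ 2 + x * p.x₀ + p.x₀ ^ 2 - (1 + p.lam) * (x + p.x₀) + p.lam) +
    (p.l * p.c + p.m * p.b) * y + (p.l * p.c - p.m * p.b) * p.y₀ + p.m * p.c * (x - p.x₀)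

/-- A quarter of the density of the induced metric, as a function on the curve. -/
def energy (p : Params) (x y : ℂ) : ℝ :=
  ‖x - p.x₀‖ ^ 2 + ‖p.wVal x y‖ ^ 2 - 2 * (p.nVal x y * (starRingEnd ℂ) (p.hVal x y)).re

/-- The base point `(x₀, y₀)` lies on the curve. -/
def OnCurve (p : Params) : Prop := p.y₀ ^ 2 = p.x₀ * (p.x₀ - 1) * (p.x₀ - p.lam)

/-- The point (x₀, y₀) lies on the curve too, so y² − y₀² is divisible by x − x₀ as a polynomial in
x. Hence ψh has no pole at x = x₀, and `wVal` is the quotient. -/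
theorem mul_wVal {p : Params} (hp : p.OnCurve) {x y : ℂ} (h : y ^ 2 = x * (x - 1) * (x - p.lam)) :
    (x - p.x₀) * p.wVal x y = p.hVal x y * p.nVal x y := by
  rw [OnCurve] at hp
  simp only [wVal, hVal, nVal]
  linear_combination (-p.b * p.l) * h + (p.b * p.l) * hp

theorem energy_of_eq {p : Params} (hp : p.OnCurve) {x y : ℂ}
    (h : y ^ 2 = x * (x - 1) * (x - p.lam)) (hx : x - p.x₀ = 0) :
    p.energy x y = ‖p.wVal x y‖ ^ 2 := by
  have h1 := mul_wVal hp h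
  rw [hx, zero_mul] at h1
  have h2 : p.nVal x y * (starRingEnd ℂ) (p.hVal x y) = 0 := by
    rcases mul_eq_zero.1 h1.symm with h3 | h3 <;> simp [h3]
  simp [energy, hx, h2]

/-- Since |P||W| = |H||N|, the energy times |P|² is a perfect square. Away from x = x₀ it vanishes
exactly when N conj H = |P|², that is, when φ = conj ψ. -/
theorem energy_mul {p : Params} (hp : p.OnCurve) {x y : ℂ}
    (h : y ^ 2 = x * (x - 1) * (x - p.lam)) :
    ‖x - p.x₀‖ ^ 2 * p.energy x y =
      ‖(‖x - p.x₀‖ ^ 2 : ℂ) - p.nVal x y * (starRingEnd ℂ) (p.hVal x y)‖ ^ 2 := by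
  have h1 := congrArg norm (mul_wVal hp h)
  rw [norm_mul, norm_mul] at h1
  set z := p.nVal x y * (starRingEnd ℂ) (p.hVal x y) with hz
  have h2 : ‖z‖ = ‖x - p.x₀‖ * ‖p.wVal x y‖ := by
    rw [h1, hz, norm_mul, Complex.norm_conj, mul_comm]
  have h3 : ∀ r : ℝ, ‖(r ^ 2 : ℂ) - z‖ ^ 2 = r ^ 4 - 2 * r ^ 2 * z.re + ‖z‖ ^ 2 := by
    intro r
    rw [← Complex.ofReal_pow, Complex.sq_norm, Complex.sq_norm, Complex.normSq_apply,
      Complex.normSq_apply]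
    simp only [Complex.sub_re, Complex.sub_im, Complex.ofReal_re, Complex.ofReal_im]
    ring
  rw [h3, h2, energy, ← hz]
  ring

/-- The parameters are close to those of the Chen-Gackstatter surface. -/
structure IsClose (p : Params) : Prop where
  b : ‖p.b - rho‖ ≤ rho ^ 4 / 1000
  c : ‖p.c‖ ≤ rho ^ 4 / 1000
  l : ‖p.l + rho‖ ≤ rho ^ 4 / 1000
  m : ‖p.m‖ ≤ rho ^ 4 / 1000
  x₀ : ‖p.x₀‖ ≤ rho ^ 4 / 1000
  y₀ : ‖p.y₀‖ ≤ rho ^ 4 / 1000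
  lam : ‖p.lam + 1‖ ≤ rho ^ 4 / 1000

theorem rho_pow_four_le : rho ^ 4 ≤ rho ^ 2 ∧ rho ^ 4 ≤ rho ∧ rho ^ 2 ≤ rho := by
  have h0 := rho_pos
  have h1 := rho_lt_one
  have h2 : rho ^ 2 ≤ rho := by nlinarith
  have h3 : rho ^ 4 ≤ rho ^ 2 := by nlinarith [sq_nonneg rho]
  exact ⟨h3, h3.trans h2, h2⟩

namespace IsClose

variable {p : Params}

theorem norm_b (h : p.IsClose) : 0.999 * rho ≤ ‖p.b‖ ∧ ‖p.b‖ ≤ 2 := by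
  have h0 := rho_pos
  have h1 := rho_lt_one
  have h2 := rho_pow_four_le.2.1
  have h3 : ‖(rho : ℂ)‖ = rho := by rw [Complex.norm_real, Real.norm_of_nonneg h0.le]
  have h4 := norm_sub_norm_le (rho : ℂ) p.b
  have h5 := norm_sub_norm_le p.b (rho : ℂ)
  rw [norm_sub_rev] at h4
  have h6 := h.b
  constructor <;> linarith

theorem norm_l (h : p.IsClose) : 0.999 * rho ≤ ‖p.l‖ ∧ ‖p.l‖ ≤ 2 := by
  have h0 := rho_pos
  have h1 := rho_lt_one
  have h2 := rho_pow_four_le.2.1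
  have h3 : ‖(-rho : ℂ)‖ = rho := by rw [norm_neg, Complex.norm_real, Real.norm_of_nonneg h0.le]
  have h4 := norm_sub_norm_le (-rho : ℂ) p.l
  have h5 := norm_sub_norm_le p.l (-rho : ℂ)
  rw [norm_sub_rev, sub_neg_eq_add] at h4
  rw [sub_neg_eq_add] at h5
  have h6 := h.l
  constructor <;> linarith

theorem b_ne_zero (h : p.IsClose) : p.b ≠ 0 := by
  have := h.norm_b.1
  have h0 := rho_pos
  exact norm_pos_iff.1 (by linarith)

theorem l_ne_zero (h : p.IsClose) : p.l ≠ 0 := by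
  have := h.norm_l.1
  have h0 := rho_pos
  exact norm_pos_iff.1 (by linarith)

theorem lam_re_neg (h : p.IsClose) : p.lam.re < 0 := by
  have h1 := (Complex.abs_re_le_norm (p.lam + 1)).trans h.lam
  have h2 := rho_pow_four_le.2.1
  have h3 := rho_lt_one
  have h4 := (abs_le.1 h1).2
  simp at h4
  linarith

/-- Close to the zeros of `φ h` the function `ψ h` is bounded from below. -/
theorem norm_wVal (h : p.IsClose) {x y : ℂ} (hxy : y ^ 2 = x * (x - 1) * (x - p.lam))
    (hx : ‖x - p.x₀‖ ≤ rho ^ 2 / 16) : rho ^ 2 / 8 < ‖p.wVal x y‖ := by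
  have h0 := rho_pos
  have h1 := rho_lt_one
  obtain ⟨h2, h3, h4⟩ := rho_pow_four_le
  have hb := h.norm_b
  have hl := h.norm_l
  set e := rho ^ 4 / 1000 with he
  have he0 : 0 < e := by positivity
  have he1 : e ≤ 1 / 1000 := by linarith
  have her : e ≤ rho ^ 2 / 1000 := by linarith
  have hxn : ‖x‖ ≤ 1 / 15 := by
    have := norm_add_le (x - p.x₀) p.x₀
    rw [sub_add_cancel] at this
    linarith [h.x₀]
  have hx1 : ‖x - 1‖ ≤ 1.1 := by
    have := norm_sub_le x 1
    rw [norm_one] at this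
    linarith
  have hxl : ‖x - p.lam‖ ≤ 1.1 := by
    have h5 := norm_sub_le (x + 1) (p.lam + 1)
    have h6 := norm_add_le x 1
    rw [norm_one] at h6
    rw [add_sub_add_right_eq_sub] at h5
    linarith [h.lam]
  have hy : ‖y‖ ≤ 1 := by
    have h5 : ‖y‖ ^ 2 ≤ 1 := by
      rw [← norm_pow, hxy, norm_mul, norm_mul]
      calc ‖x‖ * ‖x - 1‖ * ‖x - p.lam‖ ≤ 1 / 15 * 1.1 * 1.1 := by gcongr
        _ ≤ 1 := by norm_num
    nlinarith [norm_nonneg y]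
  -- For x near 0 the polynomial Q is close to λ ≈ −1, so the main term blQ of W has modulus close
  -- to ρ²; the terms containing c or m are collected in T below.
  set Q := x ^ 2 + x * p.x₀ + p.x₀ ^ 2 - (1 + p.lam) * (x + p.x₀) + p.lam with hQ
  have hQ1 : ‖Q + 1‖ ≤ 1 / 100 := by
    have h5 : Q + 1 = x ^ 2 + x * p.x₀ + p.x₀ ^ 2 - (p.lam + 1) * (x + p.x₀) + (p.lam + 1) := by
      rw [hQ]; ring
    have h6 : ‖Q + 1‖ ≤ ‖x‖ ^ 2 + ‖x‖ * ‖p.x₀‖ + ‖p.x₀‖ ^ 2 + ‖p.lam + 1‖ * (‖x‖ + ‖p.x₀‖) +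
        ‖p.lam + 1‖ := by
      rw [h5]
      refine (norm_add_le _ _).trans (add_le_add_left ?_ _)
      refine (norm_sub_le _ _).trans (add_le_add ?_ ?_)
      · refine (norm_add₃_le).trans ?_
        simp
      · rw [norm_mul]
        gcongr
        exact norm_add_le _ _
    calc ‖Q + 1‖ ≤ _ := h6
      _ ≤ (1 / 15) ^ 2 + 1 / 15 * (1 / 1000) + (1 / 1000) ^ 2 + 1 / 1000 * (1 / 15 + 1 / 1000) +
        1 / 1000 := by
        have := h.x₀.trans he1
        have := h.lam.trans he1
        gcongr
      _ ≤ 1 / 100 := by norm_num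
  have hQ2 : 0.99 ≤ ‖Q‖ := by
    have := norm_sub_norm_le (1 : ℂ) (1 + Q)
    rw [norm_one, show (1 : ℂ) - (1 + Q) = -Q by ring, norm_neg, add_comm (1 : ℂ)] at this
    linarith
  have hmain : 0.9 * rho ^ 2 ≤ ‖p.b * p.l * Q‖ := by
    rw [norm_mul, norm_mul]
    calc 0.9 * rho ^ 2 ≤ 0.999 * rho * (0.999 * rho) * 0.99 := by nlinarith
      _ ≤ _ := by
        have := hb.1
        have := hl.1
        gcongr
  set T := (p.l * p.c + p.m * p.b) * y + (p.l * p.c - p.m * p.b) * p.y₀ + p.m * p.c * (x - p.x₀)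
    with hT
  have hTn : ‖T‖ ≤ 9 * e := by
    have h5 : ‖p.l * p.c‖ ≤ 2 * e := by
      rw [norm_mul]
      have := hl.2
      have := h.c
      gcongr
    have h6 : ‖p.m * p.b‖ ≤ 2 * e := by
      rw [norm_mul, mul_comm]
      have := hb.2
      have := h.m
      gcongr
    have h7 : ‖(p.l * p.c + p.m * p.b) * y‖ ≤ 4 * e * 1 := by
      rw [norm_mul]
      have := norm_add_le (p.l * p.c) (p.m * p.b)
      gcongr
      linarith
    have h8 : ‖(p.l * p.c - p.m * p.b) * p.y₀‖ ≤ 4 * e * 1 := by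
      rw [norm_mul]
      have := norm_sub_le (p.l * p.c) (p.m * p.b)
      have := h.y₀
      gcongr <;> linarith
    have h9 : ‖p.m * p.c * (x - p.x₀)‖ ≤ e * 1 * 1 := by
      rw [norm_mul, norm_mul]
      have := h.m
      have := h.c
      gcongr <;> linarith
    refine (norm_add₃_le).trans ?_
    linarith
  have hw : p.wVal x y = p.b * p.l * Q + T := by
    rw [wVal, hT, hQ]; ring
  have := norm_sub_le (p.b * p.l * Q + T) T
  rw [add_sub_cancel_right] at this
  rw [hw]
  nlinarith [sq_pos_of_pos h0]

/-- Regularity of the Weierstrass data, away from the zeros of `φ h`. -/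
theorem nVal_mul_conj_ne (h : p.IsClose) (hp : p.OnCurve) {x y : ℂ}
    (hxy : y ^ 2 = x * (x - 1) * (x - p.lam)) (hx : x - p.x₀ ≠ 0) :
    p.nVal x y * (starRingEnd ℂ) (p.hVal x y) ≠ (‖x - p.x₀‖ ^ 2 : ℂ) := by
  intro heq
  have h0 := rho_pos
  have h1 := rho_lt_one
  obtain ⟨h2, h3, h4⟩ := rho_pow_four_le
  have hξ : 0 < ‖x - p.x₀‖ := norm_pos_iff.2 hx
  rcases le_or_gt ‖x - p.x₀‖ (rho ^ 2 / 16) with hnear | hfar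
  -- Equality would give |P||W| = |N||H| = |P|², hence |W| = |P| ≤ ρ²/16, against the lower bound
  -- ρ²/8.
  · have h5 := h.norm_wVal hxy hnear
    have h6 := congrArg norm (mul_wVal hp hxy)
    have h7 := congrArg norm heq
    rw [norm_mul, Complex.norm_conj, mul_comm, ← norm_mul, ← h6, norm_mul, ← Complex.ofReal_pow,
      Complex.norm_real, Real.norm_of_nonneg (by positivity)] at h7
    have h8 : ‖x - p.x₀‖ * (‖p.wVal x y‖ - ‖x - p.x₀‖) = 0 := by linear_combination h7
    have := (mul_eq_zero.1 h8).resolve_left hξ.ne'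
    nlinarith [sq_pos_of_pos h0]
  -- Away from x = x₀ one has H ≈ ρy and N ≈ −ρy, so N conj H is close to −ρ²|y|² ≤ 0 and cannot
  -- equal |P|². All errors are absorbed by ρ²|y|² + |P|².
  · set e := rho ^ 4 / 1000 with he
    have he0 : 0 < e := by positivity
    have he1 : e ≤ rho / 1000 := by linarith
    have hd : ∀ d : ℂ, ‖d‖ ≤ e * ‖y‖ + 2 * e + e * ‖x - p.x₀‖ →
        ‖d‖ ≤ 0.001 * (rho * ‖y‖) + 0.033 * ‖x - p.x₀‖ := by
      intro d hd
      -- The constant errors are controlled by |x − x₀| > ρ²/16; the closeness ρ⁴/1000 ≤ ρ²/1000 is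
      -- chosen for this.
      have h5 : 2 * e ≤ 0.032 * ‖x - p.x₀‖ := by
        nlinarith [sq_pos_of_pos h0]
      have h6 : e * ‖y‖ ≤ 0.001 * (rho * ‖y‖) := by
        nlinarith [mul_le_mul_of_nonneg_right he1 (norm_nonneg y)]
      have h7 : e * ‖x - p.x₀‖ ≤ 0.001 * ‖x - p.x₀‖ := by
        nlinarith
      linarith
    have hd1 := hd (p.hVal x y - rho * y) (by
      have h5 : p.hVal x y - rho * y = (p.b - rho) * y - p.b * p.y₀ + p.c * (x - p.x₀) := by
        rw [hVal]; ring
      rw [h5]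
      refine (norm_add_le _ _).trans (add_le_add ((norm_sub_le _ _).trans (add_le_add ?_ ?_)) ?_)
      · rw [norm_mul]; have := h.b; gcongr
      · rw [norm_mul]; have := h.norm_b.2; have := h.y₀; gcongr
      · rw [norm_mul]; have := h.c; gcongr)
    have hd2 := hd (p.nVal x y + rho * y) (by
      have h5 : p.nVal x y + rho * y = (p.l + rho) * y + p.l * p.y₀ + p.m * (x - p.x₀) := by
        rw [nVal]; ring
      rw [h5]
      refine (norm_add_le _ _).trans (add_le_add ((norm_add_le _ _).trans (add_le_add ?_ ?_)) ?_)
      · rw [norm_mul]; have := h.l; gcongr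
      · rw [norm_mul]; have := h.norm_l.2; have := h.y₀; gcongr
      · rw [norm_mul]; have := h.m; gcongr)
    set d1 := p.hVal x y - rho * y with hd1'
    set d2 := p.nVal x y + rho * y with hd2'
    have e1 : p.hVal x y = rho * y + d1 := by rw [hd1']; ring
    have e2 : p.nVal x y = -(rho * y) + d2 := by rw [hd2']; ring
    have hyy : y * (starRingEnd ℂ) y = (‖y‖ ^ 2 : ℂ) := Complex.mul_conj' y
    have key : ((‖x - p.x₀‖ ^ 2 + rho ^ 2 * ‖y‖ ^ 2 : ℝ) : ℂ) =
        rho * (starRingEnd ℂ) y * d2 - rho * y * (starRingEnd ℂ) d1 + d2 * (starRingEnd ℂ) d1 := by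
      rw [e1, e2, map_add, map_mul, Complex.conj_ofReal] at heq
      push_cast
      linear_combination -heq - rho ^ 2 * hyy
    have key2 := congrArg norm key
    rw [Complex.norm_real, Real.norm_of_nonneg (by positivity)] at key2
    have hbd : ‖(rho : ℂ) * (starRingEnd ℂ) y * d2 - rho * y * (starRingEnd ℂ) d1 +
        d2 * (starRingEnd ℂ) d1‖ ≤ rho * ‖y‖ * ‖d2‖ + rho * ‖y‖ * ‖d1‖ + ‖d2‖ * ‖d1‖ := by
      refine (norm_add_le _ _).trans (add_le_add ((norm_sub_le _ _).trans (add_le_add ?_ ?_)) ?_)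
      · simp [abs_of_pos h0]
      · simp [abs_of_pos h0]
      · simp
    rw [← key2] at hbd
    set Y := rho * ‖y‖ with hY
    have hY0 : 0 ≤ Y := by positivity
    set ξ := ‖x - p.x₀‖
    have h5 : ‖d2‖ * ‖d1‖ ≤ (0.001 * Y + 0.033 * ξ) * (0.001 * Y + 0.033 * ξ) := by gcongr
    have h6 : Y * ‖d2‖ ≤ Y * (0.001 * Y + 0.033 * ξ) := by gcongr
    have h7 : Y * ‖d1‖ ≤ Y * (0.001 * Y + 0.033 * ξ) := by gcongr
    have h8 : rho ^ 2 * ‖y‖ ^ 2 = Y ^ 2 := by rw [hY]; ring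
    rw [h8] at hbd
    nlinarith [sq_nonneg (Y - ξ), sq_pos_of_pos hξ]

theorem energy_pos (h : p.IsClose) (hp : p.OnCurve) {x y : ℂ}
    (hxy : y ^ 2 = x * (x - 1) * (x - p.lam)) : 0 < p.energy x y := by
  by_cases hx : x - p.x₀ = 0
  · rw [energy_of_eq hp hxy hx]
    have h1 := h.norm_wVal hxy (by rw [hx, norm_zero]; have := rho_pos; positivity)
    have h2 : 0 < ‖p.wVal x y‖ := lt_of_le_of_lt (by have := rho_pos; positivity) h1
    positivity
  · have h1 := energy_mul hp hxy
    have h2 : 0 < ‖x - p.x₀‖ := norm_pos_iff.2 hx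
    have h3 := h.nVal_mul_conj_ne hp hxy hx
    have h4 : 0 < ‖(‖x - p.x₀‖ ^ 2 : ℂ) - p.nVal x y * (starRingEnd ℂ) (p.hVal x y)‖ :=
      norm_pos_iff.2 (sub_ne_zero.2 h3.symm)
    exact pos_of_mul_pos_right (a := ‖x - p.x₀‖ ^ 2) (by rw [h1]; positivity) (by positivity)

end IsClose

end Params

end

/-! ### The surface attached to parameters and periods -/

section

/-- The half-period values are roots of 4X³ − g₂X − g₃. Prescribing two of them gives two linear
equations for g₂ and g₃, independent because λ ≠ 1, and their solution is the shifted Legendre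
cubic. -/
theorem uniformizes_of_halfValue {L : PeriodPair} {lam : ℂ} (h0 : lam ≠ 0) (h1 : lam ≠ 1)
    (he₁ : 4 * halfValue₁ (periods L) + (1 + lam) / 3 = 1)
    (he₂ : 4 * halfValue₂ (periods L) + (1 + lam) / 3 = lam) : Uniformizes L lam := by
  refine ⟨h0, h1, fun z hz => ?_⟩
  obtain ⟨c1, c2⟩ := halfValue_cubic L
  have d1 : halfValue₁ (periods L) = (2 - lam) / 12 := by linear_combination he₁ / 4
  have d2 : halfValue₂ (periods L) = (2 * lam - 1) / 12 := by linear_combination he₂ / 4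
  rw [d1] at c1
  rw [d2] at c2
  have hne : (1 - lam) ≠ 0 := sub_ne_zero.2 h1.symm
  have hg₂ : L.g₂ = (1 - lam + lam ^ 2) / 12 := by
    refine mul_left_cancel₀ hne ?_
    linear_combination 4 * c2 - 4 * c1
  have hg₃ : L.g₃ = (2 - lam) * (2 * lam - 1) * (-1 - lam) / 432 := by
    rw [hg₂] at c1
    linear_combination -c1
  have := L.derivWeierstrassP_sq z hz
  rw [hg₂, hg₃] at this
  rw [curveX, curveY]
  linear_combination 16 * this

variable {L : PeriodPair} {p : Params}

/-- Comparing the two cubic equations leaves an affine function of ℘ that vanishes identically. Its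
derivative at ω₁/4, where ℘' ≠ 0, shows that the coefficient of ℘ is zero. -/
theorem g₂_of_uniformizes {lam : ℂ} (h : Uniformizes L lam) :
    L.g₂ = (1 - lam + lam ^ 2) / 12 := by
  have h2 : 2 * (L.ω₁ / 4) ∉ L.lattice := by
    rw [show 2 * (L.ω₁ / 4) = L.ω₁ / 2 by ring]
    exact L.ω₁_div_two_notMem_lattice
  have h1 : L.ω₁ / 4 ∉ L.lattice := fun h3 => h2 (by rw [two_mul]; exact add_mem h3 h3)
  have hne := derivWeierstrassP_ne_zero h1 h2
  set α := (1 - lam + lam ^ 2) / 12 - L.g₂ with hα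
  set β := (2 - lam) * (2 * lam - 1) * (-1 - lam) / 432 - L.g₃ with hβ
  have hzero : ∀ᶠ z in 𝓝 (L.ω₁ / 4), α * ℘[L] z + β = 0 := by
    filter_upwards [(isOpen_compl_lattice L).mem_nhds h1] with z hz
    have h3 := h.2.2 z hz
    rw [curveX, curveY, mul_pow, L.derivWeierstrassP_sq z hz] at h3
    rw [hα, hβ]
    linear_combination h3 / 16
  have hd := ((hasDerivAt_weierstrassP L h1).const_mul α).add_const β
  have h3 := hd.unique ((hasDerivAt_const (L.ω₁ / 4) (0 : ℂ)).congr_of_eventuallyEq hzero)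
  linear_combination -(mul_eq_zero.1 h3).resolve_right hne

theorem hasDerivAt_curveX (lam : ℂ) {z : ℂ} (hz : z ∉ L.lattice) :
    HasDerivAt (curveX L lam) (curveY L z) z :=
  ((hasDerivAt_weierstrassP L hz).const_mul 4).add_const _

/-- A primitive of the function `x`. -/
def primX (lam : ℂ) (w : ℂ × ℂ) (z : ℂ) : ℂ := -4 * zeta (z, w) + (1 + lam) / 3 * z

theorem hasDerivAt_primX (lam : ℂ) {z : ℂ} (hz : z ∉ L.lattice) :
    HasDerivAt (primX lam (periods L)) (curveX L lam z) z := by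
  refine (((hasDerivAt_zeta L hz).const_mul (-4)).fun_add
    ((hasDerivAt_id z).const_mul ((1 + lam) / 3))).congr_deriv ?_
  rw [curveX]; ring

namespace Params

/-- The vector of holomorphic forms whose real part is `dX / 2`, as functions on the curve. -/
def formVec (p : Params) (x y : ℂ) : Fin 4 → ℂ :=
  ![x - p.x₀ + p.wVal x y, -Complex.I * (x - p.x₀ - p.wVal x y),
    p.hVal x y - p.nVal x y, p.hVal x y + p.nVal x y]

/-- Primitives of the forms `φ h`, `ψ h`, `h`, `φ ψ h`; here `Z` is a primitive of `x`. -/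
def primP (p : Params) (Z z : ℂ) : ℂ := Z - p.x₀ * z

/-- A primitive of `ψ h`. -/
def primW (p : Params) (Z x y z : ℂ) : ℂ :=
  p.b * p.l * ((2 * y + 2 * (1 + p.lam) * Z - p.lam * z) / 3 + p.x₀ * Z + p.x₀ ^ 2 * z -
    (1 + p.lam) * (Z + p.x₀ * z) + p.lam * z) + (p.l * p.c + p.m * p.b) * x +
    (p.l * p.c - p.m * p.b) * p.y₀ * z + p.m * p.c * (Z - p.x₀ * z)

/-- A primitive of `h`. -/
def primH (p : Params) (Z x z : ℂ) : ℂ := p.b * (x - p.y₀ * z) + p.c * (Z - p.x₀ * z)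

/-- A primitive of `φ ψ h`. -/
def primN (p : Params) (Z x z : ℂ) : ℂ := p.l * (x + p.y₀ * z) + p.m * (Z - p.x₀ * z)

/-- The vector of primitives of `formVec`. -/
def primVec (p : Params) (Z x y z : ℂ) : Fin 4 → ℂ :=
  ![p.primP Z z + p.primW Z x y z, -Complex.I * (p.primP Z z - p.primW Z x y z),
    p.primH Z x z - p.primN Z x z, p.primH Z x z + p.primN Z x z]

/-- The stationary surface with given parameters and periods. -/
def surface (p : Params) (w : ℂ × ℂ) (z : ℂ) : Mink := fun i =>
  2 * (p.primVec (primX p.lam w z) (4 * wpFun (z, w) + (1 + p.lam) / 3) (4 * wpDeriv (z, w)) z i).re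

theorem surface_eq {z : ℂ} (hz : z ∉ L.lattice) : p.surface (periods L) z =
    fun i => 2 * (p.primVec (primX p.lam (periods L) z) (curveX L p.lam z) (curveY L z) z i).re := by
  unfold surface
  rw [wpFun_eq hz, wpDeriv_eq hz]
  rfl

end Params

theorem hasDerivAt_curveY {lam : ℂ} (h : Uniformizes L lam) {z : ℂ} (hz : z ∉ L.lattice) :
    HasDerivAt (curveY L) ((3 * curveX L lam z ^ 2 - 2 * (1 + lam) * curveX L lam z + lam) / 2) z := by
  refine ((hasDerivAt_derivWeierstrassP L hz).const_mul 4).congr_deriv ?_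
  rw [curveX, g₂_of_uniformizes h]
  ring

namespace Params

/-- Only the square x² in ψh needs an idea: 2y' = 3x² − 2(1 + λ)x + λ, so x² integrates to (2y + 2(1
+ λ)Z − λz)/3 with Z a primitive of x. -/
theorem hasDerivAt_primVec (h : Uniformizes L p.lam) {z : ℂ} (hz : z ∉ L.lattice) (i : Fin 4) :
    HasDerivAt (fun z => p.primVec (primX p.lam (periods L) z) (curveX L p.lam z) (curveY L z) z i)
      (p.formVec (curveX L p.lam z) (curveY L z) i) z := by
  have hZ := hasDerivAt_primX p.lam hz
  have hx := hasDerivAt_curveX p.lam hz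
  have hy := hasDerivAt_curveY h hz
  have hid := hasDerivAt_id' z
  have hP : HasDerivAt (fun z => p.primP (primX p.lam (periods L) z) z)
      (curveX L p.lam z - p.x₀) z := by
    simpa using! hZ.fun_sub (hid.const_mul p.x₀)
  have hW : HasDerivAt (fun z => p.primW (primX p.lam (periods L) z) (curveX L p.lam z)
      (curveY L z) z) (p.wVal (curveX L p.lam z) (curveY L z)) z := by
    refine ((((((((((hy.const_mul 2).fun_add (hZ.const_mul (2 * (1 + p.lam)))).fun_sub
      (hid.const_mul p.lam)).div_const 3).fun_add (hZ.const_mul p.x₀)).fun_add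
      (hid.const_mul (p.x₀ ^ 2))).fun_sub ((hZ.fun_add (hid.const_mul p.x₀)).const_mul
      (1 + p.lam))).fun_add (hid.const_mul p.lam)).const_mul (p.b * p.l)).fun_add
      (hx.const_mul (p.l * p.c + p.m * p.b)) |>.fun_add
      (hid.const_mul ((p.l * p.c - p.m * p.b) * p.y₀)) |>.fun_add
      ((hZ.fun_sub (hid.const_mul p.x₀)).const_mul (p.m * p.c))).congr_deriv ?_
    rw [wVal]
    ring
  have hH : HasDerivAt (fun z => p.primH (primX p.lam (periods L) z) (curveX L p.lam z) z)
      (p.hVal (curveX L p.lam z) (curveY L z)) z := by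
    refine (((hx.fun_sub (hid.const_mul p.y₀)).const_mul p.b).fun_add
      ((hZ.fun_sub (hid.const_mul p.x₀)).const_mul p.c)).congr_deriv ?_
    rw [hVal]
    ring
  have hN : HasDerivAt (fun z => p.primN (primX p.lam (periods L) z) (curveX L p.lam z) z)
      (p.nVal (curveX L p.lam z) (curveY L z)) z := by
    refine (((hx.fun_add (hid.const_mul p.y₀)).const_mul p.l).fun_add
      ((hZ.fun_sub (hid.const_mul p.x₀)).const_mul p.m)).congr_deriv ?_
    rw [nVal]
    ring
  fin_cases i
  · exact hP.fun_add hW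
  · exact (hP.fun_sub hW).const_mul (-Complex.I)
  · exact hH.fun_sub hN
  · exact hH.fun_add hN

theorem hasDerivAt_formVec (h : Uniformizes L p.lam) {z : ℂ} (hz : z ∉ L.lattice) (i : Fin 4) :
    DifferentiableAt ℂ (fun z => p.formVec (curveX L p.lam z) (curveY L z) i) z := by
  have hx := (hasDerivAt_curveX p.lam hz).differentiableAt
  have hy := (hasDerivAt_curveY h hz).differentiableAt
  fin_cases i <;> simp only [formVec, wVal, hVal, nVal, Matrix.cons_val, Fin.reduceFinMk,
    Fin.zero_eta, Fin.mk_one] <;> fun_prop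

theorem fderiv_surface (h : Uniformizes L p.lam) {z : ℂ} (hz : z ∉ L.lattice) (a : ℂ) (i : Fin 4) :
    fderiv ℝ (p.surface (periods L)) z a i =
      2 * (p.formVec (curveX L p.lam z) (curveY L z) i * a).re := by
  have h1 : HasFDerivAt (p.surface (periods L)) (ContinuousLinearMap.pi fun i =>
      (2 : ℝ) • Complex.reCLM.comp ((ContinuousLinearMap.toSpanSingleton ℂ
        (p.formVec (curveX L p.lam z) (curveY L z) i)).restrictScalars ℝ)) z := by
    have h2 : HasFDerivAt (fun z i => 2 * (p.primVec (primX p.lam (periods L) z) (curveX L p.lam z)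
        (curveY L z) z i).re) (ContinuousLinearMap.pi fun i =>
      (2 : ℝ) • Complex.reCLM.comp ((ContinuousLinearMap.toSpanSingleton ℂ
        (p.formVec (curveX L p.lam z) (curveY L z) i)).restrictScalars ℝ)) z := by
      rw [hasFDerivAt_pi]
      intro i
      exact (Complex.reCLM.hasFDerivAt.comp z
        ((p.hasDerivAt_primVec h hz i).hasFDerivAt.restrictScalars ℝ)).const_smul (2 : ℝ)
    refine h2.congr_of_eventuallyEq ?_
    filter_upwards [(isOpen_compl_lattice L).mem_nhds hz] with z' hz'
    exact surface_eq hz'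
  rw [h1.fderiv]
  simp [mul_comm]

/-- The squared conformal factor of the surface. -/
def density (p : Params) (L : PeriodPair) (z : ℂ) : ℝ :=
  4 * p.energy (curveX L p.lam z) (curveY L z)

/-- The sum of squares with Lorentz signs of the holomorphic form is 4PW − 4HN = 0. The null
condition leaves only the Hermitian part, a multiple of the Euclidean metric. -/
theorem inducedMetric_surface (hp : p.OnCurve) (h : Uniformizes L p.lam) {z : ℂ}
    (hz : z ∉ L.lattice) (a b : ℂ) :
    inducedMetric (p.surface (periods L)) z a b = p.density L z * (a * (starRingEnd ℂ) b).re := by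
  have h1 := p.mul_wVal hp (h.2.2 z hz)
  simp only [inducedMetric, lorentz, fderiv_surface h hz, formVec, Matrix.cons_val, density, energy,
    Complex.sq_norm, Complex.normSq_apply]
  generalize p.wVal _ _ = W at *
  generalize p.hVal _ _ = H at *
  generalize p.nVal _ _ = N at *
  generalize curveX L p.lam z - p.x₀ = P at *
  obtain ⟨h2, h3⟩ := Complex.ext_iff.1 h1
  simp only [Complex.mul_re, Complex.mul_im, Complex.add_re, Complex.sub_re, Complex.neg_re,
    Complex.add_im, Complex.sub_im, Complex.neg_im, Complex.I_re, Complex.I_im, Complex.conj_re,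
    Complex.conj_im] at *
  linear_combination (8 * (a.re * b.re - a.im * b.im)) * h2 - 8 * (a.re * b.im + a.im * b.re) * h3

theorem inducedMetric_surface_self (hp : p.OnCurve) (h : Uniformizes L p.lam) {z : ℂ}
    (hz : z ∉ L.lattice) (a : ℂ) :
    inducedMetric (p.surface (periods L)) z a a = p.density L z * ‖a‖ ^ 2 := by
  rw [inducedMetric_surface hp h hz, Complex.mul_conj, Complex.ofReal_re, Complex.normSq_eq_norm_sq]

theorem contDiffOn_primVec (h : Uniformizes L p.lam) (i : Fin 4) : ContDiffOn ℂ ∞ (fun z =>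
    p.primVec (primX p.lam (periods L) z) (curveX L p.lam z) (curveY L z) z i)
    (L.lattice : Set ℂ)ᶜ :=
  contDiffOn_of_differentiableOn (isOpen_compl_lattice L) fun _ hz =>
    (p.hasDerivAt_primVec h hz i).differentiableAt.differentiableWithinAt

theorem contDiffOn_surface (h : Uniformizes L p.lam) :
    ContDiffOn ℝ ∞ (p.surface (periods L)) (L.lattice : Set ℂ)ᶜ := by
  have h1 : ContDiffOn ℝ ∞ (fun z i => 2 * (p.primVec (primX p.lam (periods L) z)
      (curveX L p.lam z) (curveY L z) z i).re) (L.lattice : Set ℂ)ᶜ := by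
    rw [contDiffOn_pi]
    intro i
    exact contDiffOn_const.mul (Complex.reCLM.contDiff.comp_contDiffOn
      ((p.contDiffOn_primVec h i).restrict_scalars ℝ))
  exact h1.congr fun z hz => surface_eq hz

theorem laplace_surface (h : Uniformizes L p.lam) {z : ℂ} (hz : z ∉ L.lattice) :
    fderiv ℝ (fun w => fderiv ℝ (p.surface (periods L)) w Complex.I) z Complex.I =
      -fderiv ℝ (fun w => fderiv ℝ (p.surface (periods L)) w 1) z 1 := by
  have key : ∀ a : ℂ, fderiv ℝ (fun w => fderiv ℝ (p.surface (periods L)) w a) z a = fun i =>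
      2 * (deriv (fun z => p.formVec (curveX L p.lam z) (curveY L z) i) z * a * a).re := by
    intro a
    have h1 : HasFDerivAt (fun w i => 2 * (p.formVec (curveX L p.lam w) (curveY L w) i * a).re)
        (ContinuousLinearMap.pi fun i => (2 : ℝ) • Complex.reCLM.comp
          ((ContinuousLinearMap.toSpanSingleton ℂ (deriv (fun z => p.formVec (curveX L p.lam z)
            (curveY L z) i) z * a)).restrictScalars ℝ)) z := by
      rw [hasFDerivAt_pi]
      intro i
      exact (Complex.reCLM.hasFDerivAt.comp z (((p.hasDerivAt_formVec h hz i).hasDerivAt.mul_const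
        a).hasFDerivAt.restrictScalars ℝ)).const_smul (2 : ℝ)
    have h2 : (fun w => fderiv ℝ (p.surface (periods L)) w a) =ᶠ[𝓝 z]
        fun w i => 2 * (p.formVec (curveX L p.lam w) (curveY L w) i * a).re := by
      filter_upwards [(isOpen_compl_lattice L).mem_nhds hz] with w hw
      ext i
      exact fderiv_surface h hw a i
    rw [h2.fderiv_eq, h1.fderiv]
    ext i
    simp [mul_comm]
  rw [key, key]
  ext i
  simp [mul_assoc]

/-- In conformal coordinates the mean curvature vector is proportional to the normal part of the
Laplacian, and the coordinates are harmonic. -/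
theorem meanCurvature_surface (hp : p.OnCurve) (h : Uniformizes L p.lam) {z : ℂ}
    (hz : z ∉ L.lattice) : meanCurvature (p.surface (periods L)) z = 0 := by
  have hneg : ∀ w : Mink, normalPart (p.surface (periods L)) z (-w) =
      -normalPart (p.surface (periods L)) z w := by
    intro w
    have h1 : ∀ u : Mink, lorentz (-w) u = -lorentz w u := fun u => by
      simp [lorentz]; ring
    simp only [normalPart, h1]
    ext i
    simp
    ring
  have hII : secondFundamentalForm (p.surface (periods L)) z Complex.I Complex.I =
      -secondFundamentalForm (p.surface (periods L)) z 1 1 := by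
    rw [secondFundamentalForm, laplace_surface h hz, hneg]
    rfl
  simp only [meanCurvature, hII, inducedMetric_surface hp h hz]
  simp

/-- The quasi-periods of the primitives are compatible with a single valued real part. -/
def PeriodCondition (p : Params) (w : ℂ × ℂ) : Prop :=
  (∀ X q, X = quasiX₁ p.lam w ∧ q = w.1 ∨ X = quasiX₂ p.lam w ∧ q = w.2 →
    quasiP p.x₀ X q + (starRingEnd ℂ) (quasiW p.b p.c p.l p.m p.x₀ p.y₀ p.lam X q) = 0 ∧
    (quasiH p.b p.c p.x₀ p.y₀ X q).re = 0 ∧ (quasiN p.l p.m p.x₀ p.y₀ X q).re = 0)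

/-- Along a period the first two coordinates change by twice Re(P + W) and Im(P − W), which vanish
together when P + conj W = 0; the last two change by twice Re(H ∓ N). -/
theorem periodic_surface (hper : p.PeriodCondition (periods L)) :
    ∀ z, z ∉ L.lattice → ∀ l ∈ L.lattice,
      p.surface (periods L) (z + l) = p.surface (periods L) z := by
  have key : ∀ X q : ℂ, X = quasiX₁ p.lam (periods L) ∧ q = L.ω₁ ∨
      X = quasiX₂ p.lam (periods L) ∧ q = L.ω₂ → q ∈ L.lattice → (∀ z, z ∉ L.lattice →
      primX p.lam (periods L) (z + q) = primX p.lam (periods L) z + X) → ∀ z, z ∉ L.lattice →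
      p.surface (periods L) (z + q) = p.surface (periods L) z := by
    intro X q hX hq hadd z hz
    have hz' : z + q ∉ L.lattice := by rwa [add_mem_lattice_iff hq]
    obtain ⟨h1, h2, h3⟩ := hper X q hX
    rw [surface_eq hz, surface_eq hz', hadd z hz, curveX, curveX, curveY, curveY,
      L.weierstrassP_add_coe z ⟨q, hq⟩, L.derivWeierstrassP_add_coe z ⟨q, hq⟩]
    change (fun i => 2 * (p.primVec _ (curveX L p.lam z) (curveY L z) _ i).re) = fun i =>
      2 * (p.primVec _ (curveX L p.lam z) (curveY L z) _ i).re
    generalize curveX L p.lam z = x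
    generalize curveY L z = y
    generalize primX p.lam (periods L) z = Z
    have eP : p.primP (Z + X) (z + q) = p.primP Z z + quasiP p.x₀ X q := by
      simp only [primP, quasiP]; ring
    have eW : p.primW (Z + X) x y (z + q) = p.primW Z x y z +
        quasiW p.b p.c p.l p.m p.x₀ p.y₀ p.lam X q := by
      simp only [primW, quasiW]; ring
    have eH : p.primH (Z + X) x (z + q) = p.primH Z x z + quasiH p.b p.c p.x₀ p.y₀ X q := by
      simp only [primH, quasiH]; ring
    have eN : p.primN (Z + X) x (z + q) = p.primN Z x z + quasiN p.l p.m p.x₀ p.y₀ X q := by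
      simp only [primN, quasiN]; ring
    simp only [primVec, eP, eW, eH, eN]
    obtain ⟨h4, h5⟩ := Complex.ext_iff.1 h1
    simp at h4 h5
    ext i
    fin_cases i <;> simp <;> linarith
  refine periodic_of_generators (key _ _ (Or.inl ⟨rfl, rfl⟩) L.ω₁_mem_lattice fun z hz => ?_)
    (key _ _ (Or.inr ⟨rfl, rfl⟩) L.ω₂_mem_lattice fun z hz => ?_)
  · rw [primX, zeta_add_ω₁ L hz, primX, quasiX₁]
    simp only [periods]
    ring
  · rw [primX, zeta_add_ω₂ L hz, primX, quasiX₂]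
    simp only [periods]
    ring

end Params

end

section

/-! ### The Weierstrass data on the compact torus -/

variable {L : PeriodPair} {p : Params}

/-- The regular part of the function `x` at the end: `z² x = endX z`. -/
def endX (L : PeriodPair) (lam z : ℂ) : ℂ := 4 + z ^ 2 * (4 * L.weierstrassPExcept 0 z + (1 + lam) / 3)

/-- The regular part of the function `y` at the end: `z³ y = endY z`. -/
def endY (L : PeriodPair) (z : ℂ) : ℂ := -8 + 4 * z ^ 3 * L.derivWeierstrassPExcept 0 z

theorem sq_mul_curveX (L : PeriodPair) (lam : ℂ) {z : ℂ} (hz : z ≠ 0) :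
    z ^ 2 * curveX L lam z = endX L lam z := by
  rw [curveX, endX, weierstrassP_eq]
  field_simp
  ring

theorem pow_mul_curveY (L : PeriodPair) {z : ℂ} (hz : z ≠ 0) :
    z ^ 3 * curveY L z = endY L z := by
  rw [curveY, endY, derivWeierstrassP_eq]
  field_simp
  ring

theorem analyticOnNhd_endX (L : PeriodPair) (lam : ℂ) :
    AnalyticOnNhd ℂ (endX L lam) ((L.lattice : Set ℂ) \ {0})ᶜ := by
  intro z hz
  have := L.analyticOnNhd_weierstrassPExcept 0 z hz
  unfold endX
  fun_prop

theorem analyticOnNhd_endY (L : PeriodPair) :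
    AnalyticOnNhd ℂ (endY L) ((L.lattice : Set ℂ) \ {0})ᶜ := by
  intro z hz
  have := L.analyticOnNhd_derivWeierstrassPExcept 0 z hz
  unfold endY
  fun_prop

theorem zero_mem_compl_lattice_sdiff (L : PeriodPair) : (0 : ℂ) ∈ ((L.lattice : Set ℂ) \ {0})ᶜ := by
  simp

@[simp] theorem endX_zero (L : PeriodPair) (lam : ℂ) : endX L lam 0 = 4 := by simp [endX]

@[simp] theorem endY_zero (L : PeriodPair) : endY L 0 = -8 := by simp [endY]

theorem meromorphic_curveX (L : PeriodPair) (lam : ℂ) : Meromorphic (curveX L lam) := by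
  intro z
  have := L.meromorphic_weierstrassP z
  unfold curveX
  fun_prop

theorem meromorphic_curveY (L : PeriodPair) : Meromorphic (curveY L) := by
  intro z
  have := L.meromorphic_derivWeierstrassP z
  unfold curveY
  fun_prop

theorem curveX_add (L : PeriodPair) (lam : ℂ) {l : ℂ} (hl : l ∈ L.lattice) (z : ℂ) :
    curveX L lam (z + l) = curveX L lam z := by
  rw [curveX, L.weierstrassP_add_coe z ⟨l, hl⟩, curveX]

theorem curveY_add (L : PeriodPair) {l : ℂ} (hl : l ∈ L.lattice) (z : ℂ) :
    curveY L (z + l) = curveY L z := by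
  rw [curveY, L.derivWeierstrassP_add_coe z ⟨l, hl⟩, curveY]

/-- A function with a pole or zero of finite order at the end vanishes identically near no point. -/
theorem meromorphicOrderAt_ne_top {f : ℂ → ℂ} (hf : Meromorphic f) {n : ℤ}
    (h0 : meromorphicOrderAt f 0 = n) (z : ℂ) : meromorphicOrderAt f z ≠ ⊤ := by
  refine MeromorphicOn.meromorphicOrderAt_ne_top_of_isPreconnected (U := univ) (x := 0)
    (fun z _ => hf z) isPreconnected_univ (mem_univ _) (mem_univ _) ?_
  rw [h0]
  exact WithTop.coe_ne_top

/-- The behaviour of `u / h` and `n / u` where `u` has no zero. -/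
theorem order_div {u h n : ℂ → ℂ} {z : ℂ} (hu : AnalyticAt ℂ u z) (hu0 : u z ≠ 0)
    (hh : AnalyticAt ℂ h z) (hn : AnalyticAt ℂ n z) (hh' : meromorphicOrderAt h z ≠ ⊤) :
    0 ≤ meromorphicOrderAt (fun w => n w / u w) z ∧
      Tendsto (fun w => n w / u w) (𝓝[≠] z) (𝓝 (n z / u z)) ∧
      (h z ≠ 0 → 0 ≤ meromorphicOrderAt (fun w => u w / h w) z ∧
        Tendsto (fun w => u w / h w) (𝓝[≠] z) (𝓝 (u z / h z))) ∧
      (h z = 0 → meromorphicOrderAt (fun w => u w / h w) z < 0) ∧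
      meromorphicOrderAt h z + min 0 (min (meromorphicOrderAt (fun w => u w / h w) z)
        (meromorphicOrderAt (fun w => n w / u w) z)) = 0 := by
  have h1 : AnalyticAt ℂ (fun w => n w / u w) z := hn.fun_div hu hu0
  have h2 := h1.meromorphicOrderAt_nonneg
  have hu1 : meromorphicOrderAt u z = 0 := by
    rw [← tendsto_ne_zero_iff_meromorphicOrderAt_eq_zero hu.meromorphicAt]
    exact ⟨u z, hu0, hu.continuousAt.continuousWithinAt⟩
  have h3 : meromorphicOrderAt (fun w => u w / h w) z = -meromorphicOrderAt h z := by
    have : (fun w => u w / h w) = u * h⁻¹ := by ext w; simp [div_eq_mul_inv]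
    rw [this, meromorphicOrderAt_mul hu.meromorphicAt hh.meromorphicAt.inv, hu1, zero_add,
      meromorphicOrderAt_inv]
  have h4 := hh.meromorphicOrderAt_nonneg
  obtain ⟨k, hk⟩ := WithTop.ne_top_iff_exists.1 hh'
  rw [← hk] at h3 h4 ⊢
  have hk0 : 0 ≤ k := by exact_mod_cast h4
  have h3' : meromorphicOrderAt (fun w => u w / h w) z = ((-k : ℤ) : WithTop ℤ) := h3
  refine ⟨h2, h1.continuousAt.continuousWithinAt, fun hz => ?_, fun hz => ?_, ?_⟩
  · have h5 : AnalyticAt ℂ (fun w => u w / h w) z := hu.fun_div hh hz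
    exact ⟨h5.meromorphicOrderAt_nonneg, h5.continuousAt.continuousWithinAt⟩
  · have h5 : 0 < meromorphicOrderAt h z := by
      rw [← tendsto_zero_iff_meromorphicOrderAt_pos hh.meromorphicAt]
      have := hh.continuousAt.continuousWithinAt (s := {z}ᶜ)
      rwa [ContinuousWithinAt, hz] at this
    rw [← hk] at h5
    have h6 : 0 < k := by exact_mod_cast h5
    rw [h3']
    have : -k < 0 := by omega
    exact_mod_cast this
  · have h5 : min (meromorphicOrderAt (fun w => u w / h w) z)
        (meromorphicOrderAt (fun w => n w / u w) z) = ((-k : ℤ) : WithTop ℤ) := by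
      rw [h3']
      refine min_eq_left (le_trans ?_ h2)
      have : -k ≤ 0 := by omega
      exact_mod_cast this
    rw [h5]
    have h6 : min (0 : WithTop ℤ) ((-k : ℤ) : WithTop ℤ) = ((-k : ℤ) : WithTop ℤ) := by
      refine min_eq_right ?_
      have : -k ≤ 0 := by omega
      exact_mod_cast this
    rw [h6, ← WithTop.coe_add, add_neg_cancel]
    rfl

theorem sphereValue_of_neg {f : ℂ → ℂ} {z : ℂ} (h : meromorphicOrderAt f z < 0) :
    sphereValue f z = OnePoint.infty := by
  rw [sphereValue, if_pos h]

theorem sphereValue_of_tendsto {f : ℂ → ℂ} {z a : ℂ} (h : 0 ≤ meromorphicOrderAt f z)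
    (ha : Tendsto f (𝓝[≠] z) (𝓝 a)) : sphereValue f z = (a : OnePoint ℂ) := by
  rw [sphereValue, if_neg (not_lt.2 h), ha.limUnder_eq]

theorem sphereValue_ne_of_neg {f g : ℂ → ℂ} {z : ℂ} (hf : meromorphicOrderAt f z < 0)
    (hg : 0 ≤ meromorphicOrderAt g z) : sphereValue f z ≠ sphereConj (sphereValue g z) ∧
      sphereValue g z ≠ sphereConj (sphereValue f z) := by
  rw [sphereValue_of_neg hf, sphereValue, if_neg (not_lt.2 hg)]
  constructor
  · exact OnePoint.infty_ne_coe _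
  · exact OnePoint.coe_ne_infty _

theorem sphereValue_ne_of_tendsto {f g : ℂ → ℂ} {z a b : ℂ} (hf : 0 ≤ meromorphicOrderAt f z)
    (hg : 0 ≤ meromorphicOrderAt g z) (ha : Tendsto f (𝓝[≠] z) (𝓝 a))
    (hb : Tendsto g (𝓝[≠] z) (𝓝 b)) (hab : a ≠ (starRingEnd ℂ) b) :
    sphereValue f z ≠ sphereConj (sphereValue g z) := by
  rw [sphereValue_of_tendsto hf ha, sphereValue_of_tendsto hg hb]
  exact fun h => hab (OnePoint.coe_injective h)

namespace Params

/-- The function `x - x₀` on the torus. -/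
def xiFun (p : Params) (L : PeriodPair) (z : ℂ) : ℂ := curveX L p.lam z - p.x₀

/-- The function `φ ψ h` on the torus. -/
def nFun (p : Params) (L : PeriodPair) (z : ℂ) : ℂ := p.nVal (curveX L p.lam z) (curveY L z)

/-- The function `ψ h` on the torus. -/
def wFun (p : Params) (L : PeriodPair) (z : ℂ) : ℂ := p.wVal (curveX L p.lam z) (curveY L z)

theorem phi_eq : p.phi L = fun z => p.xiFun L z / p.height L z := rfl

theorem psi_eq : p.psi L = fun z => p.nFun L z / p.xiFun L z := rfl

theorem meromorphic_xiFun : Meromorphic (p.xiFun L) := by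
  intro z
  have := meromorphic_curveX L p.lam z
  unfold xiFun
  fun_prop

theorem meromorphic_height : Meromorphic (p.height L) := by
  intro z
  have := meromorphic_curveX L p.lam z
  have := meromorphic_curveY L z
  unfold height
  fun_prop

theorem meromorphic_nFun : Meromorphic (p.nFun L) := by
  intro z
  have := meromorphic_curveX L p.lam z
  have := meromorphic_curveY L z
  unfold nFun nVal
  fun_prop

theorem analyticAt_funs {z : ℂ} (hz : z ∉ L.lattice) : AnalyticAt ℂ (p.xiFun L) z ∧
    AnalyticAt ℂ (p.height L) z ∧ AnalyticAt ℂ (p.nFun L) z ∧ AnalyticAt ℂ (p.wFun L) z := by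
  have hx : AnalyticAt ℂ (curveX L p.lam) z := by
    have := L.analyticOnNhd_weierstrassP z hz
    unfold curveX
    fun_prop
  have hy : AnalyticAt ℂ (curveY L) z := by
    have := L.analyticOnNhd_derivWeierstrassP z hz
    unfold curveY
    fun_prop
  refine ⟨?_, ?_, ?_, ?_⟩
  · unfold xiFun; fun_prop
  · unfold height; fun_prop
  · unfold nFun nVal; fun_prop
  · unfold wFun wVal; fun_prop

theorem order_xiFun : meromorphicOrderAt (p.xiFun L) 0 = (-2 : ℤ) := by
  rw [meromorphicOrderAt_eq_int_iff (meromorphic_xiFun 0)]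
  have hX := analyticOnNhd_endX L p.lam 0 (zero_mem_compl_lattice_sdiff L)
  refine ⟨fun z => endX L p.lam z - p.x₀ * z ^ 2, by fun_prop, by simp, ?_⟩
  filter_upwards [self_mem_nhdsWithin] with z hz
  have hz0 : z ≠ 0 := hz
  simp only [sub_zero, smul_eq_mul, ← sq_mul_curveX L p.lam hz0, xiFun, zpow_neg]
  rw [show z ^ (2 : ℤ) = z ^ 2 by norm_cast]
  field_simp

theorem order_cubic {b c y₀ : ℂ} (hb : b ≠ 0) : meromorphicOrderAt
    (fun z => b * (curveY L z + y₀) + c * (curveX L p.lam z - p.x₀)) 0 = (-3 : ℤ) := by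
  have h1 : MeromorphicAt (fun z => b * (curveY L z + y₀) + c * (curveX L p.lam z - p.x₀)) 0 := by
    have := meromorphic_curveX L p.lam 0
    have := meromorphic_curveY L 0
    fun_prop
  rw [meromorphicOrderAt_eq_int_iff h1]
  have hX := analyticOnNhd_endX L p.lam 0 (zero_mem_compl_lattice_sdiff L)
  have hY := analyticOnNhd_endY L 0 (zero_mem_compl_lattice_sdiff L)
  refine ⟨fun z => b * (endY L z + y₀ * z ^ 3) + c * z * (endX L p.lam z - p.x₀ * z ^ 2),
    by fun_prop, by simp [hb], ?_⟩
  filter_upwards [self_mem_nhdsWithin] with z hz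
  have hz0 : z ≠ 0 := hz
  simp only [sub_zero, smul_eq_mul, ← sq_mul_curveX L p.lam hz0, ← pow_mul_curveY L hz0, zpow_neg]
  rw [show z ^ (3 : ℤ) = z ^ 3 by norm_cast]
  field_simp

theorem order_height (hb : p.b ≠ 0) : meromorphicOrderAt (p.height L) 0 = (-3 : ℤ) := by
  have := order_cubic (L := L) (p := p) (c := p.c) (y₀ := -p.y₀) hb
  simpa only [← sub_eq_add_neg] using! this

theorem order_nFun (hl : p.l ≠ 0) : meromorphicOrderAt (p.nFun L) 0 = (-3 : ℤ) :=
  order_cubic hl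

theorem order_phi (hb : p.b ≠ 0) : meromorphicOrderAt (p.phi L) 0 = 1 := by
  have : p.phi L = p.xiFun L * (p.height L)⁻¹ := by
    ext z; simp [phi_eq, div_eq_mul_inv]
  rw [this, meromorphicOrderAt_mul (meromorphic_xiFun 0) (meromorphic_height 0).inv,
    meromorphicOrderAt_inv, order_xiFun, order_height hb]
  rfl

theorem order_psi (hl : p.l ≠ 0) : meromorphicOrderAt (p.psi L) 0 = -1 := by
  have : p.psi L = p.nFun L * (p.xiFun L)⁻¹ := by
    ext z; simp [psi_eq, div_eq_mul_inv]
  rw [this, meromorphicOrderAt_mul (meromorphic_nFun 0) (meromorphic_xiFun 0).inv,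
    meromorphicOrderAt_inv, order_xiFun, order_nFun hl]
  rfl

/-- Near a point of `M` the Gauss maps are `u / h` and `N / u` for a function `u` without zeros, in
one order or the other. -/
theorem gaussMaps_local (hp : p.OnCurve) (hU : Uniformizes L p.lam) (hb : p.b ≠ 0)
    (hE : ∀ z, z ∉ L.lattice → 0 < p.density L z) {z : ℂ} (hz : z ∉ L.lattice) :
    ∃ u : ℂ → ℂ, AnalyticAt ℂ u z ∧ u z ≠ 0 ∧
      ((p.phi L =ᶠ[𝓝[≠] z] fun w => u w / p.height L w) ∧
        (p.psi L =ᶠ[𝓝[≠] z] fun w => p.nFun L w / u w) ∨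
      (p.psi L =ᶠ[𝓝[≠] z] fun w => u w / p.height L w) ∧
        (p.phi L =ᶠ[𝓝[≠] z] fun w => p.nFun L w / u w)) ∧
      (p.height L z ≠ 0 → u z / p.height L z ≠ (starRingEnd ℂ) (p.nFun L z / u z)) := by
  obtain ⟨h1, h2, h3, h4⟩ := analyticAt_funs (p := p) hz
  have hmul : ∀ w, w ∉ L.lattice → p.xiFun L w * p.wFun L w = p.height L w * p.nFun L w :=
    fun w hw => mul_wVal hp (hU.2.2 w hw)
  have hpos := hE z hz
  rw [density] at hpos
  -- Where x = x₀ the relation PW = HN gives ψ = W/H and φ = N/W, and W ≠ 0 because the density is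
  -- positive. Elsewhere u = P serves directly in φ = P/H and ψ = N/P.
  by_cases hx : p.xiFun L z = 0
  · have hen := energy_of_eq hp (hU.2.2 z hz) hx
    have hW : p.wFun L z ≠ 0 := by
      intro h0
      rw [hen, show p.wVal _ _ = 0 from h0] at hpos
      simp at hpos
    have hne1 := (meromorphicOrderAt_ne_top_iff_eventually_ne_zero (meromorphic_xiFun z)).1
      (meromorphicOrderAt_ne_top (meromorphic_xiFun (p := p) (L := L)) order_xiFun z)
    have hne2 := (meromorphicOrderAt_ne_top_iff_eventually_ne_zero (meromorphic_height z)).1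
      (meromorphicOrderAt_ne_top (meromorphic_height (p := p) (L := L)) (order_height hb) z)
    have hne3 : ∀ᶠ w in 𝓝[≠] z, p.wFun L w ≠ 0 :=
      (h4.continuousAt.eventually_ne hW).filter_mono nhdsWithin_le_nhds
    have hne4 : ∀ᶠ w in 𝓝[≠] z, w ∉ L.lattice :=
      Filter.Eventually.filter_mono nhdsWithin_le_nhds ((isOpen_compl_lattice L).mem_nhds hz)
    refine ⟨p.wFun L, h4, hW, Or.inr ⟨?_, ?_⟩, fun hh heq => ?_⟩
    · filter_upwards [hne1, hne2, hne4] with w e1 e2 e4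
      rw [psi_eq]
      have := hmul w e4
      field_simp
      linear_combination -this
    · filter_upwards [hne2, hne3, hne4] with w e2 e3 e4
      rw [phi_eq]
      have := hmul w e4
      field_simp
      linear_combination this
    · have h5 := hmul z hz
      rw [hx, zero_mul] at h5
      rw [(mul_eq_zero.1 h5.symm).resolve_left hh] at heq
      simp [hW, hh] at heq
  · refine ⟨p.xiFun L, h1, hx, Or.inl ⟨Eventually.of_forall fun w => rfl,
      Eventually.of_forall fun w => rfl⟩, fun hh heq => ?_⟩
    have hen := energy_mul hp (hU.2.2 z hz)
    have h5 : 0 < ‖p.xiFun L z‖ := norm_pos_iff.2 hx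
    have h6 : p.nFun L z * (starRingEnd ℂ) (p.height L z) = (‖p.xiFun L z‖ ^ 2 : ℂ) := by
      have h7 := congrArg (starRingEnd ℂ) heq
      rw [Complex.conj_conj, map_div₀] at h7
      have h8 : (starRingEnd ℂ) (p.height L z) ≠ 0 := (map_ne_zero _).2 hh
      rw [div_eq_div_iff h8 hx] at h7
      rw [← h7, mul_comm, Complex.mul_conj']
    have h9 : ‖curveX L p.lam z - p.x₀‖ ^ 2 * p.energy (curveX L p.lam z) (curveY L z) = 0 := by
      rw [hen]
      change ‖(‖p.xiFun L z‖ ^ 2 : ℂ) - p.nFun L z * (starRingEnd ℂ) (p.height L z)‖ ^ 2 = 0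
      rw [h6]
      simp
    have h10 : 0 < ‖curveX L p.lam z - p.x₀‖ ^ 2 * p.energy (curveX L p.lam z) (curveY L z) :=
      mul_pos (pow_pos h5 2) (by linarith)
    linarith

/-- On M regularity is positivity of the density, read through the local normal form of the Gauss
maps. At the end it is automatic: φ vanishes and ψ has a pole. -/
theorem isAlgebraicRepresentation (hp : p.OnCurve) (hU : Uniformizes L p.lam) (hb : p.b ≠ 0)
    (hl : p.l ≠ 0) (hE : ∀ z, z ∉ L.lattice → 0 < p.density L z)
    (hper : p.PeriodCondition (periods L)) :
    IsAlgebraicRepresentation L (p.phi L) (p.psi L) (p.height L) (p.surface (periods L)) where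
  elliptic_phi := by
    refine ⟨fun z => (meromorphic_xiFun z).fun_div (meromorphic_height z), fun l hl z => ?_⟩
    simp only [phi, curveX_add L _ hl, curveY_add L hl]
  elliptic_psi := by
    refine ⟨fun z => (meromorphic_nFun z).fun_div (meromorphic_xiFun z), fun l hl z => ?_⟩
    simp only [psi, curveX_add L _ hl, curveY_add L hl]
  elliptic_h := by
    refine ⟨meromorphic_height, fun l hl z => ?_⟩
    simp only [height, curveX_add L _ hl, curveY_add L hl]
  regular := by
    intro z
    by_cases hz : z ∈ L.lattice
    · have h1 : ∀ f : ℂ → ℂ, (∀ w, f (w + z) = f w) →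
          meromorphicOrderAt f z = meromorphicOrderAt f 0 := by
        intro f hf
        have h2 := meromorphicOrderAt_comp_add_const_eq_meromorphicOrderAt (x := 0) (c := z) (f := f)
        rw [zero_add] at h2
        rw [← h2]
        exact congrArg (fun g => meromorphicOrderAt g 0) (funext hf)
      refine (sphereValue_ne_of_neg (f := p.psi L) (g := p.phi L) ?_ ?_).2
      · rw [h1 _ fun w => by simp only [psi, curveX_add L _ hz, curveY_add L hz], order_psi hl]
        decide
      · rw [h1 _ fun w => by simp only [phi, curveX_add L _ hz, curveY_add L hz], order_phi hb]
        decide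
    · obtain ⟨u, hu, hu0, hloc, hreg⟩ := gaussMaps_local hp hU hb hE hz
      obtain ⟨-, a2, a3, -⟩ := analyticAt_funs (p := p) hz
      obtain ⟨d1, d2, d3, d4, -⟩ := order_div hu hu0 a2 a3
        (meromorphicOrderAt_ne_top meromorphic_height (order_height hb) z)
      rcases hloc with ⟨hφ, hψ⟩ | ⟨hψ, hφ⟩
      · rw [← meromorphicOrderAt_congr hψ] at d1
        rw [← meromorphicOrderAt_congr hφ, ← tendsto_congr' hφ] at d3
        rw [← meromorphicOrderAt_congr hφ] at d4
        rw [← tendsto_congr' hψ] at d2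
        by_cases hh : p.height L z = 0
        · exact (sphereValue_ne_of_neg (d4 hh) d1).1
        · exact sphereValue_ne_of_tendsto (d3 hh).1 d1 (d3 hh).2 d2 (hreg hh)
      · rw [← meromorphicOrderAt_congr hφ] at d1
        rw [← meromorphicOrderAt_congr hψ, ← tendsto_congr' hψ] at d3
        rw [← meromorphicOrderAt_congr hψ] at d4
        rw [← tendsto_congr' hφ] at d2
        by_cases hh : p.height L z = 0
        · exact (sphereValue_ne_of_neg (d4 hh) d1).2
        · refine sphereValue_ne_of_tendsto d1 (d3 hh).1 d2 (d3 hh).2 fun heq => hreg hh ?_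
          rw [heq, Complex.conj_conj]
  zeros := by
    intro z hz
    obtain ⟨u, hu, hu0, hloc, -⟩ := gaussMaps_local hp hU hb hE hz
    obtain ⟨-, a2, a3, -⟩ := analyticAt_funs (p := p) hz
    obtain ⟨-, -, -, -, d5⟩ := order_div hu hu0 a2 a3
      (meromorphicOrderAt_ne_top meromorphic_height (order_height hb) z)
    rcases hloc with ⟨hφ, hψ⟩ | ⟨hψ, hφ⟩
    · rwa [← meromorphicOrderAt_congr hφ, ← meromorphicOrderAt_congr hψ] at d5
    · rwa [← meromorphicOrderAt_congr hφ, ← meromorphicOrderAt_congr hψ, min_comm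
        (meromorphicOrderAt (p.psi L) z)] at d5
  periodic := periodic_surface hper
  smooth := contDiffOn_surface hU
  deriv_eq := by
    intro z hz hφ hψ hh a i
    obtain ⟨a1, a2, a3, a4⟩ := analyticAt_funs (p := p) hz
    have hne1 := (meromorphicOrderAt_ne_top_iff_eventually_ne_zero (meromorphic_xiFun z)).1
      (meromorphicOrderAt_ne_top (meromorphic_xiFun (p := p) (L := L)) order_xiFun z)
    have hne2 := (meromorphicOrderAt_ne_top_iff_eventually_ne_zero (meromorphic_height z)).1
      (meromorphicOrderAt_ne_top (meromorphic_height (p := p) (L := L)) (order_height hb) z)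
    have hne4 : ∀ᶠ w in 𝓝[≠] z, w ∉ L.lattice :=
      Filter.Eventually.filter_mono nhdsWithin_le_nhds ((isOpen_compl_lattice L).mem_nhds hz)
    -- The formulas hold off the zeros of the denominators, where division gives the value 0.
    -- Functions continuous at z that agree on a punctured neighbourhood agree at z.
    have key : ∀ {f g : ℂ → ℂ}, ContinuousAt f z → ContinuousAt g z → f =ᶠ[𝓝[≠] z] g → f z = g z :=
      fun hf hg hfg => ((hf.eventuallyEq_nhds_iff_eventuallyEq_nhdsNE hg).1 hfg).eq_of_nhds
    have e1 : p.phi L z * p.height L z = p.xiFun L z := by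
      refine key (f := fun z => p.phi L z * p.height L z) (hφ.fun_mul hh).continuousAt
        a1.continuousAt ?_
      filter_upwards [hne2] with w hw
      rw [phi_eq, div_mul_cancel₀ _ hw]
    have e2 : p.psi L z * p.height L z = p.wFun L z := by
      refine key (f := fun z => p.psi L z * p.height L z) (hψ.fun_mul hh).continuousAt
        a4.continuousAt ?_
      filter_upwards [hne1, hne4] with w hw hw'
      have : p.xiFun L w * p.wFun L w = p.height L w * p.nFun L w := mul_wVal hp (hU.2.2 w hw')
      rw [psi_eq]
      field_simp
      linear_combination -this
    have e3 : p.phi L z * p.psi L z * p.height L z = p.nFun L z := by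
      refine key (f := fun z => p.phi L z * p.psi L z * p.height L z)
        ((hφ.fun_mul hψ).fun_mul hh).continuousAt a3.continuousAt ?_
      filter_upwards [hne1, hne2] with w hw hw'
      rw [psi_eq, phi_eq]
      field_simp
    rw [fderiv_surface hU hz]
    have : weierstrassForm (p.phi L) (p.psi L) (p.height L) z =
        p.formVec (curveX L p.lam z) (curveY L z) := by
      change _ = ![p.xiFun L z + p.wFun L z, -Complex.I * (p.xiFun L z - p.wFun L z),
        p.height L z - p.nFun L z, p.height L z + p.nFun L z]
      rw [← e1, ← e2, ← e3, weierstrassForm]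
      ext i
      fin_cases i <;> simp <;> ring
    rw [this]

end Params

end

section

/-! ### Completeness at the end -/

variable {L : PeriodPair} {p : Params}

/-- Periodicity spreads a punctured neighbourhood of 0 to a uniform neighbourhood of the lattice. -/
theorem exists_infDist_lt {Q : ℂ → Prop} (hper : ∀ z, ∀ l ∈ L.lattice, Q (z + l) ↔ Q z)
    (h0 : ∀ᶠ z in 𝓝[≠] 0, Q z) :
    ∃ δ > 0, ∀ z, z ∉ L.lattice → Metric.infDist z (L.lattice : Set ℂ) < δ → Q z := by
  rw [eventually_nhdsWithin_iff, Metric.eventually_nhds_iff] at h0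
  obtain ⟨δ, hδ, h⟩ := h0
  refine ⟨δ, hδ, fun z hz hd => ?_⟩
  obtain ⟨l, hl, hd'⟩ := (Metric.infDist_lt_iff ⟨0, zero_mem _⟩).1 hd
  have h1 := h (y := z - l) (by rwa [dist_zero_right, ← dist_eq_norm])
    (sub_ne_zero.2 fun h => hz (h ▸ hl))
  have h2 := hper (z - l) l hl
  rw [sub_add_cancel] at h2
  exact h2.2 h1

namespace Params

/-- `z⁴ (x - x₀)`. -/
def endP (p : Params) (L : PeriodPair) (z : ℂ) : ℂ := z ^ 2 * (endX L p.lam z - p.x₀ * z ^ 2)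

/-- `z⁴ h`. -/
def endH (p : Params) (L : PeriodPair) (z : ℂ) : ℂ :=
  p.b * z * (endY L z - p.y₀ * z ^ 3) + p.c * z ^ 2 * (endX L p.lam z - p.x₀ * z ^ 2)

/-- `z⁴ φ ψ h`. -/
def endN (p : Params) (L : PeriodPair) (z : ℂ) : ℂ :=
  p.l * z * (endY L z + p.y₀ * z ^ 3) + p.m * z ^ 2 * (endX L p.lam z - p.x₀ * z ^ 2)

/-- `z⁴ ψ h`. -/
def endW (p : Params) (L : PeriodPair) (z : ℂ) : ℂ :=
  p.b * p.l * (endX L p.lam z ^ 2 + z ^ 2 * endX L p.lam z * p.x₀ + z ^ 4 * p.x₀ ^ 2 -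
    (1 + p.lam) * (z ^ 2 * endX L p.lam z + z ^ 4 * p.x₀) + p.lam * z ^ 4) +
    (p.l * p.c + p.m * p.b) * z * endY L z + (p.l * p.c - p.m * p.b) * p.y₀ * z ^ 4 +
    p.m * p.c * z ^ 2 * (endX L p.lam z - p.x₀ * z ^ 2)

/-- The product of `|z|⁸` and the squared conformal factor. -/
def endDensity (p : Params) (L : PeriodPair) (z : ℂ) : ℝ :=
  4 * (‖p.endP L z‖ ^ 2 + ‖p.endW L z‖ ^ 2 -
    2 * (p.endN L z * (starRingEnd ℂ) (p.endH L z)).re)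

theorem endDensity_eq {z : ℂ} (hz : z ≠ 0) : p.endDensity L z = ‖z‖ ^ 8 * p.density L z := by
  have e1 : p.endP L z = z ^ 4 * (curveX L p.lam z - p.x₀) := by
    rw [endP, ← sq_mul_curveX L p.lam hz]; ring
  have e2 : p.endH L z = z ^ 4 * p.hVal (curveX L p.lam z) (curveY L z) := by
    rw [endH, hVal, ← sq_mul_curveX L p.lam hz, ← pow_mul_curveY L hz]; ring
  have e3 : p.endN L z = z ^ 4 * p.nVal (curveX L p.lam z) (curveY L z) := by
    rw [endN, nVal, ← sq_mul_curveX L p.lam hz, ← pow_mul_curveY L hz]; ring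
  have e4 : p.endW L z = z ^ 4 * p.wVal (curveX L p.lam z) (curveY L z) := by
    rw [endW, wVal, ← sq_mul_curveX L p.lam hz, ← pow_mul_curveY L hz]; ring
  have e5 : ∀ a b : ℂ, z ^ 4 * a * (starRingEnd ℂ) (z ^ 4 * b) =
      ((‖z‖ ^ 8 : ℝ) : ℂ) * (a * (starRingEnd ℂ) b) := by
    intro a b
    have h1 : z ^ 4 * (starRingEnd ℂ) (z ^ 4) = ((‖z‖ ^ 8 : ℝ) : ℂ) := by
      rw [Complex.mul_conj', norm_pow]; push_cast; ring
    rw [map_mul]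
    linear_combination (a * (starRingEnd ℂ) b) * h1
  rw [endDensity, density, energy, e1, e2, e3, e4, e5, Complex.re_ofReal_mul, norm_mul, norm_mul,
    norm_pow]
  ring

/-- Only ψh has a pole of full order 4 at the end, with leading coefficient 16bl; the other three
terms vanish there. -/
theorem endDensity_zero_pos (hb : p.b ≠ 0) (hl : p.l ≠ 0) : 0 < p.endDensity L 0 := by
  have : p.endW L 0 ≠ 0 := by simp [endW, hb, hl]
  simp only [endDensity, endP, endN, endH]
  simp
  positivity

theorem endDensity_pos (hb : p.b ≠ 0) (hl : p.l ≠ 0)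
    (hE : ∀ z, z ∉ L.lattice → 0 < p.density L z) {z : ℂ} (hz : z ∈ ((L.lattice : Set ℂ) \ {0})ᶜ) :
    0 < p.endDensity L z := by
  by_cases h0 : z = 0
  · rw [h0]
    exact endDensity_zero_pos hb hl
  · rw [endDensity_eq h0]
    have := norm_pos_iff.2 h0
    have := hE z fun h => hz ⟨h, h0⟩
    positivity

theorem contDiffAt_endDensity {z : ℂ} (hz : z ∈ ((L.lattice : Set ℂ) \ {0})ᶜ) :
    ContDiffAt ℝ ∞ (p.endDensity L) z := by
  have hX : ContDiffAt ℝ ∞ (endX L p.lam) z :=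
    (analyticOnNhd_endX L p.lam z hz).contDiffAt.restrict_scalars ℝ
  have hY : ContDiffAt ℝ ∞ (endY L) z := (analyticOnNhd_endY L z hz).contDiffAt.restrict_scalars ℝ
  have h1 : ContDiffAt ℝ ∞ (p.endP L) z := by unfold endP; fun_prop
  have h2 : ContDiffAt ℝ ∞ (p.endW L) z := by unfold endW; fun_prop
  have h3 : ContDiffAt ℝ ∞ (p.endH L) z := by unfold endH; fun_prop
  have h4 : ContDiffAt ℝ ∞ (p.endN L) z := by unfold endN; fun_prop
  have hconj : ContDiff ℝ ∞ (starRingEnd ℂ) := Complex.conjCLE.contDiff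
  have h5 : ContDiffAt ℝ ∞ (fun z => p.endN L z * (starRingEnd ℂ) (p.endH L z)) z := by fun_prop
  have h6 := Complex.reCLM.contDiff.contDiffAt.comp z h5
  exact contDiffAt_const.mul (((h1.norm_sq ℝ).add (h2.norm_sq ℝ)).sub (contDiffAt_const.mul h6))

theorem density_add {l : ℂ} (hl : l ∈ L.lattice) (z : ℂ) :
    p.density L (z + l) = p.density L z := by
  rw [density, density, curveX_add L _ hl, curveY_add L hl]

theorem hasDerivAt_xiFun {z : ℂ} (hz : z ∉ L.lattice) :
    HasDerivAt (p.xiFun L) (curveY L z) z := (hasDerivAt_curveX p.lam hz).sub_const _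

/-- The function |y|² has a pole of order 6 in |z|, and the density one of order 8. -/
theorem norm_curveY_le (hb : p.b ≠ 0) (hl : p.l ≠ 0) :
    ∀ᶠ z in 𝓝[≠] (0 : ℂ), ‖curveY L z‖ ^ 2 ≤ p.density L z := by
  have h0 := zero_mem_compl_lattice_sdiff L
  have h1 : ContinuousAt (fun z : ℂ => ‖z‖ ^ 2 * ‖endY L z‖ ^ 2) 0 := by
    have := (analyticOnNhd_endY L 0 h0).continuousAt
    fun_prop
  have h2 : ContinuousAt (p.endDensity L) 0 := (contDiffAt_endDensity h0).continuousAt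
  have h3 := h1.eventually_lt h2 (by simpa using endDensity_zero_pos hb hl)
  filter_upwards [nhdsWithin_le_nhds h3, self_mem_nhdsWithin] with z hz hz0
  have hz0' : z ≠ 0 := hz0
  have hn := norm_pos_iff.2 hz0'
  rw [endDensity_eq hz0', ← pow_mul_curveY L hz0', norm_mul, norm_pow] at hz
  refine le_of_mul_le_mul_left (a := ‖z‖ ^ 8) ?_ (by positivity)
  refine le_trans (le_of_eq ?_) hz.le
  ring

/-- Near the end the length element dominates |y dz| = |dx|. The length of a path is thus at least
the variation of x along it, and x tends to infinity at the end. -/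
theorem isCompleteSurface (hp : p.OnCurve) (hU : Uniformizes L p.lam) (hb : p.b ≠ 0)
    (hl : p.l ≠ 0) : IsCompleteSurface L (p.surface (periods L)) := by
  intro γ hγ hγL hlim
  have hdens : ∃ δ > 0, ∀ z, z ∉ L.lattice → Metric.infDist z (L.lattice : Set ℂ) < δ →
      ‖curveY L z‖ ^ 2 ≤ p.density L z :=
    exists_infDist_lt (fun z l hl => by rw [density_add hl, curveY_add L hl]) (norm_curveY_le hb hl)
  obtain ⟨δ, hδ, hdens⟩ := hdens
  have hev : ∀ᶠ t in 𝓝[<] (1 : ℝ), t ∈ Ioo (0 : ℝ) 1 ∧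
      Metric.infDist (γ t) (L.lattice : Set ℂ) < δ :=
    Filter.Eventually.and (Ioo_mem_nhdsLT one_pos) (hlim.eventually (gt_mem_nhds hδ))
  obtain ⟨t₀, ht₀, hsub⟩ : ∃ t₀ ∈ Ioo (0 : ℝ) 1, ∀ t ∈ Ico t₀ 1, t ∈ Ioo (0 : ℝ) 1 ∧
      Metric.infDist (γ t) (L.lattice : Set ℂ) < δ := by
    obtain ⟨a, ha, hsub⟩ := (mem_nhdsLT_iff_exists_Ioo_subset' (zero_lt_one' ℝ)).1 hev
    have ha1 : a < 1 := ha
    refine ⟨(max a 0 + 1) / 2, ⟨?_, ?_⟩, fun t ht => hsub ⟨?_, ht.2⟩⟩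
    · have := le_max_right a 0; linarith
    · have := max_lt ha1 one_pos; linarith
    · have h1 := le_max_left a 0
      have h2 := max_lt ha1 one_pos
      have h3 := ht.1
      linarith
  have hd : ∀ t ∈ Ioo (0 : ℝ) 1, HasDerivAt (fun t => p.xiFun L (γ t))
      (curveY L (γ t) * deriv γ t) t := by
    intro t ht
    have h1 : HasDerivAt γ (deriv γ t) t := ((hγ.contDiffAt (Ico_mem_nhds ht.1 ht.2)).differentiableAt
      (by simp)).hasDerivAt
    exact (hasDerivAt_xiFun (hγL t ⟨ht.1.le, ht.2⟩)).comp_of_eq t h1 rfl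
  have hcont : ContinuousOn (fun t => curveY L (γ t) * deriv γ t) (Ioo (0 : ℝ) 1) := by
    have h1 : ContinuousOn (deriv γ) (Ioo (0 : ℝ) 1) :=
      (hγ.mono Ioo_subset_Ico_self).continuousOn_deriv_of_isOpen isOpen_Ioo le_rfl
    refine ContinuousOn.mul (fun t ht => ?_) h1
    have h2 := (hasDerivAt_curveY hU (hγL t ⟨ht.1.le, ht.2⟩)).continuousAt
    have h3 : ContinuousAt γ t := (hγ.contDiffAt (Ico_mem_nhds ht.1 ht.2)).continuousAt
    exact (ContinuousAt.comp (g := curveY L) h2 h3).continuousWithinAt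
  have hbound : ∀ s ∈ Ico t₀ 1, ENNReal.ofReal ‖p.xiFun L (γ s) - p.xiFun L (γ t₀)‖ ≤
      ∫⁻ t in Ioo (0 : ℝ) 1, ENNReal.ofReal (Real.sqrt (inducedMetric (p.surface (periods L)) (γ t)
        (deriv γ t) (deriv γ t))) := by
    intro s hs
    have hsubset : Icc t₀ s ⊆ Ioo (0 : ℝ) 1 := fun t ht => ⟨ht₀.1.trans_le ht.1, ht.2.trans_lt hs.2⟩
    have h1 : ∫ t in t₀..s, curveY L (γ t) * deriv γ t = p.xiFun L (γ s) - p.xiFun L (γ t₀) := by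
      refine intervalIntegral.integral_eq_sub_of_hasDerivAt (f := fun t => p.xiFun L (γ t))
        (fun t ht => hd t ?_) ?_
      · rw [uIcc_of_le hs.1] at ht
        exact hsubset ht
      · refine ContinuousOn.intervalIntegrable (hcont.mono ?_)
        rwa [uIcc_of_le hs.1]
    rw [← h1, intervalIntegral.integral_of_le hs.1, ofReal_norm]
    refine (enorm_integral_le_lintegral_enorm _).trans ?_
    refine (setLIntegral_mono' measurableSet_Ioc fun t ht => ?_).trans
      (lintegral_mono_set fun t ht => hsubset ⟨ht.1.le, ht.2⟩)
    obtain ⟨ht1, ht2⟩ := hsub t ⟨ht.1.le, ht.2.trans_lt hs.2⟩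
    have htL := hγL t ⟨ht1.1.le, ht1.2⟩
    rw [← ofReal_norm, inducedMetric_surface_self hp hU htL]
    refine ENNReal.ofReal_le_ofReal (Real.le_sqrt_of_sq_le ?_)
    rw [norm_mul, mul_pow]
    exact mul_le_mul_of_nonneg_right (hdens _ htL ht2) (by positivity)
  refine ENNReal.eq_top_of_forall_nnreal_le fun M => ?_
  have hbig : ∃ δ' > 0, ∀ z, z ∉ L.lattice → Metric.infDist z (L.lattice : Set ℂ) < δ' →
      (M : ℝ) + ‖p.xiFun L (γ t₀)‖ ≤ ‖p.xiFun L z‖ := by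
    refine exists_infDist_lt (fun z l hl => by simp only [xiFun, curveX_add L _ hl]) ?_
    have h1 : Tendsto (p.xiFun L) (𝓝[≠] 0) (Bornology.cobounded ℂ) :=
      tendsto_cobounded_of_meromorphicOrderAt_neg (by rw [order_xiFun]; decide)
    exact (tendsto_norm_cobounded_atTop.comp h1).eventually_ge_atTop _
  obtain ⟨δ', hδ', hbig⟩ := hbig
  have hev2 : ∀ᶠ t in 𝓝[<] (1 : ℝ), t ∈ Ico t₀ 1 ∧
      Metric.infDist (γ t) (L.lattice : Set ℂ) < δ' :=
    Filter.Eventually.and (Ico_mem_nhdsLT ht₀.2) (hlim.eventually (gt_mem_nhds hδ'))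
  obtain ⟨s, hs, hs'⟩ := hev2.exists
  refine le_trans ?_ (hbound s hs)
  have h2 := hbig (γ s) (hγL s ⟨(ht₀.1.trans_le hs.1).le, hs.2⟩) hs'
  have h3 := norm_sub_norm_le (p.xiFun L (γ s)) (p.xiFun L (γ t₀))
  rw [← ENNReal.ofReal_coe_nnreal]
  exact ENNReal.ofReal_le_ofReal (by linarith)

theorem isCompleteStationary (hp : p.OnCurve) (hU : Uniformizes L p.lam) (hb : p.b ≠ 0)
    (hl : p.l ≠ 0) (hE : ∀ z, z ∉ L.lattice → 0 < p.density L z)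
    (hper : p.PeriodCondition (periods L)) : IsCompleteStationary L (p.surface (periods L)) where
  periodic := periodic_surface hper
  smooth := contDiffOn_surface hU
  spacelike := fun z hz a ha => by
    rw [inducedMetric_surface_self hp hU hz]
    have := hE z hz
    have := norm_pos_iff.2 ha
    positivity
  conformal := fun z hz => by
    simp [inducedMetric_surface hp hU hz]
  stationary := fun z hz => meanCurvature_surface hp hU hz
  complete := isCompleteSurface hp hU hb hl

/-- The parameters of the Chen-Gackstatter surface. -/
def chenGackstatter : Params := ⟨rho, 0, -rho, 0, 0, 0, -1⟩

/-- At these parameters dh = ρ dx, which explains the factor ρ⁻¹; the fourth coordinate vanishes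
because l = −b makes h + φψh zero. -/
theorem isChenGackstatter (hU : Uniformizes L (-1))
    (hE : ∀ z, z ∉ L.lattice → 0 < chenGackstatter.density L z)
    (hper : chenGackstatter.PeriodCondition (periods L)) :
    IsChenGackstatter L (fun z => rho⁻¹ • chenGackstatter.surface (periods L) z) := by
  have hr : (rho : ℂ) ≠ 0 := Complex.ofReal_ne_zero.2 rho_pos.ne'
  have hrep := isAlgebraicRepresentation (p := chenGackstatter) (L := L)
    (by simp [OnCurve, chenGackstatter]) hU hr (neg_ne_zero.2 hr) hE hper
  have hφ : chenGackstatter.phi L = gaussCG L := by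
    ext z
    simp [phi, chenGackstatter, gaussCG]
  have hψ : chenGackstatter.psi L = fun z => -1 / gaussCG L z := by
    ext z
    simp [psi, chenGackstatter, gaussCG, neg_div]
  have hh : chenGackstatter.height L = fun z => rho * curveY L z := by
    ext z
    simp [height, chenGackstatter]
  rw [hφ, hψ, hh] at hrep
  have hh' : ∀ z, curveY L z = (rho : ℂ)⁻¹ * (rho * curveY L z) := fun z => by field_simp
  refine ⟨hU, ⟨hrep.elliptic_phi, hrep.elliptic_psi, ⟨meromorphic_curveY L, fun l hl z =>
    curveY_add L hl z⟩, hrep.regular, fun z hz => ?_, fun z hz l hl => ?_, ?_, ?_⟩, fun z hz => ?_⟩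
  · have h1 := hrep.zeros z hz
    have h2 := meromorphicOrderAt_mul_of_ne_zero (f := curveY L) (g := fun _ => (rho : ℂ)) (x := z)
      analyticAt_const hr
    rwa [← h2]
  · simp only [hrep.periodic z hz l hl]
  · exact hrep.smooth.const_smul rho⁻¹
  · intro z hz h1 h2 h3 a i
    have h4 := hrep.deriv_eq z hz h1 h2 (analyticAt_const.fun_mul h3) a i
    have h5 : fderiv ℝ (fun z => rho⁻¹ • chenGackstatter.surface (periods L) z) z =
        rho⁻¹ • fderiv ℝ (chenGackstatter.surface (periods L)) z :=
      fderiv_fun_const_smul ((hrep.smooth.contDiffAt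
        ((isOpen_compl_lattice L).mem_nhds hz)).differentiableAt (by simp)) _
    rw [h5]
    change rho⁻¹ * fderiv ℝ (chenGackstatter.surface (periods L)) z a i = _
    rw [h4]
    have h6 : weierstrassForm (gaussCG L) (fun z => -1 / gaussCG L z)
        (fun z => rho * curveY L z) z i = rho * weierstrassForm (gaussCG L)
        (fun z => -1 / gaussCG L z) (curveY L) z i := by
      fin_cases i <;> simp [weierstrassForm] <;> ring
    rw [h6, mul_assoc, Complex.re_ofReal_mul]
    have := rho_pos.ne'
    field_simp
  · have h1 := congrFun (surface_eq (p := chenGackstatter) hz) 3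
    change rho⁻¹ * chenGackstatter.surface (periods L) z 3 = 0
    rw [h1]
    simp [primVec, primH, primN, chenGackstatter]

end Params

end

section

/-! ### The divergence theorem on a period parallelogram -/

variable {L : PeriodPair}

/-- Coordinates with respect to the periods. -/
theorem latticeCoord_unique (L : PeriodPair) {s t s' t' : ℝ}
    (h : (s : ℂ) * L.ω₁ + t * L.ω₂ = s' * L.ω₁ + t' * L.ω₂) : s = s' ∧ t = t' := by
  have hd := latticeDet_periods_ne_zero L
  obtain ⟨h1, h2⟩ := Complex.ext_iff.1 h
  simp at h1 h2
  simp only [latticeDet, periods] at hd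
  constructor
  · refine sub_eq_zero.1 ((mul_eq_zero.1 (?_ : (s - s') * _ = 0)).resolve_right hd)
    linear_combination L.ω₂.im * h1 - L.ω₂.re * h2
  · refine sub_eq_zero.1 ((mul_eq_zero.1 (?_ : (t - t') * _ = 0)).resolve_right hd)
    linear_combination L.ω₁.re * h2 - L.ω₁.im * h1

theorem mem_lattice_coord {s t : ℝ} (h : (s : ℂ) * L.ω₁ + t * L.ω₂ ∈ L.lattice) :
    ∃ m n : ℤ, s = m ∧ t = n := by
  obtain ⟨m, n, h⟩ := PeriodPair.mem_lattice.1 h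
  obtain ⟨h1, h2⟩ := latticeCoord_unique L (s := m) (t := n) (s' := s) (t' := t)
    (by push_cast; exact h)
  exact ⟨m, n, h1.symm, h2.symm⟩

theorem int_eq_zero_of_mem {m : ℤ} (h : (m : ℝ) ∈ Icc (-(1 / 2) : ℝ) (1 / 2)) : m = 0 := by
  have h1 : (-1 : ℝ) < m := by linarith [h.1]
  have h2 : (m : ℝ) < 1 := by linarith [h.2]
  norm_cast at h1 h2
  omega

theorem parallelogram_subset {s t : ℝ} (hs : s ∈ Icc (-(1 / 2) : ℝ) (1 / 2))
    (ht : t ∈ Icc (-(1 / 2) : ℝ) (1 / 2)) :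
    (s : ℂ) * L.ω₁ + t * L.ω₂ ∈ ((L.lattice : Set ℂ) \ {0})ᶜ := by
  rintro ⟨h1, h2⟩
  obtain ⟨m, n, rfl, rfl⟩ := mem_lattice_coord h1
  rw [int_eq_zero_of_mem hs, int_eq_zero_of_mem ht] at h2
  simp at h2

theorem boundary_notMem {s t : ℝ} (h : s = 1 / 2 ∨ s = -(1 / 2) ∨ t = 1 / 2 ∨ t = -(1 / 2)) :
    (s : ℂ) * L.ω₁ + t * L.ω₂ ∉ L.lattice := by
  intro hm
  obtain ⟨m, n, h1, h2⟩ := mem_lattice_coord hm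
  have key : ∀ k : ℤ, (k : ℝ) ≠ 1 / 2 ∧ (k : ℝ) ≠ -(1 / 2) := by
    intro k
    constructor <;> intro hk
    · have : (2 * k : ℝ) = 1 := by linarith
      norm_cast at this
      omega
    · have : (2 * k : ℝ) = -1 := by linarith
      norm_cast at this
      omega
  rcases h with h | h | h | h
  · exact (key m).1 (h1 ▸ h)
  · exact (key m).2 (h1 ▸ h)
  · exact (key n).1 (h2 ▸ h)
  · exact (key n).2 (h2 ▸ h)

theorem hasFDerivAt_log_norm {z : ℂ} (hz : z ≠ 0) : HasFDerivAt (fun z : ℂ => Real.log ‖z‖)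
    (Complex.reCLM.comp ((ContinuousLinearMap.toSpanSingleton ℂ z⁻¹).restrictScalars ℝ)) z := by
  have h1 : ∀ z : ℂ, Real.log ‖z‖ = 1 / 2 * Real.log (‖z‖ ^ 2) := fun z => by
    rw [Real.log_pow]; push_cast; ring
  have h2 : HasFDerivAt (fun z : ℂ => ‖z‖ ^ 2) (2 • innerSL ℝ z) z :=
    (hasStrictFDerivAt_norm_sq z).hasFDerivAt
  have h3 := (h2.log (pow_ne_zero 2 (norm_ne_zero_iff.2 hz))).const_mul (1 / 2)
  simp_rw [← h1] at h3
  refine h3.congr_fderiv ?_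
  ext a
  · simp [Complex.inv_re, Complex.normSq_eq_norm_sq]
    ring

/-- The jump of the derivative of a function that is periodic up to `8 log |z|`. -/
theorem fderiv_add_sub {S D : ℂ → ℝ} (hD : ∀ z, ∀ l ∈ L.lattice, D (z + l) = D z)
    (hSD : ∀ z, z ∉ L.lattice → S z = D z + 8 * Real.log ‖z‖) {z l : ℂ}
    (hS : DifferentiableAt ℝ S z) (hz : z ∉ L.lattice) (hl : l ∈ L.lattice) (a : ℂ) :
    fderiv ℝ S (z + l) a - fderiv ℝ S z a = 8 * (a / (z + l)).re - 8 * (a / z).re := by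
  have hz0 : z ≠ 0 := fun h => hz (h ▸ zero_mem _)
  have hzl : z + l ∉ L.lattice := by rwa [add_mem_lattice_iff hl]
  have hzl0 : z + l ≠ 0 := fun h => hzl (h ▸ zero_mem _)
  have h1 : HasFDerivAt (fun w => S w - 8 * Real.log ‖w‖ + 8 * Real.log ‖w + l‖) _ z :=
    (hS.hasFDerivAt.sub ((hasFDerivAt_log_norm hz0).const_mul 8)).add
    (((hasFDerivAt_log_norm hzl0).comp z ((hasFDerivAt_id z).add_const l)).const_mul 8)
  -- The function S − 8 log|z| is periodic, so translating S by l only exchanges the logarithmic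
  -- terms.
  have h2 : (fun w => S (w + l)) =ᶠ[𝓝 z] fun w => S w - 8 * Real.log ‖w‖ + 8 * Real.log ‖w + l‖ := by
    filter_upwards [(isOpen_compl_lattice L).mem_nhds hz] with w hw
    have hwl : w + l ∉ L.lattice := by rwa [add_mem_lattice_iff hl]
    rw [hSD _ hw, hSD _ hwl, hD _ _ hl]
    ring
  have h3 := (h1.congr_of_eventuallyEq h2).fderiv
  rw [fderiv_comp_add_right] at h3
  rw [h3]
  simp [div_eq_mul_inv]
  ring

/-- Twice the boundary terms: the winding number of the parallelogram. -/
theorem arg_parallelogram {τ : ℂ} (hτ : 0 < τ.im) :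
    Complex.arg (τ / 2 - 1 / 2) - Complex.arg (1 / 2 - τ / 2) = Real.pi := by
  have h : 0 < (τ / 2 - 1 / 2).im := by simpa using hτ
  rw [show (1 / 2 - τ / 2 : ℂ) = -(τ / 2 - 1 / 2) by ring,
    Complex.arg_neg_eq_arg_sub_pi_of_im_pos h]
  ring

theorem hasDerivAt_arg {c a : ℂ} {t : ℝ} (h : c + t * a ∈ Complex.slitPlane) :
    HasDerivAt (fun t : ℝ => Complex.arg (c + t * a)) (a / (c + t * a)).im t := by
  have h1 : HasDerivAt (fun t : ℝ => c + (t : ℂ) * a) a t := by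
    simpa using! ((hasDerivAt_id (t : ℂ)).comp_ofReal.mul_const a).const_add c
  have h2 := Complex.imCLM.hasFDerivAt.comp_hasDerivAt t (h1.clog_real h)
  have h3 : (fun t : ℝ => Complex.arg (c + t * a)) =
      Complex.imCLM ∘ fun t : ℝ => Complex.log (c + t * a) := by
    funext t
    simp [Complex.log_im]
  rw [h3]
  exact h2

/-- The parallelogram is centred at 0, so S is smooth on it and its boundary avoids the lattice. By
the divergence theorem only the jumps between opposite sides remain. They are derivatives of
arguments, and their integrals add up to 8 times the winding 2π around 0. -/
theorem integral2_laplacian (hdet : 0 < latticeDet (periods L)) {S D : ℂ → ℝ}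
    (hS : ∀ z ∈ ((L.lattice : Set ℂ) \ {0})ᶜ, ContDiffAt ℝ ∞ S z)
    (hD : ∀ z, ∀ l ∈ L.lattice, D (z + l) = D z)
    (hSD : ∀ z, z ∉ L.lattice → S z = D z + 8 * Real.log ‖z‖) :
    ∫ s in (-(1 / 2) : ℝ)..(1 / 2), ∫ t in (-(1 / 2) : ℝ)..(1 / 2),
      latticeDet (periods L) * Laplacian.laplacian S ((s : ℂ) * L.ω₁ + t * L.ω₂) =
      16 * Real.pi := by
  have hI : Icc (-(1 / 2) : ℝ) (1 / 2) = uIcc (-(1 / 2)) (1 / 2) := (uIcc_of_le (by norm_num)).symm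
  have hω₁ : L.ω₁ ≠ 0 := fun h => by
    simp [latticeDet, periods, h] at hdet
  set τ := L.ω₂ / L.ω₁ with hτ
  have hω₂ : L.ω₂ = τ * L.ω₁ := by rw [hτ]; field_simp
  have hτim : 0 < τ.im := by
    have h1 : 0 < Complex.normSq L.ω₁ := Complex.normSq_pos.2 hω₁
    have h2 : latticeDet (periods L) = τ.im * Complex.normSq L.ω₁ := by
      simp only [latticeDet, periods, hω₂, Complex.mul_re, Complex.mul_im, Complex.normSq_apply]
      ring
    rw [h2] at hdet
    exact pos_of_mul_pos_left hdet h1.le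
  let A : ℝ × ℝ →L[ℝ] ℂ := (Complex.ofRealCLM.comp (ContinuousLinearMap.fst ℝ ℝ ℝ)).smulRight L.ω₁ +
    (Complex.ofRealCLM.comp (ContinuousLinearMap.snd ℝ ℝ ℝ)).smulRight L.ω₂
  have hA : ∀ x : ℝ × ℝ, A x = (x.1 : ℂ) * L.ω₁ + x.2 * L.ω₂ := fun x => by simp [A]
  -- These are outward normals to two sides, scaled by their lengths; in the coordinates (s, t) the
  -- divergence of the field is then the determinant times ΔS.
  set u₁ : ℂ := -Complex.I * L.ω₂ with hu₁
  set u₂ : ℂ := Complex.I * L.ω₁ with hu₂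
  let D2 : ℂ → ℂ →L[ℝ] ℂ →L[ℝ] ℝ := fun z => fderiv ℝ (fderiv ℝ S) z
  have hD1 : ∀ z ∈ ((L.lattice : Set ℂ) \ {0})ᶜ, ContDiffAt ℝ ∞ (fderiv ℝ S) z := fun z hz =>
    (hS z hz).fderiv_right (m := ∞) (by simp)
  have hD2 : ∀ z ∈ ((L.lattice : Set ℂ) \ {0})ᶜ, ContDiffAt ℝ ∞ D2 z := fun z hz =>
    (hD1 z hz).fderiv_right (m := ∞) (by simp)
  have hQ : ∀ x ∈ uIcc (-(1 / 2) : ℝ) (1 / 2) ×ˢ uIcc (-(1 / 2) : ℝ) (1 / 2),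
      A x ∈ ((L.lattice : Set ℂ) \ {0})ᶜ := by
    intro x hx
    rw [← hI] at hx
    rw [hA]
    exact parallelogram_subset hx.1 hx.2
  have hderiv : ∀ a : ℂ, ∀ x ∈ uIcc (-(1 / 2) : ℝ) (1 / 2) ×ˢ uIcc (-(1 / 2) : ℝ) (1 / 2),
      HasFDerivAt (fun x => fderiv ℝ S (A x) a)
        ((ContinuousLinearMap.apply ℝ ℝ a).comp ((D2 (A x)).comp A)) x := by
    intro a x hx
    exact (ContinuousLinearMap.apply ℝ ℝ a).hasFDerivAt.comp x
      (((hD1 _ (hQ x hx)).differentiableAt (by simp)).hasFDerivAt.comp x A.hasFDerivAt)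
  have hcont : ∀ a : ℂ, ContinuousOn (fun x => fderiv ℝ S (A x) a)
      (uIcc (-(1 / 2) : ℝ) (1 / 2) ×ˢ uIcc (-(1 / 2) : ℝ) (1 / 2)) := fun a x hx =>
    (hderiv a x hx).continuousAt.continuousWithinAt
  have hsub : ∀ x ∈ Ioo (min (-(1 / 2) : ℝ) (1 / 2)) (max (-(1 / 2)) (1 / 2)) ×ˢ
      Ioo (min (-(1 / 2) : ℝ) (1 / 2)) (max (-(1 / 2)) (1 / 2)) \ ∅,
      x ∈ uIcc (-(1 / 2) : ℝ) (1 / 2) ×ˢ uIcc (-(1 / 2) : ℝ) (1 / 2) := fun x hx =>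
    ⟨Ioo_subset_Icc_self hx.1.1, Ioo_subset_Icc_self hx.1.2⟩
  have hlap : ∀ x : ℝ × ℝ, ((ContinuousLinearMap.apply ℝ ℝ u₁).comp ((D2 (A x)).comp A)) (1, 0) +
      ((ContinuousLinearMap.apply ℝ ℝ u₂).comp ((D2 (A x)).comp A)) (0, 1) =
      latticeDet (periods L) * Laplacian.laplacian S ((x.1 : ℂ) * L.ω₁ + x.2 * L.ω₂) := by
    intro x
    have hbil : ∀ v w : ℂ, D2 (A x) v w = v.re * w.re * D2 (A x) 1 1 +
        v.re * w.im * D2 (A x) 1 Complex.I + v.im * w.re * D2 (A x) Complex.I 1 +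
        v.im * w.im * D2 (A x) Complex.I Complex.I := by
      intro v w
      have e : ∀ v : ℂ, v = v.re • (1 : ℂ) + v.im • Complex.I := fun v => by
        simp [Complex.re_add_im]
      conv_lhs => rw [e v, e w]
      simp only [map_add, map_smul, add_apply, smul_apply, smul_eq_mul]
      ring
    have h1 : Laplacian.laplacian S (A x) = D2 (A x) 1 1 + D2 (A x) Complex.I Complex.I := by
      rw [InnerProductSpace.laplacian_eq_iteratedFDeriv_complexPlane]
      simp [iteratedFDeriv_two_apply, D2]
    rw [← hA, h1]
    have e1 : A (1, 0) = L.ω₁ := by rw [hA]; simp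
    have e2 : A (0, 1) = L.ω₂ := by rw [hA]; simp
    simp only [ContinuousLinearMap.comp_apply, ContinuousLinearMap.apply_apply, e1, e2]
    rw [hbil L.ω₁, hbil L.ω₂]
    simp only [hu₁, hu₂, latticeDet, periods, Complex.mul_re, Complex.mul_im, Complex.neg_re,
      Complex.neg_im, Complex.I_re, Complex.I_im]
    ring
  have hint : IntegrableOn (fun x : ℝ × ℝ => ((ContinuousLinearMap.apply ℝ ℝ u₁).comp
      ((D2 (A x)).comp A)) (1, 0) + ((ContinuousLinearMap.apply ℝ ℝ u₂).comp
      ((D2 (A x)).comp A)) (0, 1)) (uIcc (-(1 / 2) : ℝ) (1 / 2) ×ˢ uIcc (-(1 / 2) : ℝ) (1 / 2)) := by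
    refine ContinuousOn.integrableOn_compact (isCompact_uIcc.prod isCompact_uIcc) ?_
    have h1 : ContinuousOn (fun x => D2 (A x))
        (uIcc (-(1 / 2) : ℝ) (1 / 2) ×ˢ uIcc (-(1 / 2) : ℝ) (1 / 2)) := fun x hx =>
      (ContinuousAt.comp (g := D2) (hD2 _ (hQ x hx)).continuousAt
        A.continuous.continuousAt).continuousWithinAt
    simp only [ContinuousLinearMap.comp_apply, ContinuousLinearMap.apply_apply]
    exact ((h1.clm_apply continuousOn_const).clm_apply continuousOn_const).add
      ((h1.clm_apply continuousOn_const).clm_apply continuousOn_const)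
  have hmain := integral2_divergence_prod_of_hasFDerivAt_off_countable
    (fun x => fderiv ℝ S (A x) u₁) (fun x => fderiv ℝ S (A x) u₂)
    (fun x => (ContinuousLinearMap.apply ℝ ℝ u₁).comp ((D2 (A x)).comp A))
    (fun x => (ContinuousLinearMap.apply ℝ ℝ u₂).comp ((D2 (A x)).comp A))
    (-(1 / 2)) (-(1 / 2)) (1 / 2) (1 / 2) ∅ countable_empty (hcont u₁) (hcont u₂)
    (fun x hx => hderiv u₁ x (hsub x hx)) (fun x hx => hderiv u₂ x (hsub x hx)) hint
  simp only [hlap] at hmain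
  rw [hmain]
  have hends : ((1 / 2 : ℝ)) ∈ uIcc (-(1 / 2) : ℝ) (1 / 2) ∧
      (-(1 / 2) : ℝ) ∈ uIcc (-(1 / 2) : ℝ) (1 / 2) := ⟨right_mem_uIcc, left_mem_uIcc⟩
  have hii₁ : ∀ (a : ℂ) (c : ℝ), c ∈ uIcc (-(1 / 2) : ℝ) (1 / 2) → IntervalIntegrable
      (fun t => fderiv ℝ S (A (c, t)) a) volume (-(1 / 2)) (1 / 2) := fun a c hc =>
    ((hcont a).comp (by fun_prop) fun t ht => ⟨hc, ht⟩).intervalIntegrable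
  have hii₂ : ∀ (a : ℂ) (c : ℝ), c ∈ uIcc (-(1 / 2) : ℝ) (1 / 2) → IntervalIntegrable
      (fun s => fderiv ℝ S (A (s, c)) a) volume (-(1 / 2)) (1 / 2) := fun a c hc =>
    ((hcont a).comp (by fun_prop) fun t ht => ⟨ht, hc⟩).intervalIntegrable
  have hJ₁ : (∫ t in (-(1 / 2) : ℝ)..(1 / 2), fderiv ℝ S (A (1 / 2, t)) u₁) -
      ∫ t in (-(1 / 2) : ℝ)..(1 / 2), fderiv ℝ S (A (-(1 / 2), t)) u₁ =
      16 * (Complex.arg (1 / 2 + τ / 2) - Complex.arg (1 / 2 - τ / 2)) := by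
    rw [← intervalIntegral.integral_sub (hii₁ _ _ hends.1) (hii₁ _ _ hends.2)]
    have hd : ∀ t ∈ uIcc (-(1 / 2) : ℝ) (1 / 2), HasDerivAt (fun t : ℝ => 8 * (Complex.arg
        (1 / 2 + t * τ) - Complex.arg (1 / 2 + t * (-τ)))) (fderiv ℝ S (A (1 / 2, t)) u₁ -
        fderiv ℝ S (A (-(1 / 2), t)) u₁) t := by
      intro t ht
      have hz : A (-(1 / 2), t) ∉ L.lattice := by
        rw [hA]; exact boundary_notMem (Or.inr (Or.inl rfl))
      have hz' : A (1 / 2, t) = A (-(1 / 2), t) + L.ω₁ := by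
        rw [hA, hA]; push_cast; ring
      have h1 := fderiv_add_sub hD hSD ((hS _ (hQ _ ⟨hends.2, ht⟩)).differentiableAt (by simp)) hz
        L.ω₁_mem_lattice u₁
      rw [← hz'] at h1
      rw [h1]
      -- After division by ω₁ these sides are 1/2 ± tτ. They meet the real axis only at 1/2, so the
      -- principal argument is smooth on them.
      have hslit : ∀ a : ℂ, 0 < |a.im| → 1 / 2 + (t : ℂ) * a ∈ Complex.slitPlane := by
        intro a ha
        rw [Complex.mem_slitPlane_iff]
        by_cases ht0 : t = 0
        · left; simp [ht0]
        · right
          simpa [ht0] using abs_pos.1 ha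
      have h2 := ((hasDerivAt_arg (hslit τ (abs_pos.2 hτim.ne'))).fun_sub
        (hasDerivAt_arg (hslit (-τ) (by simpa using hτim.ne')))).const_mul (8 : ℝ)
      refine h2.congr_deriv ?_
      have e1 : u₁ / A (1 / 2, t) = -Complex.I * (τ / (1 / 2 + t * τ)) := by
        rw [hA, hu₁, hω₂]
        push_cast
        rw [show (1 / 2 : ℂ) * L.ω₁ + t * (τ * L.ω₁) = (1 / 2 + t * τ) * L.ω₁ by ring,
          mul_div_assoc, mul_div_mul_right _ _ hω₁]
      have e2 : u₁ / A (-(1 / 2), t) = Complex.I * (τ / (1 / 2 + t * (-τ))) := by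
        rw [hA, hu₁, hω₂]
        push_cast
        rw [show (-(1 / 2) : ℂ) * L.ω₁ + t * (τ * L.ω₁) = -(1 / 2 + t * (-τ)) * L.ω₁ by ring,
          mul_div_assoc, mul_div_mul_right _ _ hω₁, div_neg]
        ring
      rw [e1, e2, neg_div]
      simp
      ring
    rw [intervalIntegral.integral_eq_sub_of_hasDerivAt hd
      ((hii₁ _ _ hends.1).sub (hii₁ _ _ hends.2))]
    push_cast
    rw [show (1 / 2 + 1 / 2 * τ : ℂ) = 1 / 2 + τ / 2 by ring,
      show (1 / 2 + 1 / 2 * -τ : ℂ) = 1 / 2 - τ / 2 by ring,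
      show (1 / 2 + -(1 / 2) * τ : ℂ) = 1 / 2 - τ / 2 by ring,
      show (1 / 2 + -(1 / 2) * -τ : ℂ) = 1 / 2 + τ / 2 by ring]
    ring
  have hJ₂ : (∫ s in (-(1 / 2) : ℝ)..(1 / 2), fderiv ℝ S (A (s, 1 / 2)) u₂) -
      ∫ s in (-(1 / 2) : ℝ)..(1 / 2), fderiv ℝ S (A (s, -(1 / 2))) u₂ =
      16 * (Complex.arg (τ / 2 - 1 / 2) - Complex.arg (1 / 2 + τ / 2)) := by
    rw [← intervalIntegral.integral_sub (hii₂ _ _ hends.1) (hii₂ _ _ hends.2)]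
    have hd : ∀ s ∈ uIcc (-(1 / 2) : ℝ) (1 / 2), HasDerivAt (fun s : ℝ => 8 * (Complex.arg
        (τ / 2 + s * (-1)) - Complex.arg (τ / 2 + s * 1))) (fderiv ℝ S (A (s, 1 / 2)) u₂ -
        fderiv ℝ S (A (s, -(1 / 2))) u₂) s := by
      intro s hs
      have hz : A (s, -(1 / 2)) ∉ L.lattice := by
        rw [hA]; exact boundary_notMem (Or.inr (Or.inr (Or.inr rfl)))
      have hz' : A (s, 1 / 2) = A (s, -(1 / 2)) + L.ω₂ := by
        rw [hA, hA]; push_cast; ring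
      have h1 := fderiv_add_sub hD hSD ((hS _ (hQ _ ⟨hs, hends.2⟩)).differentiableAt (by simp)) hz
        L.ω₂_mem_lattice u₂
      rw [← hz'] at h1
      rw [h1]
      have hslit : ∀ a : ℝ, τ / 2 + (s : ℂ) * a ∈ Complex.slitPlane := by
        intro a
        rw [Complex.mem_slitPlane_iff]
        right
        simpa using hτim.ne'
      have h2 := ((hasDerivAt_arg (a := -1) (by simpa using hslit (-1))).fun_sub
        (hasDerivAt_arg (a := 1) (by simpa using hslit 1))).const_mul (8 : ℝ)
      refine h2.congr_deriv ?_
      have e1 : u₂ / A (s, 1 / 2) = Complex.I * (1 / (τ / 2 + s * 1)) := by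
        rw [hA, hu₂, hω₂]
        push_cast
        rw [show (s : ℂ) * L.ω₁ + 1 / 2 * (τ * L.ω₁) = (τ / 2 + s * 1) * L.ω₁ by ring,
          mul_comm Complex.I, mul_div_mul_comm, mul_comm Complex.I]
        field_simp
      have e2 : u₂ / A (s, -(1 / 2)) = Complex.I * (-1 / (τ / 2 + s * (-1))) := by
        rw [hA, hu₂, hω₂]
        push_cast
        rw [show (s : ℂ) * L.ω₁ + -(1 / 2) * (τ * L.ω₁) = -(τ / 2 + s * (-1)) * L.ω₁ by ring,
          mul_div_mul_right _ _ hω₁, div_neg]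
        ring
      rw [e1, e2]
      simp only [Complex.I_mul_re]
      ring
    rw [intervalIntegral.integral_eq_sub_of_hasDerivAt hd
      ((hii₂ _ _ hends.1).sub (hii₂ _ _ hends.2))]
    push_cast
    rw [show (τ / 2 + 1 / 2 * -1 : ℂ) = τ / 2 - 1 / 2 by ring,
      show (τ / 2 + 1 / 2 * 1 : ℂ) = 1 / 2 + τ / 2 by ring,
      show (τ / 2 + -(1 / 2) * -1 : ℂ) = 1 / 2 + τ / 2 by ring,
      show (τ / 2 + -(1 / 2) * 1 : ℂ) = τ / 2 - 1 / 2 by ring]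
    ring
  -- The argument at the corner 1/2 + τ/2 cancels between the two pairs of sides; the remaining
  -- difference is π.
  have harg := arg_parallelogram hτim
  linear_combination hJ₁ + hJ₂ + 16 * harg

end

section

open scoped Pointwise

/-! ### The total curvature -/

section ParallelogramIntegral

variable {L : PeriodPair}

/-- The real linear map taking `1` and `i` to the generators of the lattice. -/
def periodCLM (L : PeriodPair) : ℂ →L[ℝ] ℂ :=
  Complex.reCLM.smulRight L.ω₁ + Complex.imCLM.smulRight L.ω₂

theorem periodCLM_apply (z : ℂ) : periodCLM L z = z.re * L.ω₁ + z.im * L.ω₂ := by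
  simp [periodCLM]

theorem det_periodCLM : (periodCLM L).det = latticeDet (periods L) := by
  rw [ContinuousLinearMap.det, ← LinearMap.det_toMatrix Complex.basisOneI, Matrix.det_fin_two]
  simp [LinearMap.toMatrix_apply, periodCLM_apply, latticeDet, periods]
  ring

theorem repr_periodCLM (z : ℂ) :
    L.basis.repr (periodCLM L z) 0 = z.re ∧ L.basis.repr (periodCLM L z) 1 = z.im := by
  have h : periodCLM L z = z.re • L.basis 0 + z.im • L.basis 1 := by
    simp [periodCLM_apply]
  rw [h]
  simp only [map_add, map_smul, Module.Basis.repr_self]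
  simp

theorem injective_periodCLM : Function.Injective (periodCLM L) := fun z w h => by
  have h1 := repr_periodCLM (L := L) z
  rw [h] at h1
  have h2 := repr_periodCLM (L := L) w
  exact Complex.ext (h1.1.symm.trans h2.1) (h1.2.symm.trans h2.2)

/-- The square of side one centred at the origin. -/
def unitSquare : Set ℂ := Ico (-(1 / 2)) (1 / 2) ×ℂ Ico (-(1 / 2)) (1 / 2)

theorem image_unitSquare : periodCLM L '' unitSquare =
    (-(L.ω₁ + L.ω₂) / 2 : ℂ) +ᵥ ZSpan.fundamentalDomain L.basis := by
  have hs : periodCLM L (1 / 2 + 1 / 2 * Complex.I) = (L.ω₁ + L.ω₂) / 2 := by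
    simp [periodCLM_apply]
    ring
  ext x
  rw [mem_vadd_set_iff_neg_vadd_mem, ZSpan.mem_fundamentalDomain, Fin.forall_fin_two]
  constructor
  · rintro ⟨z, hz, rfl⟩
    have h : -(-(L.ω₁ + L.ω₂) / 2 : ℂ) +ᵥ periodCLM L z =
        periodCLM L (z + (1 / 2 + 1 / 2 * Complex.I)) := by
      rw [map_add, hs, vadd_eq_add]; ring
    rw [h, (repr_periodCLM _).1, (repr_periodCLM _).2]
    simp only [unitSquare, Complex.mem_reProdIm, mem_Ico] at hz
    simp only [mem_Ico]
    norm_num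
    constructor <;> constructor <;> linarith [hz.1.1, hz.1.2, hz.2.1, hz.2.2]
  · intro h
    set y := -(-(L.ω₁ + L.ω₂) / 2 : ℂ) +ᵥ x with hy
    have hy' : periodCLM L ⟨L.basis.repr y 0, L.basis.repr y 1⟩ = y := by
      conv_rhs => rw [← L.basis.sum_repr y]
      simp [periodCLM_apply]
    refine ⟨⟨L.basis.repr y 0, L.basis.repr y 1⟩ - (1 / 2 + 1 / 2 * Complex.I), ?_, ?_⟩
    · simp only [mem_Ico] at h
      simp only [unitSquare, Complex.mem_reProdIm, mem_Ico]
      norm_num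
      constructor <;> constructor <;> linarith [h.1.1, h.1.2, h.2.1, h.2.2]
    · rw [map_sub, hy', hs, hy, vadd_eq_add]
      ring

/-- The centred parallelogram is a translate of the standard one; it has the end in its interior, so
that its boundary avoids the lattice. -/
theorem isAddFundamentalDomain_image : IsAddFundamentalDomain
    (Submodule.span ℤ (range L.basis)) (periodCLM L '' unitSquare) volume := by
  rw [image_unitSquare]
  exact (ZSpan.isAddFundamentalDomain L.basis volume).vadd_of_comm _

theorem countable_lattice : (L.lattice : Set ℂ).Countable := by
  have : Countable L.lattice := inferInstance
  exact this.to_set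

instance : VAddInvariantMeasure (Submodule.span ℤ (range L.basis)) ℂ volume :=
  ⟨fun c s _ => measure_preimage_add volume (c : ℂ) s⟩

/-- A periodic function has the same integral over all fundamental domains, and its values on the
null set Λ do not matter. On the centred parallelogram it may thus be replaced by its continuous
extension f. -/
theorem setIntegral_fundamentalDomain (hdet : 0 < latticeDet (periods L)) {F f : ℂ → ℝ}
    (hF : ∀ l ∈ L.lattice, ∀ z, F (z + l) = F z) (hFf : ∀ z, z ∉ L.lattice → F z = f z)
    (hf : ContinuousOn f ((L.lattice : Set ℂ) \ {0})ᶜ) :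
    IntegrableOn F (ZSpan.fundamentalDomain L.basis) ∧
      ∫ z in ZSpan.fundamentalDomain L.basis, F z =
      ∫ s in (-(1 / 2) : ℝ)..(1 / 2), ∫ t in (-(1 / 2) : ℝ)..(1 / 2),
        latticeDet (periods L) * f ((s : ℂ) * L.ω₁ + t * L.ω₂) := by
  have hper : ∀ (g : Submodule.span ℤ (range L.basis)) (x : ℂ), F (g +ᵥ x) = F x := by
    intro g x
    have : (g : ℂ) ∈ L.lattice := by rw [L.lattice_eq_span_range_basis]; exact g.2
    rw [← hF _ this x, Submodule.vadd_def, vadd_eq_add, add_comm]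
  have hae : F =ᵐ[volume] f := by
    filter_upwards [(countable_lattice (L := L)).ae_notMem volume] with z hz
    exact hFf z hz
  have hmeas : MeasurableSet unitSquare := MeasurableSet.inter
    (measurableSet_Ico.preimage Complex.measurable_re)
    (measurableSet_Ico.preimage Complex.measurable_im)
  set K : Set ℂ := Icc (-(1 / 2)) (1 / 2) ×ℂ Icc (-(1 / 2)) (1 / 2) with hK
  have hKc : IsCompact K := isCompact_Icc.reProdIm isCompact_Icc
  have hsub : unitSquare ⊆ K := fun z hz =>
    ⟨Ico_subset_Icc_self hz.1, Ico_subset_Icc_self hz.2⟩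
  have hmaps : MapsTo (periodCLM L) K ((L.lattice : Set ℂ) \ {0})ᶜ := by
    intro z hz
    rw [periodCLM_apply]
    exact parallelogram_subset hz.1 hz.2
  have hint : IntegrableOn f (periodCLM L '' unitSquare) := by
    refine IntegrableOn.mono_set (t := periodCLM L '' K) ?_ (image_mono hsub)
    refine ContinuousOn.integrableOn_compact (hKc.image (periodCLM L).continuous) (hf.mono ?_)
    exact hmaps.image_subset
  have hint' : IntegrableOn F (periodCLM L '' unitSquare) :=
    hint.congr (ae_restrict_of_ae hae.symm)
  have hfd := ZSpan.isAddFundamentalDomain L.basis volume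
  refine ⟨(hfd.integrableOn_iff isAddFundamentalDomain_image hper).2 hint', ?_⟩
  rw [hfd.setIntegral_eq isAddFundamentalDomain_image hper,
    integral_congr_ae (ae_restrict_of_ae hae),
    integral_image_eq_integral_abs_det_fderiv_smul volume hmeas
      (fun x _ => (periodCLM L).hasFDerivAt.hasFDerivWithinAt) injective_periodCLM.injOn]
  simp only [det_periodCLM, abs_of_pos hdet, smul_eq_mul]
  let G : ℝ × ℝ → ℝ := fun q => latticeDet (periods L) * f ((q.1 : ℂ) * L.ω₁ + q.2 * L.ω₂)
  have h1 := Complex.volume_preserving_equiv_real_prod.setIntegral_preimage_emb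
    Complex.measurableEquivRealProd.measurableEmbedding G
    (Ico (-(1 / 2)) (1 / 2) ×ˢ Ico (-(1 / 2)) (1 / 2))
  have h2 : Complex.measurableEquivRealProd ⁻¹' (Ico (-(1 / 2)) (1 / 2) ×ˢ Ico (-(1 / 2)) (1 / 2)) =
      unitSquare := rfl
  have h3 : ∀ z, G (Complex.measurableEquivRealProd z) =
      latticeDet (periods L) * f (periodCLM L z) := fun z => by
    rw [periodCLM_apply]; rfl
  simp only [h2, h3] at h1
  rw [h1]
  have hGc : ContinuousOn G (Icc (-(1 / 2)) (1 / 2) ×ˢ Icc (-(1 / 2)) (1 / 2)) := by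
    refine continuousOn_const.mul (hf.comp (Continuous.continuousOn (by fun_prop)) ?_)
    exact fun q hq => parallelogram_subset hq.1 hq.2
  have hGi : IntegrableOn G (Ico (-(1 / 2)) (1 / 2) ×ˢ Ico (-(1 / 2)) (1 / 2))
      ((volume : Measure ℝ).prod volume) :=
    (hGc.integrableOn_compact (isCompact_Icc.prod isCompact_Icc)).mono_set
      (prod_mono Ico_subset_Icc_self Ico_subset_Icc_self)
  rw [Measure.volume_eq_prod, setIntegral_prod _ hGi]
  rw [intervalIntegral.integral_of_le (by norm_num), integral_Ico_eq_integral_Ioc]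
  refine setIntegral_congr_fun measurableSet_Ioc fun s _ => ?_
  rw [intervalIntegral.integral_of_le (by norm_num), integral_Ico_eq_integral_Ioc]

end ParallelogramIntegral

namespace Params

variable {L : PeriodPair} {p : Params}

theorem laplacian_add_periodic {D : ℂ → ℝ} {l : ℂ} (hD : ∀ z, D (z + l) = D z) (z : ℂ) :
    Laplacian.laplacian D (z + l) = Laplacian.laplacian D z := by
  have h : (fun w => D (w + l)) = D := funext hD
  conv_rhs => rw [← h]
  simp only [InnerProductSpace.laplacian_eq_iteratedFDeriv_complexPlane,
    iteratedFDeriv_comp_add_right]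

theorem laplacian_log_norm {z : ℂ} (hz : z ≠ 0) :
    Laplacian.laplacian (fun w : ℂ => Real.log ‖w‖) z = 0 :=
  ((analyticAt_id (𝕜 := ℂ)).harmonicAt_log_norm hz).2.self_of_nhds

/-- In conformal coordinates K dM = −½ Δ log E du dv. Off the lattice log E and log(|z|⁸E) have
equal Laplacians because log|z| is harmonic, and the latter function is smooth across the end, so
the value is −½·16π. -/
theorem hasTotalCurvature (hdet : 0 < latticeDet (periods L)) (hp : p.OnCurve)
    (hU : Uniformizes L p.lam) (hb : p.b ≠ 0) (hl : p.l ≠ 0)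
    (hE : ∀ z, z ∉ L.lattice → 0 < p.density L z) :
    HasTotalCurvature L (p.surface (periods L)) (-(8 * Real.pi)) := by
  set D : ℂ → ℝ := fun z => Real.log (p.density L z) with hDdef
  set S : ℂ → ℝ := fun z => Real.log (p.endDensity L z) with hSdef
  have hS : ∀ z ∈ ((L.lattice : Set ℂ) \ {0})ᶜ, ContDiffAt ℝ ∞ S z := fun z hz =>
    (contDiffAt_endDensity hz).log (endDensity_pos hb hl hE hz).ne'
  have hD : ∀ z, ∀ l ∈ L.lattice, D (z + l) = D z := fun z l hl => by
    simp only [hDdef, density_add hl]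
  have hne : ∀ z, z ∉ L.lattice → z ≠ 0 := fun z hz h => hz (h ▸ zero_mem _)
  have hSD : ∀ z, z ∉ L.lattice → S z = D z + 8 * Real.log ‖z‖ := fun z hz => by
    simp only [hDdef, hSdef]
    rw [endDensity_eq (hne z hz), Real.log_mul (pow_ne_zero _ (norm_ne_zero_iff.2 (hne z hz)))
      (hE z hz).ne', Real.log_pow]
    push_cast
    ring
  have hlap : ∀ z, z ∉ L.lattice → Laplacian.laplacian D z = Laplacian.laplacian S z := by
    intro z hz
    have h1 : S =ᶠ[𝓝 z] D + (8 : ℝ) • fun w : ℂ => Real.log ‖w‖ := by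
      filter_upwards [(isOpen_compl_lattice L).mem_nhds hz] with w hw
      simp [hSD w hw]
    have h2 : D =ᶠ[𝓝 z] S - (8 : ℝ) • fun w : ℂ => Real.log ‖w‖ := by
      filter_upwards [h1] with w hw
      simp [hw]
    have hlog : ContDiffAt ℝ 2 (fun w : ℂ => Real.log ‖w‖) z :=
      ((analyticAt_id (𝕜 := ℂ)).harmonicAt_log_norm (hne z hz)).1
    have hS2 : ContDiffAt ℝ 2 S z := (hS z fun h => hz h.1).of_le (by norm_cast)
    rw [(InnerProductSpace.laplacian_congr_nhds h2).self_of_nhds,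
      ContDiffAt.laplacian_sub (f₂ := (8 : ℝ) • fun w : ℂ => Real.log ‖w‖) hS2
        (hlog.const_smul (8 : ℝ)), InnerProductSpace.laplacian_smul _ hlog,
      laplacian_log_norm (hne z hz)]
    simp
  have hmet : ∀ z, z ∉ L.lattice →
      inducedMetric (p.surface (periods L)) z 1 1 = p.density L z := fun z hz => by
    rw [inducedMetric_surface hp hU hz]; simp
  have hcurv : ∀ z, z ∉ L.lattice →
      curvatureDensity (p.surface (periods L)) z = -(1 / 2) * Laplacian.laplacian D z := by
    intro z hz
    have h1 : (fun w => Real.log (inducedMetric (p.surface (periods L)) w 1 1)) =ᶠ[𝓝 z] D := by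
      filter_upwards [(isOpen_compl_lattice L).mem_nhds hz] with w hw
      rw [hmet w hw]
    have h2 : metricDet (p.surface (periods L)) z = p.density L z ^ 2 := by
      simp only [metricDet, inducedMetric_surface hp hU hz]
      simp
      ring
    rw [curvatureDensity, gaussCurvature, h2, Real.sqrt_sq (hE z hz).le, hmet z hz,
      (InnerProductSpace.laplacian_congr_nhds h1).self_of_nhds]
    have := (hE z hz).ne'
    field_simp
  have hcont : ContinuousOn (fun z => -(1 / 2) * Laplacian.laplacian S z)
      ((L.lattice : Set ℂ) \ {0})ᶜ := by
    refine continuousOn_const.mul fun z hz => ContinuousAt.continuousWithinAt ?_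
    have h1 : ContDiffAt ℝ 0 (fun w => fderiv ℝ (fderiv ℝ S) w) z :=
      ((hS z hz).fderiv_right (m := ∞) (by simp)).fderiv_right (m := 0) (by simp)
    have h2 : Laplacian.laplacian S = fun w => fderiv ℝ (fderiv ℝ S) w 1 1 +
        fderiv ℝ (fderiv ℝ S) w Complex.I Complex.I := by
      rw [InnerProductSpace.laplacian_eq_iteratedFDeriv_complexPlane]
      funext w
      simp [iteratedFDeriv_two_apply]
    rw [h2]
    have h3 := h1.continuousAt
    exact ((h3.clm_apply continuousAt_const).clm_apply continuousAt_const).add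
      ((h3.clm_apply continuousAt_const).clm_apply continuousAt_const)
  obtain ⟨h1, h2⟩ := setIntegral_fundamentalDomain hdet
    (F := fun z => -(1 / 2) * Laplacian.laplacian D z)
    (fun l hl z => by simp only [laplacian_add_periodic fun z => hD z l hl])
    (fun z hz => by simp only [hlap z hz]) hcont
  have hae : curvatureDensity (p.surface (periods L)) =ᵐ[volume]
      fun z => -(1 / 2) * Laplacian.laplacian D z := by
    filter_upwards [(countable_lattice (L := L)).ae_notMem volume] with z hz
    exact hcurv z hz
  refine ⟨h1.congr (ae_restrict_of_ae hae.symm), ?_⟩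
  rw [integral_congr_ae (ae_restrict_of_ae hae), h2]
  have h3 := integral2_laplacian hdet hS hD hSD
  have h4 : ∀ x y : ℝ, x * (-(1 / 2) * y) = -(1 / 2) * (x * y) := fun x y => by ring
  simp only [h4, intervalIntegral.integral_const_mul]
  simp only [intervalIntegral.integral_const_mul] at h3
  rw [h3]
  ring

end Params

end

section

/-! ### Congruence of surfaces -/

theorem exists_curveY_ne_zero (L : PeriodPair) : ∃ z, z ∉ L.lattice ∧ curveY L z ≠ 0 := by
  have h2 : 2 * (L.ω₁ / 4) ∉ L.lattice := by
    rw [show 2 * (L.ω₁ / 4) = L.ω₁ / 2 by ring]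
    exact L.ω₁_div_two_notMem_lattice
  have h1 : L.ω₁ / 4 ∉ L.lattice := fun h3 => h2 (by rw [two_mul]; exact add_mem h3 h3)
  exact ⟨L.ω₁ / 4, h1, mul_ne_zero (by norm_num) (derivWeierstrassP_ne_zero h1 h2)⟩

/-- The derivative is a·y, evaluated at a point where y ≠ 0. -/
theorem eq_zero_of_linear {L : PeriodPair} {lam a c : ℂ}
    (h : ∀ z, z ∉ L.lattice → a * curveX L lam z + c = 0) : a = 0 ∧ c = 0 := by
  obtain ⟨z, hz, hy⟩ := exists_curveY_ne_zero L
  have hzero : (fun z => a * curveX L lam z + c) =ᶠ[𝓝 z] fun _ => 0 := by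
    filter_upwards [(isOpen_compl_lattice L).mem_nhds hz] with w hw
    exact h w hw
  have hd := ((hasDerivAt_curveX lam hz).const_mul a).add_const c
  have ha := (mul_eq_zero.1
    (hd.unique ((hasDerivAt_const z (0 : ℂ)).congr_of_eventuallyEq hzero))).resolve_right hy
  have h1 := h z hz
  rw [ha, zero_mul, zero_add] at h1
  exact ⟨ha, h1⟩

namespace Params

variable {L M : PeriodPair} {p q : Params}

/-- Differentiation removes the translation; the real differential applied to 1 and i recovers the
real and imaginary parts of the holomorphic form. -/
theorem formVec_eq_of_surface_eq (hp : Uniformizes L p.lam) (hq : Uniformizes M q.lam)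
    {α : ℂ} {r : ℝ} {w : Mink} (hlat : ∀ z, z ∈ L.lattice ↔ α * z ∈ M.lattice)
    (hX : ∀ z, z ∉ L.lattice →
      q.surface (periods M) (α * z) = r • p.surface (periods L) z + w)
    {z : ℂ} (hz : z ∉ L.lattice) (i : Fin 4) :
    q.formVec (curveX M q.lam (α * z)) (curveY M (α * z)) i * α =
      r * p.formVec (curveX L p.lam z) (curveY L z) i := by
  have hz' : α * z ∉ M.lattice := fun h => hz ((hlat z).2 h)
  have hd : ∀ {p : Params} {L : PeriodPair} {z : ℂ}, Uniformizes L p.lam → z ∉ L.lattice →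
      DifferentiableAt ℝ (p.surface (periods L)) z := fun h hz =>
    ((contDiffOn_surface h).contDiffAt ((isOpen_compl_lattice _).mem_nhds hz)).differentiableAt
      (by simp)
  have h1 : HasFDerivAt (fun u => q.surface (periods M) (α * u)) _ z :=
    (hd hq hz').hasFDerivAt.comp z
      (((hasDerivAt_id' z).const_mul α).hasFDerivAt.restrictScalars ℝ)
  have h2 := ((hd hp hz).hasFDerivAt.const_smul r).add_const w
  have h3 : (fun u => q.surface (periods M) (α * u)) =ᶠ[𝓝 z]
      fun u => r • p.surface (periods L) u + w := by
    filter_upwards [(isOpen_compl_lattice L).mem_nhds hz] with u hu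
    exact hX u hu
  have h4 := h1.unique (h2.congr_of_eventuallyEq h3)
  have h5 : ∀ a : ℂ, (q.formVec (curveX M q.lam (α * z)) (curveY M (α * z)) i * (α * a)).re =
      r * (p.formVec (curveX L p.lam z) (curveY L z) i * a).re := fun a => by
    have h6 := congrFun (DFunLike.congr_fun h4 a) i
    simp only [ContinuousLinearMap.comp_apply, smul_apply, Pi.smul_apply, smul_eq_mul,
      fderiv_surface hp hz] at h6
    have h7 := fderiv_surface hq hz' (α * a) i
    simp only [mul_one, ContinuousLinearMap.coe_restrictScalars',
      ContinuousLinearMap.toSpanSingleton_apply, smul_eq_mul, mul_comm a α] at h6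
    rw [h7] at h6
    linarith
  have e1 := h5 1
  have e2 := h5 Complex.I
  rw [mul_one, mul_one] at e1
  rw [← mul_assoc, Complex.mul_I_re, Complex.mul_I_re] at e2
  refine Complex.ext ?_ ?_
  · rw [e1, Complex.re_ofReal_mul]
  · rw [Complex.im_ofReal_mul]
    linarith

/-- A surface determines the parameters `b` and `y₀`, up to homotheties and reparametrizations. -/
theorem eq_of_surface_eq (hp : Uniformizes L p.lam) (hq : Uniformizes M q.lam)
    (hpre : p.lam.re < 0) (hqre : q.lam.re < 0) (hb : p.b ≠ 0)
    {α : ℂ} {r : ℝ} {w : Mink} (hα : α ≠ 0) (hr : 0 < r)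
    (hlat : ∀ z, z ∈ L.lattice ↔ α * z ∈ M.lattice)
    (hX : ∀ z, z ∉ L.lattice →
      q.surface (periods M) (α * z) = r • p.surface (periods L) z + w) :
    p.b = q.b ∧ p.y₀ = q.y₀ := by
  have hform := fun (z : ℂ) (hz : z ∉ L.lattice) =>
    formVec_eq_of_surface_eq hp hq hlat hX hz
  simp only [Fin.forall_fin_succ, formVec, Matrix.cons_val_zero, Matrix.cons_val_succ,
    IsEmpty.forall_iff, and_true] at hform
  have hx : ∀ z, curveX M q.lam (α * z) =
      (α ^ 2)⁻¹ * (curveX L p.lam z - (1 + p.lam) / 3) + (1 + q.lam) / 3 := fun z => by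
    simp only [curveX, weierstrassP_mul hα hlat]
    ring
  have hy : ∀ z, curveY M (α * z) = (α ^ 3)⁻¹ * curveY L z := fun z => by
    simp only [curveY, derivWeierstrassP_mul hα hlat]
    ring
  have hξ : ∀ z, z ∉ L.lattice → (curveX M q.lam (α * z) - q.x₀) * α =
      r * (curveX L p.lam z - p.x₀) := fun z hz => by
    obtain ⟨h0, h1, -⟩ := hform z hz
    linear_combination h0 / 2 + Complex.I / 2 * h1 + (1 / 2 *
      ((curveX M q.lam (α * z) - q.x₀ - q.wVal (curveX M q.lam (α * z)) (curveY M (α * z))) * α -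
      r * (curveX L p.lam z - p.x₀ - p.wVal (curveX L p.lam z) (curveY L z)))) * Complex.I_sq
  have hh : ∀ z, z ∉ L.lattice → q.hVal (curveX M q.lam (α * z)) (curveY M (α * z)) * α =
      r * p.hVal (curveX L p.lam z) (curveY L z) := fun z hz => by
    obtain ⟨-, -, h2, h3⟩ := hform z hz
    linear_combination h2 / 2 + h3 / 2
  obtain ⟨h1, h2⟩ := eq_zero_of_linear (L := L) (lam := p.lam) (a := α⁻¹ - r)
    (c := (-(α ^ 2)⁻¹ * ((1 + p.lam) / 3) + (1 + q.lam) / 3 - q.x₀) * α + r * p.x₀)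
    (fun z hz => by
      have := hξ z hz
      rw [hx] at this
      rw [← sub_eq_zero] at this
      rw [← this]
      field_simp
      ring)
  have hα' : α = (r : ℂ)⁻¹ := by rw [← sub_eq_zero.1 h1, inv_inv]
  have hrc : (r : ℂ) ≠ 0 := Complex.ofReal_ne_zero.2 hr.ne'
  set d : ℂ := (1 + q.lam) / 3 - r ^ 2 * ((1 + p.lam) / 3) with hd
  have hx' : ∀ z, curveX M q.lam (α * z) = r ^ 2 * curveX L p.lam z + d := fun z => by
    rw [hx, hα', hd]
    field_simp
    ring
  have hy' : ∀ z, curveY M (α * z) = r ^ 3 * curveY L z := fun z => by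
    rw [hy, hα']
    field_simp
  -- Insert x ↦ r²x + d, y ↦ r³y in the second curve and compare with r⁶ times the first. The terms
  -- in x² cancel by the definition of d, leaving an affine function of x; its vanishing shows that
  -- branch points go to branch points.
  obtain ⟨h3, h4⟩ := eq_zero_of_linear (L := L) (lam := p.lam)
    (a := r ^ 2 * (d * (d - 1) + d * (d - q.lam) + (d - 1) * (d - q.lam)) - r ^ 6 * p.lam)
    (c := d * (d - 1) * (d - q.lam)) (fun z hz => by
      have e1 := hq.2.2 (α * z) fun h => hz ((hlat z).2 h)
      have e2 := hp.2.2 z hz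
      rw [hx', hy'] at e1
      have e3 : 3 * d = (1 + q.lam) - r ^ 2 * (1 + p.lam) := by rw [hd]; ring
      linear_combination -e1 + r ^ 6 * e2 - r ^ 4 * curveX L p.lam z ^ 2 * e3)
  have hroot : ∀ X : ℂ, X * (X - 1) * (X - p.lam) = 0 →
      (r ^ 2 * X + d) * (r ^ 2 * X + d - 1) * (r ^ 2 * X + d - q.lam) = 0 := fun X hX => by
    have e3 : 3 * d = (1 + q.lam) - r ^ 2 * (1 + p.lam) := by rw [hd]; ring
    linear_combination r ^ 6 * hX + X * h3 + h4 + r ^ 4 * X ^ 2 * e3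
  have hr2 : 0 < r ^ 2 := by positivity
  have hre : ∀ X : ℂ, ((r : ℂ) ^ 2 * X).re = r ^ 2 * X.re := fun X => by
    rw [← Complex.ofReal_pow, Complex.re_ofReal_mul]
  have hcases : ∀ X : ℂ, X * (X - 1) * (X - p.lam) = 0 →
      r ^ 2 * X + d = 0 ∨ r ^ 2 * X + d = 1 ∨ r ^ 2 * X + d = q.lam := fun X hX => by
    rcases mul_eq_zero.1 (hroot X hX) with h | h
    · rcases mul_eq_zero.1 h with h | h
      · exact Or.inl h
      · exact Or.inr (Or.inl (sub_eq_zero.1 h))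
    · exact Or.inr (Or.inr (sub_eq_zero.1 h))
  have c0 := hcases 0 (by ring)
  have c1 := hcases 1 (by ring)
  have cl := hcases p.lam (by ring)
  rw [mul_zero, zero_add] at c0
  have hrel : r ^ 2 * p.lam.re < 0 := mul_neg_of_pos_of_neg hr2 hpre
  -- The map is increasing in the real part, and 0 lies strictly between λ and 1 in real part. If 0
  -- went to 1, the image of 1 would lie too far right; if it went to the other λ, the image of λ
  -- would lie too far left.
  have hd0 : d = 0 := by
    rcases c0 with h | h | h
    · exact h
    · exfalso
      rw [h] at c1
      rcases c1 with h | h | h <;> have h := congrArg Complex.re h <;>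
        simp only [Complex.add_re, hre, Complex.one_re, Complex.zero_re] at h <;> linarith
    · exfalso
      rw [h] at cl
      rcases cl with h | h | h <;> have h := congrArg Complex.re h <;>
        simp only [Complex.add_re, hre, Complex.one_re, Complex.zero_re] at h <;> linarith
  have hr1 : r = 1 := by
    rw [hd0] at c1
    have : r ^ 2 = 1 := by
      rcases c1 with h | h | h <;> have h := congrArg Complex.re h <;>
        simp only [Complex.add_re, hre, Complex.one_re, Complex.zero_re] at h <;> linarith
    exact (pow_eq_one_iff_of_nonneg hr.le two_ne_zero).1 this
  subst hr1
  simp only [Complex.ofReal_one, inv_one] at hα'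
  subst hα'
  simp only [Complex.ofReal_one, one_pow, one_mul, mul_one, hd0, add_zero] at hx' hy' hξ hh
  have hx₀ : p.x₀ = q.x₀ := by
    obtain ⟨z, hz, -⟩ := exists_curveY_ne_zero L
    have := hξ z hz
    rw [hx'] at this
    linear_combination this
  simp only [hVal, hx', hy', ← hx₀] at hh
  -- The values at z and −z separate the odd part by of h from its even part.
  have hbb : p.b = q.b := by
    obtain ⟨z, hz, hy0⟩ := exists_curveY_ne_zero L
    have e1 := hh z hz
    have e2 := hh (-z) (fun h => hz (by simpa using neg_mem h))
    simp only [curveX, curveY, L.weierstrassP_neg, L.derivWeierstrassP_neg] at e1 e2 hy0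
    refine mul_right_cancel₀ hy0 ?_
    linear_combination e2 / 2 - e1 / 2
  obtain ⟨h5, h6⟩ := eq_zero_of_linear (L := L) (lam := p.lam) (a := q.c - p.c)
    (c := p.b * (p.y₀ - q.y₀) - (q.c - p.c) * p.x₀) (fun z hz => by
      have := hh z hz
      rw [← hbb] at this
      linear_combination this)
  rw [h5, zero_mul, sub_zero] at h6
  exact ⟨hbb, sub_eq_zero.1 ((mul_eq_zero.1 h6).resolve_left hb)⟩

end Params

end

section

/-! ### The family of surfaces -/

/-- The parameters among the coordinates `(b, y₀, ω₁, ω₂, λ, l, c, m, x₀)`. -/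
def toParams (v : Fin 9 → ℂ) : Params := ⟨v 0, v 6, v 5, v 7, v 8, v 1, v 4⟩

open Classical in
/-- The period pair among the coordinates, if it generates a lattice. -/
def toPeriodPair (v : Fin 9 → ℂ) : PeriodPair :=
  if h : latticeDet (v 2, v 3) ≠ 0 then pairOf (v 2, v 3) h else squarePair

theorem periods_toPeriodPair {v : Fin 9 → ℂ} (h : 0 < latticeDet (v 2, v 3)) :
    periods (toPeriodPair v) = (v 2, v 3) := by
  rw [toPeriodPair, dif_pos h.ne', periods_pairOf]

/-- The parameters and periods to which the estimates apply. -/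
def closeSet : Set (Fin 9 → ℂ) := {v | (toParams v).IsClose ∧ 0 < latticeDet (v 2, v 3)}

theorem closeSet_mem_nhds : closeSet ∈ 𝓝 basePoint := by
  have hr : 0 < rho ^ 4 / 1000 := by have := rho_pos; positivity
  have h1 : ∀ᶠ v in 𝓝 basePoint, dist v basePoint < rho ^ 4 / 1000 := Metric.ball_mem_nhds _ hr
  have hdet : 0 < latticeDet (basePoint 2, basePoint 3) := by
    simpa [basePoint, latticeDet] using side_pos.ne'
  have hc : Continuous fun v : Fin 9 → ℂ => latticeDet (v 2, v 3) :=
    continuous_latticeDet.comp (by fun_prop)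
  filter_upwards [h1, hc.continuousAt.eventually (lt_mem_nhds hdet)] with v hv hv'
  have h2 : ∀ i, ‖v i - basePoint i‖ ≤ rho ^ 4 / 1000 := fun i =>
    (dist_eq_norm (v i) _).symm.le.trans ((dist_le_pi_dist v basePoint i).trans hv.le)
  refine ⟨⟨?_, ?_, ?_, ?_, ?_, ?_, ?_⟩, hv'⟩
  · simpa [basePoint, toParams] using h2 0
  · simpa [basePoint, toParams] using h2 6
  · simpa [basePoint, toParams] using h2 5
  · simpa [basePoint, toParams] using h2 7
  · simpa [basePoint, toParams] using h2 8
  · simpa [basePoint, toParams] using h2 1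
  · simpa [basePoint, toParams] using h2 4

/-- The equations of the family, for parameters to which the estimates apply. -/
structure IsSolution (v : Fin 9 → ℂ) : Prop where
  isClose : (toParams v).IsClose
  latticeDet_pos : 0 < latticeDet (v 2, v 3)
  onCurve : (toParams v).OnCurve
  uniformizes : Uniformizes (toPeriodPair v) (v 4)
  periodCondition : (toParams v).PeriodCondition (periods (toPeriodPair v))

theorem isSolution_of_periodMap {v : Fin 9 → ℂ} {t : EuclideanSpace ℝ (Fin 4)} (hv : v ∈ closeSet)
    (h : periodMap v = familyPoint t) : IsSolution v := by
  obtain ⟨hc, hdet⟩ := hv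
  have hper := periods_toPeriodPair hdet
  have hre : v 4 ≠ 0 ∧ v 4 ≠ 1 := by
    have h1 : (v 4).re < 0 := hc.lam_re_neg
    constructor <;> intro h2 <;> rw [h2] at h1 <;> norm_num at h1
  have e2 := congrFun h 2
  have e3 := congrFun h 3
  have e4 := congrFun h 4
  have e5 := congrFun h 5
  have e6 := congrFun h 6
  have e7 := congrFun h 7
  have e8 := congrFun h 8
  simp only [periodMap, familyPoint, Matrix.cons_val] at e2 e3 e4 e5 e6 e7 e8
  have hsplit : ∀ {a c : ℝ}, (a : ℂ) + c * Complex.I = 0 → a = 0 ∧ c = 0 := fun {a c} h => by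
    have h1 := congrArg Complex.re h
    have h2 := congrArg Complex.im h
    simp at h1 h2
    exact ⟨h1, h2⟩
  refine ⟨hc, hdet, ?_, ?_, ?_⟩
  · exact sub_eq_zero.1 e4
  · refine uniformizes_of_halfValue hre.1 hre.2 ?_ ?_
    · rw [hper]; exact sub_eq_zero.1 e2
    · rw [hper]; exact sub_eq_zero.1 e3
  · rw [hper]
    rintro X q (⟨rfl, rfl⟩ | ⟨rfl, rfl⟩)
    · exact ⟨e5, (hsplit e7).1, (hsplit e8).1⟩
    · exact ⟨e6, (hsplit e7).2, (hsplit e8).2⟩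

theorem IsSolution.density_pos {v : Fin 9 → ℂ} (h : IsSolution v) (z : ℂ)
    (hz : z ∉ (toPeriodPair v).lattice) : 0 < (toParams v).density (toPeriodPair v) z :=
  mul_pos (by norm_num) (h.isClose.energy_pos h.onCurve (h.uniformizes.2.2 z hz))

/-- Joint smoothness is the reason for defining ζ, ℘ and ℘' as functions of the point and the
periods together. -/
theorem contDiffOn_surface_joint : ContDiffOn ℝ ∞
    (fun q : (Fin 9 → ℂ) × ℂ => (toParams q.1).surface (q.1 2, q.1 3) q.2)
    {q | (q.2, (q.1 2, q.1 3)) ∈ zetaDomain} := by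
  intro q hq
  refine ContDiffAt.contDiffWithinAt ?_
  have hm : ContDiffAt ℝ ∞ (fun q : (Fin 9 → ℂ) × ℂ => (q.2, (q.1 2, q.1 3))) q := by fun_prop
  have hc : ∀ f : ℂ × ℂ × ℂ → ℂ, ContDiffOn ℂ ∞ f zetaDomain →
      ContDiffAt ℝ ∞ (fun q : (Fin 9 → ℂ) × ℂ => f (q.2, (q.1 2, q.1 3))) q := fun f hf =>
    ContDiffAt.comp (g := f) (f := fun q : (Fin 9 → ℂ) × ℂ => (q.2, (q.1 2, q.1 3))) q
      ((hf.contDiffAt (isOpen_zetaDomain.mem_nhds hq)).restrict_scalars ℝ) hm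
  have h1 := hc _ contDiffOn_zeta
  have h2 := hc _ contDiffOn_wpFun
  have h3 := hc _ contDiffOn_wpDeriv
  have hre : ∀ f : (Fin 9 → ℂ) × ℂ → ℂ, ContDiffAt ℝ ∞ f q →
      ContDiffAt ℝ ∞ (fun q => 2 * (f q).re) q := fun f hf =>
    contDiffAt_const.mul (Complex.reCLM.contDiff.contDiffAt.comp q hf)
  rw [contDiffAt_pi]
  intro i
  refine hre _ ?_
  fin_cases i <;> simp only [Params.primVec, Params.primP, Params.primW, Params.primH, Params.primN,
    primX, toParams, Matrix.cons_val, Fin.reduceFinMk, Fin.zero_eta, Fin.mk_one,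
    div_eq_mul_inv] <;> fun_prop

/-- The parameter of the family, recovered from `b` and `y₀`. -/
def familyParam (u : Fin 6 → ℂ) : EuclideanSpace ℝ (Fin 4) :=
  !₂[(u 0).re - rho, (u 0).im, (u 4).re, (u 4).im]

theorem contDiff_familyParam : ContDiff ℝ ∞ familyParam := by
  rw [contDiff_euclidean]
  have hre : ∀ i : Fin 6, ContDiff ℝ ∞ fun u : Fin 6 → ℂ => (u i).re := fun i =>
    Complex.reCLM.contDiff.comp (contDiff_apply ℝ ℂ i)
  have him : ∀ i : Fin 6, ContDiff ℝ ∞ fun u : Fin 6 → ℂ => (u i).im := fun i =>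
    Complex.imCLM.contDiff.comp (contDiff_apply ℝ ℂ i)
  intro i
  fin_cases i
  · exact (hre 0).sub contDiff_const
  · exact him 0
  · exact hre 4
  · exact him 4

/-- The parameter is read off from b and y₀: a smooth left inverse of the coordinates, which yields
immersion, embedding and effectiveness alike. -/
theorem familyParam_coord {v : Fin 9 → ℂ} {t : EuclideanSpace ℝ (Fin 4)}
    (h : periodMap v = familyPoint t) : familyParam (toParams v).coord = t := by
  have e0 := congrFun h 0
  have e1 := congrFun h 1
  simp only [periodMap, familyPoint, Matrix.cons_val] at e0 e1
  ext i
  fin_cases i <;> simp [familyParam, toParams, Params.coord, e0, e1]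

end

end StationarySurface

end

open StationarySurface

theorem theorem6p1 :
    ∃ (B : Set (EuclideanSpace ℝ (Fin 4))) (p : EuclideanSpace ℝ (Fin 4) → Params)
      (L : EuclideanSpace ℝ (Fin 4) → PeriodPair)
      (X : EuclideanSpace ℝ (Fin 4) → ℂ → Mink),
      IsOpen B ∧ IsPreconnected B ∧ (0 : EuclideanSpace ℝ (Fin 4)) ∈ B ∧
      -- the parameters form a smoothly embedded real four-dimensional family in `ℂ⁶`
      ContDiffOn ℝ ∞ (fun t => (p t).coord) B ∧
      ContDiffOn ℝ ∞ (fun t => (p t).x₀) B ∧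
      (∀ t ∈ B, Function.Injective (fderiv ℝ (fun t => (p t).coord) t)) ∧
      Topology.IsEmbedding (B.domRestrict fun t => (p t).coord) ∧
      -- the tori and the surfaces depend smoothly on the parameter
      ContDiffOn ℝ ∞ (fun t => ((L t).ω₁, (L t).ω₂)) B ∧
      ContDiffOn ℝ ∞ (fun q : EuclideanSpace ℝ (Fin 4) × ℂ => X q.1 q.2)
        {q | q.1 ∈ B ∧ q.2 ∉ (L q.1).lattice} ∧
      -- the member at `t = 0` is, up to scale, the Chen-Gackstatter surface
      p 0 = ⟨rho, 0, -rho, 0, 0, 0, -1⟩ ∧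
      IsChenGackstatter (L 0) (fun z => rho⁻¹ • X 0 z) ∧
      -- each member is a complete algebraic stationary surface of genus one with one end, total
      -- curvature `-∫ K dM = 8π`, and Gauss maps of order one at the end
      (∀ t ∈ B, (p t).Admissible ∧ Uniformizes (L t) (p t).lam ∧
        IsAlgebraicRepresentation (L t) ((p t).phi (L t)) ((p t).psi (L t))
          ((p t).height (L t)) (X t) ∧
        IsCompleteStationary (L t) (X t) ∧
        HasTotalCurvature (L t) (X t) (-(8 * Real.pi)) ∧
        meromorphicOrderAt ((p t).phi (L t)) 0 = 1 ∧
        meromorphicOrderAt ((p t).psi (L t)) 0 = -1) ∧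
      -- different members differ, even up to translation, scaling and conformal reparametrization
      (∀ s ∈ B, ∀ t ∈ B, ∀ (α : ℂ) (r : ℝ) (w : Mink), α ≠ 0 → 0 < r →
        (∀ z, z ∈ (L s).lattice ↔ α * z ∈ (L t).lattice) →
        (∀ z, z ∉ (L s).lattice → X t (α * z) = r • X s z + w) → s = t) := by
  obtain ⟨r, hr, g, hg0, hg, hgN⟩ := exists_family closeSet_mem_nhds
  have hsol : ∀ t ∈ Metric.ball (0 : EuclideanSpace ℝ (Fin 4)) r, IsSolution (g t) := fun t ht =>
    isSolution_of_periodMap (hgN t ht).2 (hgN t ht).1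
  have hper : ∀ t ∈ Metric.ball (0 : EuclideanSpace ℝ (Fin 4)) r,
      periods (toPeriodPair (g t)) = (g t 2, g t 3) := fun t ht =>
    periods_toPeriodPair (hsol t ht).latticeDet_pos
  have hgi : ∀ i, ContDiffOn ℝ ∞ (fun t => g t i) (Metric.ball 0 r) := contDiffOn_pi.1 hg
  have hcoord : ContDiffOn ℝ ∞ (fun t => (toParams (g t)).coord) (Metric.ball 0 r) := by
    rw [contDiffOn_pi]
    intro i
    fin_cases i
    exacts [hgi 0, hgi 6, hgi 5, hgi 7, hgi 1, hgi 4]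
  have hinv : ∀ t ∈ Metric.ball (0 : EuclideanSpace ℝ (Fin 4)) r,
      familyParam (toParams (g t)).coord = t := fun t ht => familyParam_coord (hgN t ht).1
  have h0 : (0 : EuclideanSpace ℝ (Fin 4)) ∈ Metric.ball 0 r := Metric.mem_ball_self hr
  have hp0 : toParams (g 0) = Params.chenGackstatter := by
    rw [hg0]
    simp [toParams, basePoint, Params.chenGackstatter]
  refine ⟨Metric.ball 0 r, fun t => toParams (g t), fun t => toPeriodPair (g t),
    fun t => (toParams (g t)).surface (periods (toPeriodPair (g t))), Metric.isOpen_ball,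
    (convex_ball _ _).isPreconnected, h0, hcoord, hgi 8, ?_, ?_, ?_, ?_, hp0, ?_, ?_, ?_⟩
  -- Differentiating the identity `familyParam ∘ coord = id` gives a left inverse of the derivative.
  · intro t ht
    have h1 : HasFDerivAt (fun t => (toParams (g t)).coord) _ t :=
      ((hcoord.contDiffAt (Metric.isOpen_ball.mem_nhds ht)).differentiableAt (by simp)).hasFDerivAt
    have h2 := (contDiff_familyParam.differentiable (by simp)
      (toParams (g t)).coord).hasFDerivAt.comp t h1
    have h3 : (familyParam ∘ fun t => (toParams (g t)).coord) =ᶠ[𝓝 t] id := by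
      filter_upwards [Metric.isOpen_ball.mem_nhds ht] with s hs
      exact hinv s hs
    have h4 := h2.unique ((hasFDerivAt_id t).congr_of_eventuallyEq h3)
    exact Function.LeftInverse.injective (g := fderiv ℝ familyParam (toParams (g t)).coord)
      fun v => DFunLike.congr_fun h4 v
  · refine Topology.IsEmbedding.of_comp hcoord.continuousOn.domRestrict
      contDiff_familyParam.continuous ?_
    have h1 : familyParam ∘ (Metric.ball (0 : EuclideanSpace ℝ (Fin 4)) r).domRestrict
        (fun t => (toParams (g t)).coord) = Subtype.val := funext fun t => hinv t t.2
    rw [h1]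
    exact Topology.IsEmbedding.subtypeVal
  · refine ((hgi 2).prodMk (hgi 3)).congr fun t ht => hper t ht
  · have h1 : ContDiffOn ℝ ∞ (fun q : EuclideanSpace ℝ (Fin 4) × ℂ => (g q.1, q.2))
        {q | q.1 ∈ Metric.ball 0 r ∧ q.2 ∉ (toPeriodPair (g q.1)).lattice} :=
      (hg.comp contDiffOn_fst fun q hq => hq.1).prodMk contDiffOn_snd
    refine (contDiffOn_surface_joint.comp h1 fun q hq => ?_).congr fun q hq => ?_
    · have h2 := mem_zetaDomain_iff.2 hq.2
      rw [hper _ hq.1] at h2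
      exact h2
    · simp only [hper _ hq.1, Function.comp_apply]
  · have h := hsol 0 h0
    have hE := h.density_pos
    have hU := h.uniformizes
    have hP := h.periodCondition
    have h4 : g 0 4 = -1 := by rw [hg0]; simp [basePoint]
    rw [h4] at hU
    simp only [hp0] at hE hP ⊢
    exact Params.isChenGackstatter hU hE hP
  · intro t ht
    have h := hsol t ht
    have hb := h.isClose.b_ne_zero
    have hl := h.isClose.l_ne_zero
    exact ⟨⟨hb, hl, h.onCurve⟩, h.uniformizes,
      Params.isAlgebraicRepresentation h.onCurve h.uniformizes hb hl h.density_pos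
        h.periodCondition,
      Params.isCompleteStationary h.onCurve h.uniformizes hb hl h.density_pos h.periodCondition,
      Params.hasTotalCurvature (by rw [hper t ht]; exact h.latticeDet_pos) h.onCurve h.uniformizes
        hb hl h.density_pos, Params.order_phi hb, Params.order_psi hl⟩
  -- Congruent members share b and y₀, from which t is recovered.
  · intro s hs t ht α a w hα ha hlat hX
    obtain ⟨hb, hy⟩ := Params.eq_of_surface_eq (hsol s hs).uniformizes (hsol t ht).uniformizes
      (hsol s hs).isClose.lam_re_neg (hsol t ht).isClose.lam_re_neg (hsol s hs).isClose.b_ne_zero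
      hα ha hlat hX
    rw [← hinv s hs, ← hinv t ht]
    simp [familyParam, Params.coord, hb, hy]
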